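/- Let $k$ be an integer with $1\le k\le 11$, put $\alpha=k/12$, $\xi=e^{\pi i k/6}$, $D=k/(12,k)$, and let $v=v_\eta^{2k}$ be the eta multiplier system, i.e. $\eta(Az)^{2k}=v(A)(cz+d)^k\eta(z)^{2k}$ for $A=\left(\begin{smallmatrix}a&b\\c&d\end{smallmatrix}\right)\in SL(2,\mathbb Z)$ (so $v\left(\begin{smallmatrix}1&1\\0&1\end{smallmatrix}\right)=\xi$). For $R\in\mathbb R$ and $w\in\{v,\bar v\}$ let $\mathcal M(w,k,R)$ be the space of smooth $f:\mathbb H\to\mathbb C$ with $e^{-ik\operatorname{Arg}(cz+d)}f(Az)=w(A)f(z)$ for all $A\in SL(2,\mathbb Z)$, with $\bigl(y^2(\partial_x^2+\partial_y^2)-iky\,\partial_x+\tfrac14+R^2\bigr)f=0$, and with $\int_{SL(2,\mathbb Z)\backslash\mathbb H}|f|^2\,\frac{dx\,dy}{y^2}<\infty$. For $n\in\mathbb Z$ put $$\mathcal W_{n}(z)=|n+\alpha|^{-1/2}\,W_{\frac k2\operatorname{sgn}(n+\alpha),\,iR}(4\pi|n+\alpha|y)\,e^{2\pi i(n+\alpha)x},$$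 where $W_{\kappa,\mu}$ is Whittaker's function. Let $E_\kappa^-=(z-\bar z)\frac{\partial}{\partial\bar z}+\frac \kappa2$, let $(Jf)(z)=f(-\bar z)$, and let $\Theta=J\circ E^-_{2-k}\circ\cdots\circ E^-_{k-2}\circ E^-_k$. Put $\chi_k(d)=i^{k(d-1)}$ and $$\Lambda_{k,R}=\begin{cases}\prod_{j=1}^{l}\left(j(j-1)+\tfrac14+R^2\right)^2,&k=2l,\\ -R^2\prod_{j=1}^{l}(j^2+R^2)^2,&k=2l+1.\end{cases}$$ For a positive integer $m$ with $km\equiv-k \pmod{12}$ put $$T^{\bar v}_m g(z)=\frac1{\sqrt m}\sum_{ad=m,\ d>0}\chi_k(d)\sum_{b=0}^{d-1}\xi^{bd}\,g\!\left(\frac{az+b}{d}\right),\qquad T^\Theta_m=T^{\bar v}_m\circ\Theta .$$ **Proposition.** Let $m$ be a positive integer with $km\equiv-k\pmod{12}$. 1. If $f\in\mathcal M(v,k,R)$, then $\Theta f\in\mathcal M(\bar v,k,R)$ and $T^\Theta_m f\in\mathcal M(v,k,R)$. 2. If moreover $f=\sum_{n\in\mathbb Z}c(n)\mathcal W_n$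 (convergent at every point of $\mathbb H$, unconditionally), then $T^\Theta_m f=\sum_{n\in\mathbb Z}d(n)\mathcal W_n$ in the same sense, where $$d(n)=(-1)^k\sum_{0<a\mid\left(m,\;n+\frac{k(m+1)}{12}\right)}\chi_k(a)\,\delta_a\,c\!\left(-\frac{mn}{a^2}-\frac{k(m+a^2)}{12a^2}\right),\qquad \delta_a=\begin{cases}1,&\frac{mn}{a^2}+\frac{k(m+a^2)}{12a^2}\ge1,\\ \Lambda_{k,R},&\text{otherwise.}\end{cases}$$ (Here $c(x)=0$ if $x$ is not an integer.) 3. If moreover $T^\Theta_mf=\mu_mf$ with $\mu_m\in\mathbb C$ and $c(0)\neq0$, then $$\mu_m=\frac{(-1)^k}{c(0)}\begin{cases}c\!\left(-\frac{k(1+m)}{12}\right),&(m,D)=1,\\[1mm] c\!\left(-\frac{k(1+m)}{12}\right)+\chi_k(D)\,c\!\left(-\frac{k(m+D^2)}{12D^2}\right),&(m,D)>1.\end{cases}$$ -/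

import Mathlib

open Complex UpperHalfPlane MeasureTheory
open scoped MatrixGroups Modular ContDiff Real

noncomputable section

namespace MaassEta

/-! ### Multiplier systems -/

/-- The automorphy factor `j_A(z;k) = e^{ik Arg(cz+d)}`. -/
def autoFactor (k : ℤ) (A : SL(2, ℤ)) (z : ℍ) : ℂ :=
  Complex.exp (Complex.I * k * (Complex.arg ((A 1 0 : ℂ) * (z : ℂ) + (A 1 1 : ℂ)) : ℂ))

/-- The eta multiplier system `v_η^{2k}`: the constant `v(A)` with
`η(Az)^{2k} = v(A) (cz+d)^k η(z)^{2k}` for all `z`, read off at `z = i`. -/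
def etaMult (k : ℕ) (A : SL(2, ℤ)) : ℂ :=
  ModularForm.eta ((A • UpperHalfPlane.I : ℍ) : ℂ) ^ (2 * k) /
    (((A 1 0 : ℂ) * Complex.I + (A 1 1 : ℂ)) ^ k * ModularForm.eta Complex.I ^ (2 * k))

/-- The conjugate multiplier system. -/
def etaMultBar (k : ℕ) (A : SL(2, ℤ)) : ℂ :=
  (starRingEnd ℂ) (etaMult k A)

/-! ### Maass waveforms -/

/-- `∂f/∂x` for `f : ℍ → ℂ`, where `z = x + iy`. -/
def dX (f : ℍ → ℂ) (z : ℍ) : ℂ :=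
  fderiv ℝ (fun w : ℂ => f (ofComplex w)) (z : ℂ) 1

/-- `∂f/∂y` for `f : ℍ → ℂ`, where `z = x + iy`. -/
def dY (f : ℍ → ℂ) (z : ℍ) : ℂ :=
  fderiv ℝ (fun w : ℂ => f (ofComplex w)) (z : ℂ) Complex.I

/-- The weight `k` Laplacian `Δ_k = y² (∂²/∂x² + ∂²/∂y²) - i k y ∂/∂x`. -/
def laplacian (k : ℤ) (f : ℍ → ℂ) (z : ℍ) : ℂ :=
  (z.im : ℂ) ^ 2 * (dX (dX f) z + dY (dY f) z) - Complex.I * k * (z.im : ℂ) * dX f z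

/-- Maass waveforms on the modular group of weight `k`, multiplier system `v` and spectral
parameter `R`. Square integrability is over the standard fundamental domain `𝒟` with respect to
the hyperbolic area `dx dy / y²`, which is the volume of `ℍ`. -/
structure IsMaassForm (v : SL(2, ℤ) → ℂ) (k : ℤ) (R : ℝ) (f : ℍ → ℂ) : Prop where
  smooth : ContDiffOn ℝ ∞ (fun w : ℂ => f (ofComplex w)) {w : ℂ | 0 < w.im}
  automorphic : ∀ (A : SL(2, ℤ)) (z : ℍ), (autoFactor k A z)⁻¹ * f (A • z) = v A * f z
  eigen : ∀ z : ℍ, laplacian k f z + (1 / 4 + (R : ℂ) ^ 2) * f z = 0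
  sq_integrable : IntegrableOn (fun z : ℍ => ‖f z‖ ^ 2) 𝒟 volume

/-! ### The Whittaker function and the Fourier basis functions -/

/-- The number of integrations by parts used in `tricomiU`: the least `N : ℕ` with
`Re a + N > 0`. -/
def regOrder (a : ℂ) : ℕ := ⌊1 - a.re⌋₊

/-- Tricomi's confluent hypergeometric function `U(a,c;t)` for `t > 0`. If `Re a > 0` then
`N = 0` and this is `Γ(a)⁻¹ ∫₀^∞ s^{a-1} e^{-ts} (1+s)^{c-a-1} ds`; for other `a` it is the
analytic continuation in `a` of that integral, obtained by `N` integrations by parts: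
`U(a,c;t) = Γ(a+N)⁻¹ ∫₀^∞ s^{a+N-1} (-d/ds)^N [e^{-ts} (1+s)^{c-a-1}] ds`. -/
def tricomiU (a c : ℂ) (t : ℝ) : ℂ :=
  (Complex.Gamma (a + regOrder a))⁻¹ *
    ∫ s in Set.Ioi (0 : ℝ), (s : ℂ) ^ (a + regOrder a - 1) *
      ((-1) ^ regOrder a *
        iteratedDeriv (regOrder a)
          (fun u : ℝ => Complex.exp (-(t : ℂ) * u) * (1 + (u : ℂ)) ^ (c - a - 1)) s)

/-- The Whittaker function `W_{κ,μ}(t) = e^{-t/2} t^{μ+1/2} U(μ-κ+1/2, 1+2μ; t)` for `t > 0`. -/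
def whittakerW (κ μ : ℂ) (t : ℝ) : ℂ :=
  Complex.exp (-(t : ℂ) / 2) * (t : ℂ) ^ (μ + 1 / 2) *
    tricomiU (μ - κ + 1 / 2) (1 + 2 * μ) t

/-- `𝒲_{n,k,R}(z) = |n+α|^{-1/2} W_{(k/2) sgn(n+α), iR}(4π|n+α|y) e((n+α)x)` with `α = k/12`. -/
def fourierW (k : ℕ) (R : ℝ) (n : ℤ) (z : ℍ) : ℂ :=
  ((1 / √|(n : ℝ) + k / 12| : ℝ) : ℂ) *
    whittakerW (((k : ℝ) / 2 * Real.sign ((n : ℝ) + k / 12) : ℝ) : ℂ) (Complex.I * R)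
      (4 * π * |(n : ℝ) + k / 12| * z.im) *
    Complex.exp (2 * π * Complex.I * (((n : ℝ) + k / 12) * z.re : ℝ))

/-- `f(z) = ∑_{n ∈ ℤ} c(n) 𝒲_{n,k,R}(z)` on the upper half-plane. -/
def HasFourierExpansion (k : ℕ) (R : ℝ) (f : ℍ → ℂ) (c : ℤ → ℂ) : Prop :=
  ∀ z : ℍ, HasSum (fun n : ℤ => c n * fourierW k R n z) (f z)

/-! ### The operators -/

/-- The lowering operator `E_k^- = (z - z̄) ∂/∂z̄ + k/2`, where `∂/∂z̄ = (∂/∂x + i ∂/∂y)/2`. It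
lowers the weight from `k` to `k - 2`. -/
def lower (k : ℤ) (f : ℍ → ℂ) (z : ℍ) : ℂ :=
  ((z : ℂ) - (starRingEnd ℂ) (z : ℂ)) * ((dX f z + Complex.I * dY f z) / 2) + (k : ℂ) / 2 * f z

/-- `E_{k-2(j-1)}^- ∘ ⋯ ∘ E_{k-2}^- ∘ E_k^-`, a composition of `j` lowering operators. -/
def lowerIter (k : ℤ) : ℕ → (ℍ → ℂ) → (ℍ → ℂ)
  | 0, f => f
  | j + 1, f => lower (k - 2 * j) (lowerIter k j f)

/-- The reflection `J f(z) = f(-z̄)`. -/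
def reflect (f : ℍ → ℂ) (z : ℍ) : ℂ :=
  f ⟨-(starRingEnd ℂ) (z : ℂ), by simpa using z.im_pos⟩

/-- `Θ = J ∘ E_{2-k}^- ∘ ⋯ ∘ E_{k-2}^- ∘ E_k^-`. -/
def theta (k : ℕ) (f : ℍ → ℂ) : ℍ → ℂ :=
  reflect (lowerIter k k f)

/-- `χ_k(d) = i^{k(d-1)}`. -/
def chi (k d : ℕ) : ℂ := Complex.I ^ ((k : ℤ) * ((d : ℤ) - 1))

/-- The Hecke operator of index `m` on forms whose multiplier system takes the value `ξ` at
`T = (1 1; 0 1)`: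
`f ↦ m^{-1/2} ∑_{ad=m, d>0} χ_k(d) ∑_{b mod d} ξ^{-bd} f((az+b)/d)`. -/
def heckeOp (k : ℕ) (ξ : ℂ) (m : ℕ) (f : ℍ → ℂ) (z : ℍ) : ℂ :=
  ((1 / √(m : ℝ) : ℝ) : ℂ) * ∑ d ∈ m.divisors, chi k d *
    ∑ b ∈ Finset.range d, (ξ ^ (b * d))⁻¹ *
      f (ofComplex ((((m / d : ℕ) : ℂ) * (z : ℂ) + b) / d))

/-- `T^{v̄}_m`: here `ξ = v̄(T) = e^{-πik/6}`. -/
def heckeBar (k m : ℕ) (f : ℍ → ℂ) : ℍ → ℂ :=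
  heckeOp k (Complex.exp (-(π * Complex.I * k / 6))) m f

/-- The Hecke-like operator `T^Θ_m = T^{v̄}_m ∘ Θ`. -/
def heckeTheta (k m : ℕ) (f : ℍ → ℂ) : ℍ → ℂ :=
  heckeBar k m (theta k f)

/-! ### The coefficient formula -/

/-- `Λ_{k,R}`: for `k = 2l` it is `∏_{j=1}^l (j(j-1) + 1/4 + R²)²`, for `k = 2l+1` it is
`-R² ∏_{j=1}^l (j² + R²)²`. -/
def bigLambda (k : ℕ) (R : ℝ) : ℝ :=
  if Even k then ∏ j ∈ Finset.Icc 1 (k / 2), ((j : ℝ) * ((j : ℝ) - 1) + 1 / 4 + R ^ 2) ^ 2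
  else -R ^ 2 * ∏ j ∈ Finset.Icc 1 (k / 2), ((j : ℝ) ^ 2 + R ^ 2) ^ 2

/-- `c(x)` for rational `x`, with the convention `c(x) = 0` if `x` is not an integer. -/
def coeffAt (c : ℤ → ℂ) (x : ℚ) : ℂ := if x.den = 1 then c x.num else 0

/-- `mn/a² + k(m+a²)/(12a²)`. -/
def thetaIndex (k m : ℕ) (n : ℤ) (a : ℕ) : ℚ :=
  (m : ℚ) * n / (a : ℚ) ^ 2 + (k : ℚ) * ((m : ℚ) + (a : ℚ) ^ 2) / (12 * (a : ℚ) ^ 2)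

/-- `δ_a`: `1` if `mn/a² + k(m+a²)/(12a²) ≥ 1`, and `Λ_{k,R}` otherwise. -/
def thetaDelta (k m : ℕ) (R : ℝ) (n : ℤ) (a : ℕ) : ℂ :=
  if 1 ≤ thetaIndex k m n a then 1 else (bigLambda k R : ℂ)

/-- `d(n) = (-1)^k ∑_{0 < a ∣ (m, n + k(m+1)/12)} χ_k(a) δ_a c(-mn/a² - k(m+a²)/(12a²))`.
It is used for `km ≡ -k mod 12`, where `k(m+1)/12` is an exact division. -/
def thetaCoeff (k m : ℕ) (R : ℝ) (c : ℤ → ℂ) (n : ℤ) : ℂ :=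
  (-1) ^ k * ∑ a ∈ (Int.gcd m (n + (k : ℤ) * ((m : ℤ) + 1) / 12)).divisors,
    chi k a * thetaDelta k m R n a * coeffAt c (-thetaIndex k m n a)

/-- `D = k / (12, k)`. -/
def levelD (k : ℕ) : ℕ := k / Nat.gcd 12 k

end MaassEta

end

open Complex UpperHalfPlane MeasureTheory
open scoped MatrixGroups Modular ContDiff Real

noncomputable section

namespace MaassEta

/-! Part 1, for `Θ`. The lowering operator intertwines the Laplacians of weights `k` and `k - 2`
(`laplacian_lower`) and commutes with the group action of these weights (`lower_S`, `lower_T`), so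
`k` lowerings lead from weight `k` to weight `-k`. The reflection brings the weight back to `k` and
inverts the multiplier. What remains is square integrability, and no decay of Whittaker functions is
used for it: if `g(y)` is the integral of `|f|²` over a horizontal period, the eigenvalue equation
gives `g'' + C g / y² ≥ ∫ |∇f|²`. If the gradient integral diverged, `g` would grow at least
linearly, against the convergence of `∫ g / y²` (`integrableOn_of_le_deriv_deriv`,
`integrableOn_grad`).

Part 1, for the Hecke operator. The eta multiplier is an explicit character, given by a polynomial
exponent mod `3` and a piecewise polynomial one mod `4` (`etaMult_eq`), and the same formulas make
sense for every integral matrix. Negating the first row of a matrix of determinant `m` gives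
determinant `-m`; as `km ≡ -k (mod 12)`, the `k`-th power of the character treats this as
determinant one. Hence the Hecke operator is a sum over `SL(2, ℤ)`-cosets of matrices of determinant
`m` of a term depending only on the coset (`heckeTerm_smul`), and right multiplication permutes the
cosets (`sum_heckeTerm_mulSL`).

Part 2. Two relations for Whittaker functions (`hasDerivAt_whittakerW`, `whittakerW_add_one`) show
that lowering sends `W_κ` to a multiple of `W_{κ-1}` at positive frequencies and exactly to
`W_{κ+1}` at negative ones. After `k` steps the multiples accumulate to `Λ` (`bigLambda_eq_prod`),
and `κ` has changed sign, as the reflection requires. The sum over `b` in the Hecke operator is a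
character sum which selects a residue class of frequencies mod `d` (`hasSum_hecke_inner`). The
congruence on `m` gives `χ_k(d) = (-1)^k χ_k(a)` for `ad = m`, which is the origin of the global
sign.

Part 3. Coefficients are unique because no Whittaker function vanishes identically, so the
coefficients at `n = 0` may be compared. The divisors that occur are those of `gcd(m, k(m+1)/12) =
gcd(m, D)` (`gcd_eq_gcd_levelD`), where `D` is `1` or a prime, which leaves one or two terms. There
the index is positive, so `Λ` could only multiply a coefficient with non-integral index. -/

/-! ### Calculus on the upper half-plane -/

/-- The extension of `f : ℍ → ℂ` to `ℂ` used to differentiate. -/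
def up (f : ℍ → ℂ) (w : ℂ) : ℂ := f (ofComplex w)

/-- Real-smooth functions on the upper half-plane. -/
def Smooth (f : ℍ → ℂ) : Prop := ContDiffOn ℝ ∞ (up f) {w : ℂ | 0 < w.im}

/-- The directional derivative of `f : ℍ → ℂ`. -/
def dV (v : ℂ) (f : ℍ → ℂ) (z : ℍ) : ℂ := fderiv ℝ (up f) (z : ℂ) v

lemma dX_eq : dX = dV 1 := rfl

lemma dY_eq : dY = dV Complex.I := rfl

lemma isOpen_im_pos : IsOpen {w : ℂ | 0 < w.im} := isOpen_lt continuous_const Complex.continuous_im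

lemma smooth_iff {f : ℍ → ℂ} : Smooth f ↔ ∀ z : ℍ, ContDiffAt ℝ ∞ (up f) (z : ℂ) :=
  ⟨fun h z => h.contDiffAt (isOpen_im_pos.mem_nhds z.im_pos),
    fun h w hw => (h ⟨w, hw⟩).contDiffWithinAt⟩

lemma Smooth.at {f : ℍ → ℂ} (h : Smooth f) (z : ℍ) : ContDiffAt ℝ ∞ (up f) (z : ℂ) :=
  smooth_iff.1 h z

lemma Smooth.differentiableAt {f : ℍ → ℂ} (h : Smooth f) (z : ℍ) :
    DifferentiableAt ℝ (up f) (z : ℂ) :=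
  (h.at z).differentiableAt (by simp)

lemma up_coe (f : ℍ → ℂ) (z : ℍ) : up f (z : ℂ) = f z := by simp [up]

/-- The values of `up f` off the upper half-plane are junk. Agreement near a point of the open
half-plane is all that derivatives need. -/
lemma eventually_up {f : ℍ → ℂ} {F : ℂ → ℂ} (h : ∀ z : ℍ, f z = F z) (z : ℍ) :
    up f =ᶠ[nhds (z : ℂ)] F := by
  filter_upwards [isOpen_im_pos.mem_nhds z.im_pos] with w hw
  simp only [up]
  rw [h, ofComplex_apply_of_im_pos hw]

lemma Smooth.continuous {f : ℍ → ℂ} (h : Smooth f) : Continuous f := by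
  refine continuous_iff_continuousAt.2 fun z => ?_
  have h1 : ContinuousAt (up f) (z : ℂ) := (h.at z).continuousAt
  have h2 := ContinuousAt.comp (f := fun z : ℍ => (z : ℂ)) h1 UpperHalfPlane.continuous_coe.continuousAt
  have h3 : up f ∘ (fun z : ℍ => (z : ℂ)) = f := by ext z; simp [up]
  rwa [h3] at h2

lemma Smooth.dV {f : ℍ → ℂ} (h : Smooth f) (v : ℂ) : Smooth (dV v f) := by
  refine smooth_iff.2 fun z => ?_
  have h1 : ContDiffAt ℝ ∞ (fun w => fderiv ℝ (up f) w v) (z : ℂ) :=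
    ((h.at z).fderiv_right (m := ∞) (by simp)).clm_apply contDiffAt_const
  exact h1.congr_of_eventuallyEq (eventually_up (F := fun w => fderiv ℝ (up f) w v)
    (fun _ => rfl) z)

lemma smooth_const (c : ℂ) : Smooth (fun _ => c) := smooth_iff.2 fun _ => contDiffAt_const

lemma Smooth.add {f g : ℍ → ℂ} (hf : Smooth f) (hg : Smooth g) : Smooth (fun z => f z + g z) :=
  smooth_iff.2 fun z => (hf.at z).add (hg.at z)

lemma Smooth.sub {f g : ℍ → ℂ} (hf : Smooth f) (hg : Smooth g) : Smooth (fun z => f z - g z) :=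
  smooth_iff.2 fun z => (hf.at z).sub (hg.at z)

lemma Smooth.mul {f g : ℍ → ℂ} (hf : Smooth f) (hg : Smooth g) : Smooth (fun z => f z * g z) :=
  smooth_iff.2 fun z => (hf.at z).mul (hg.at z)

lemma Smooth.const_mul {f : ℍ → ℂ} (hf : Smooth f) (c : ℂ) : Smooth (fun z => c * f z) :=
  (smooth_const c).mul hf

lemma Smooth.sum {ι : Type*} {s : Finset ι} {f : ι → ℍ → ℂ} (hf : ∀ i ∈ s, Smooth (f i)) :
    Smooth (fun z => ∑ i ∈ s, f i z) :=
  smooth_iff.2 fun z => ContDiffAt.sum fun i hi => (hf i hi).at z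

lemma Smooth.conj {f : ℍ → ℂ} (hf : Smooth f) : Smooth (fun z => (starRingEnd ℂ) (f z)) :=
  smooth_iff.2 fun z => Complex.conjCLE.contDiff.contDiffAt.comp (z : ℂ) (hf.at z)

lemma smooth_of_contDiff {f : ℍ → ℂ} {F : ℂ → ℂ} (hF : ContDiff ℝ ∞ F) (h : ∀ z : ℍ, f z = F z) :
    Smooth f :=
  smooth_iff.2 fun z => hF.contDiffAt.congr_of_eventuallyEq (eventually_up h z)

lemma hasFDerivAt_ofReal_im (w : ℂ) :
    HasFDerivAt (fun w : ℂ => ((w.im : ℝ) : ℂ)) (Complex.ofRealCLM.comp Complex.imCLM) w :=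
  (Complex.ofRealCLM.comp Complex.imCLM).hasFDerivAt

lemma smooth_im : Smooth (fun z => (z.im : ℂ)) :=
  smooth_of_contDiff (Complex.ofRealCLM.comp Complex.imCLM).contDiff fun _ => rfl

lemma dV_congr_up {f : ℍ → ℂ} {F : ℂ → ℂ} {F' : ℂ →L[ℝ] ℂ} {z : ℍ} (h : ∀ z : ℍ, f z = F z)
    (hF : HasFDerivAt F F' z) (v : ℂ) : dV v f z = F' v := by
  rw [dV, (eventually_up h z).fderiv_eq, hF.fderiv]

lemma dV_im (v : ℂ) (z : ℍ) : dV v (fun z => (z.im : ℂ)) z = (v.im : ℂ) := by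
  rw [dV_congr_up (f := fun z => (z.im : ℂ)) (F := fun w : ℂ => ((w.im : ℝ) : ℂ)) (fun _ => rfl)
    (hasFDerivAt_ofReal_im z)]
  simp

lemma dV_const (v c : ℂ) (z : ℍ) : dV v (fun _ => c) z = 0 := by
  rw [dV_congr_up (f := fun _ => c) (F := fun _ => c) (fun _ => rfl) (hasFDerivAt_const c (z : ℂ))]
  simp

lemma dV_add {f g : ℍ → ℂ} (hf : Smooth f) (hg : Smooth g) (v : ℂ) (z : ℍ) :
    dV v (fun z => f z + g z) z = dV v f z + dV v g z := by
  have := ((hf.differentiableAt z).hasFDerivAt.add (hg.differentiableAt z).hasFDerivAt).fderiv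
  exact (DFunLike.congr_fun this v :)

lemma dV_sub {f g : ℍ → ℂ} (hf : Smooth f) (hg : Smooth g) (v : ℂ) (z : ℍ) :
    dV v (fun z => f z - g z) z = dV v f z - dV v g z := by
  have := ((hf.differentiableAt z).hasFDerivAt.sub (hg.differentiableAt z).hasFDerivAt).fderiv
  exact (DFunLike.congr_fun this v :)

lemma dV_mul {f g : ℍ → ℂ} (hf : Smooth f) (hg : Smooth g) (v : ℂ) (z : ℍ) :
    dV v (fun z => f z * g z) z = dV v f z * g z + f z * dV v g z := by
  have := ((hf.differentiableAt z).hasFDerivAt.mul (hg.differentiableAt z).hasFDerivAt).fderiv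
  have := (DFunLike.congr_fun this v :)
  simp only [up_coe] at this
  refine Eq.trans this ?_
  simp only [dV, add_apply, smul_apply, smul_eq_mul]
  ring

lemma dV_const_mul {f : ℍ → ℂ} (hf : Smooth f) (c v : ℂ) (z : ℍ) :
    dV v (fun z => c * f z) z = c * dV v f z := by
  rw [dV_mul (smooth_const c) hf, dV_const]; ring

lemma dV_sum {ι : Type*} {s : Finset ι} {f : ι → ℍ → ℂ} (hf : ∀ i ∈ s, Smooth (f i)) (v : ℂ)
    (z : ℍ) : dV v (fun z => ∑ i ∈ s, f i z) z = ∑ i ∈ s, dV v (f i) z := by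
  have := (HasFDerivAt.fun_sum fun i hi => ((hf i hi).differentiableAt z).hasFDerivAt).fderiv
  have := (DFunLike.congr_fun this v :)
  refine Eq.trans this ?_
  simp [dV]

lemma dV_conj {f : ℍ → ℂ} (hf : Smooth f) (v : ℂ) (z : ℍ) :
    dV v (fun z => (starRingEnd ℂ) (f z)) z = (starRingEnd ℂ) (dV v f z) := by
  have := (Complex.conjCLE.hasFDerivAt.comp (z : ℂ) (hf.differentiableAt z).hasFDerivAt).fderiv
  exact (DFunLike.congr_fun this v :)

lemma dV_comm {f : ℍ → ℂ} (hf : Smooth f) (v w : ℂ) (z : ℍ) :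
    dV v (dV w f) z = dV w (dV v f) z := by
  have key : ∀ v w : ℂ, dV v (dV w f) z = fderiv ℝ (fderiv ℝ (up f)) (z : ℂ) v w := by
    intro v w
    have h1 : HasFDerivAt (fderiv ℝ (up f)) (fderiv ℝ (fderiv ℝ (up f)) (z : ℂ)) (z : ℂ) :=
      (((hf.at z).fderiv_right (m := ∞) (by simp)).differentiableAt (by simp)).hasFDerivAt
    rw [dV_congr_up (f := dV w f) (F := fun u => fderiv ℝ (up f) u w) (fun _ => rfl)
      (h1.clm_apply (hasFDerivAt_const w (z : ℂ)))]
    simp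
  rw [key, key]
  exact ((hf.at z).isSymmSndFDerivAt (by
    rw [minSmoothness_of_isRCLikeNormedField]; exact ENat.LEInfty.out)) v w

/-! ### The Laplacian and the lowering operator -/

/-- Since `z - z̄ = 2iy`, no conjugate is left and the operator is a combination of real partial
derivatives. The later calculations start from this form. -/
lemma lower_eq (k : ℤ) (f : ℍ → ℂ) :
    lower k f = fun z => (z.im : ℂ) * (Complex.I * dV 1 f z - dV Complex.I f z) +
      (k : ℂ) / 2 * f z := by
  ext z
  have h : (z : ℂ) - (starRingEnd ℂ) (z : ℂ) = 2 * Complex.I * z.im := by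
    rw [Complex.sub_conj]; push_cast; simp; ring
  simp only [lower, h, dX_eq, dY_eq]
  linear_combination (z.im : ℂ) * dV Complex.I f z * Complex.I_mul_I

lemma laplacian_eq (k : ℤ) (f : ℍ → ℂ) :
    laplacian k f = fun z => (z.im : ℂ) * ((z.im : ℂ) * (dV 1 (dV 1 f) z +
      dV Complex.I (dV Complex.I f) z)) - Complex.I * k * ((z.im : ℂ) * dV 1 f z) := by
  ext z
  simp only [laplacian, dX_eq, dY_eq]
  ring

lemma Smooth.lower {f : ℍ → ℂ} (hf : Smooth f) (k : ℤ) : Smooth (lower k f) := by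
  rw [lower_eq]
  exact (smooth_im.mul (((hf.dV _).const_mul _).sub (hf.dV _))).add (hf.const_mul _)

/-- Both sides expand by the product rule into partial derivatives of order at most three. They
agree once mixed derivatives are identified and `i² = -1` is used. -/
lemma laplacian_lower {f : ℍ → ℂ} (hf : Smooth f) (k : ℤ) :
    laplacian (k - 2) (lower k f) = lower k (laplacian k f) := by
  have s1 := hf.dV 1
  have s2 := hf.dV Complex.I
  have s11 := s1.dV 1
  have s22 := s2.dV Complex.I
  have sP : Smooth (fun z => Complex.I * dV 1 f z - dV Complex.I f z) := (s1.const_mul _).sub s2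
  have hP : ∀ v, dV v (fun z => Complex.I * dV 1 f z - dV Complex.I f z) =
      fun z => Complex.I * dV v (dV 1 f) z - dV v (dV Complex.I f) z := by
    intro v; ext z
    rw [dV_sub (s1.const_mul _) s2, dV_const_mul s1]
  have hL : ∀ v, dV v (lower k f) = fun z => (v.im : ℂ) * (Complex.I * dV 1 f z - dV Complex.I f z)
      + (z.im : ℂ) * (Complex.I * dV v (dV 1 f) z - dV v (dV Complex.I f) z)
      + (k : ℂ) / 2 * dV v f z := by
    intro v; ext z
    rw [lower_eq, dV_add (smooth_im.mul sP) (hf.const_mul _), dV_mul smooth_im sP, hP,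
      dV_const_mul hf, dV_im]
  have hLL : ∀ v z, dV v (dV v (lower k f)) z =
      2 * (v.im : ℂ) * (Complex.I * dV v (dV 1 f) z - dV v (dV Complex.I f) z)
      + (z.im : ℂ) * (Complex.I * dV v (dV v (dV 1 f)) z - dV v (dV v (dV Complex.I f)) z)
      + (k : ℂ) / 2 * dV v (dV v f) z := by
    intro v z
    have sQ : Smooth (fun z => Complex.I * dV v (dV 1 f) z - dV v (dV Complex.I f) z) :=
      ((s1.dV v).const_mul _).sub (s2.dV v)
    rw [hL, dV_add ((sP.const_mul _).add (smooth_im.mul sQ)) ((hf.dV v).const_mul _),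
      dV_add (sP.const_mul _) (smooth_im.mul sQ), dV_mul smooth_im sQ, dV_const_mul sP, hP,
      dV_const_mul (hf.dV v), dV_im, dV_sub ((s1.dV v).const_mul _) (s2.dV v),
      dV_const_mul (s1.dV v)]
    ring
  have sD := s11.add s22
  have hΔ : ∀ v z, dV v (laplacian k f) z =
      2 * (v.im : ℂ) * (z.im : ℂ) * (dV 1 (dV 1 f) z + dV Complex.I (dV Complex.I f) z)
      + (z.im : ℂ) ^ 2 * (dV v (dV 1 (dV 1 f)) z + dV v (dV Complex.I (dV Complex.I f)) z)
      - Complex.I * k * ((v.im : ℂ) * dV 1 f z + (z.im : ℂ) * dV v (dV 1 f) z) := by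
    intro v z
    rw [laplacian_eq, dV_sub (smooth_im.mul (smooth_im.mul sD)) ((smooth_im.mul s1).const_mul _),
      dV_mul smooth_im (smooth_im.mul sD), dV_mul smooth_im sD, dV_const_mul (smooth_im.mul s1),
      dV_mul smooth_im s1, dV_add s11 s22, dV_im]
    ring
  ext z
  rw [lower_eq k (laplacian k f)]
  simp only [hΔ, laplacian, dX_eq, dY_eq, hLL]
  rw [hL]
  have e1 : dV 1 (dV 1 (dV Complex.I f)) z = dV Complex.I (dV 1 (dV 1 f)) z := by
    rw [show dV 1 (dV Complex.I f) = dV Complex.I (dV 1 f) from funext (dV_comm hf 1 Complex.I)]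
    exact dV_comm s1 _ _ z
  have e2 : dV Complex.I (dV Complex.I (dV 1 f)) z = dV 1 (dV Complex.I (dV Complex.I f)) z := by
    rw [show dV Complex.I (dV 1 f) = dV 1 (dV Complex.I f) from funext (dV_comm hf Complex.I 1)]
    exact dV_comm s2 _ _ z
  rw [e1, e2, dV_comm hf Complex.I 1]
  simp only [Complex.one_im, Complex.I_im]
  push_cast
  linear_combination (2 * (z.im : ℂ) ^ 2 * dV 1 (dV 1 f) z) * Complex.I_mul_I

lemma lower_const_mul {f : ℍ → ℂ} (hf : Smooth f) (k : ℤ) (c : ℂ) :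
    lower k (fun z => c * f z) = fun z => c * lower k f z := by
  ext z
  simp only [lower_eq, dV_const_mul hf]
  ring

/-- `f` is an eigenfunction of the weight `k` Laplacian with eigenvalue `-(1/4 + R²)`. -/
def IsEigen (k : ℤ) (R : ℝ) (f : ℍ → ℂ) : Prop :=
  ∀ z : ℍ, laplacian k f z + (1 / 4 + (R : ℂ) ^ 2) * f z = 0

lemma IsEigen.lower {k : ℤ} {R : ℝ} {f : ℍ → ℂ} (h : IsEigen k R f) (hf : Smooth f) :
    IsEigen (k - 2) R (lower k f) := by
  have h1 : laplacian k f = fun z => (-(1 / 4 + (R : ℂ) ^ 2)) * f z := by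
    ext z; linear_combination h z
  intro z
  rw [laplacian_lower hf, h1, lower_const_mul hf]
  ring

lemma smooth_lowerIter {f : ℍ → ℂ} (hf : Smooth f) (k : ℤ) (j : ℕ) : Smooth (lowerIter k j f) := by
  induction j with
  | zero => exact hf
  | succ j ih => exact ih.lower _

lemma IsEigen.lowerIter {k : ℤ} {R : ℝ} {f : ℍ → ℂ} (h : IsEigen k R f) (hf : Smooth f) (j : ℕ) :
    IsEigen (k - 2 * j) R (lowerIter k j f) := by
  induction j with
  | zero => simpa [MaassEta.lowerIter] using h
  | succ j ih =>
    have := ih.lower (smooth_lowerIter hf k j)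
    rw [show k - 2 * ((j + 1 : ℕ) : ℤ) = k - 2 * j - 2 by push_cast; ring]
    exact this

/-! ### Pull-back by real affine maps and the reflection -/

/-- Precomposition with a real-linear affine map of `ℂ` preserving the upper half-plane. -/
lemma dV_comp_affine {f : ℍ → ℂ} (hf : Smooth f) (L : ℂ →L[ℝ] ℂ) (w₀ : ℂ) (φ : ℍ → ℍ)
    (hφ : ∀ z, (φ z : ℂ) = L z + w₀) (v : ℂ) (z : ℍ) :
    dV v (fun z => f (φ z)) z = dV (L v) f (φ z) := by
  have hL : HasFDerivAt (fun w : ℂ => L w + w₀) L (z : ℂ) := L.hasFDerivAt.add_const w₀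
  have hf' : HasFDerivAt (up f) (fderiv ℝ (up f) (φ z)) (L z + w₀) := by
    rw [← hφ]; exact (hf.differentiableAt (φ z)).hasFDerivAt
  rw [dV_congr_up (F := fun w => up f (L w + w₀)) (fun z => by rw [← hφ, up_coe])
    (HasFDerivAt.comp (g := up f) (z : ℂ) hf' hL)]
  rfl

lemma Smooth.comp_affine {f : ℍ → ℂ} (hf : Smooth f) (L : ℂ →L[ℝ] ℂ) (w₀ : ℂ) (φ : ℍ → ℍ)
    (hφ : ∀ z, (φ z : ℂ) = L z + w₀) : Smooth (fun z => f (φ z)) := by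
  refine smooth_iff.2 fun z => ?_
  have h1 : ContDiffAt ℝ ∞ (fun w : ℂ => L w + w₀) (z : ℂ) := by fun_prop
  have h2 : ContDiffAt ℝ ∞ (up f) (L z + w₀) := by rw [← hφ]; exact hf.at _
  exact (ContDiffAt.comp (z : ℂ) h2 h1).congr_of_eventuallyEq
    (eventually_up (fun z => by simp only [Function.comp]; rw [← hφ, up_coe]) z)

/-- The reflection `z ↦ -z̄`. -/
def negConj (z : ℍ) : ℍ := ⟨-(starRingEnd ℂ) (z : ℂ), by simpa using z.im_pos⟩

lemma reflect_eq (f : ℍ → ℂ) : reflect f = fun z => f (negConj z) := rfl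

lemma coe_negConj (z : ℍ) : (negConj z : ℂ) = -(starRingEnd ℂ) (z : ℂ) := rfl

@[simp] lemma im_negConj (z : ℍ) : (negConj z).im = z.im := by
  rw [← UpperHalfPlane.coe_im, coe_negConj]; simp

@[simp] lemma re_negConj (z : ℍ) : (negConj z).re = -z.re := by
  rw [← UpperHalfPlane.coe_re, coe_negConj]; simp

lemma negConj_affine (z : ℍ) :
    (negConj z : ℂ) = (-(Complex.conjCLE : ℂ →L[ℝ] ℂ)) z + 0 := by
  simp [coe_negConj]

lemma dV_reflect {f : ℍ → ℂ} (hf : Smooth f) (v : ℂ) (z : ℍ) :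
    dV v (reflect f) z = dV (-(starRingEnd ℂ) v) f (negConj z) := by
  have := dV_comp_affine hf (-(Complex.conjCLE : ℂ →L[ℝ] ℂ)) 0 negConj negConj_affine v z
  simpa [reflect_eq] using this

lemma Smooth.reflect {f : ℍ → ℂ} (hf : Smooth f) : Smooth (reflect f) :=
  hf.comp_affine _ _ negConj negConj_affine

lemma dV_neg (v : ℂ) (f : ℍ → ℂ) : dV (-v) f = fun z => (-1 : ℂ) * dV v f z := by
  ext z; simp [dV]

lemma dV_real_mul (r : ℝ) (v : ℂ) (f : ℍ → ℂ) : dV (r * v) f = fun z => (r : ℂ) * dV v f z := by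
  ext z
  have : (r : ℂ) * v = r • v := by simp
  simp only [dV]
  rw [this, map_smul]
  simp

/-- The reflection changes the sign of `∂/∂x` only. Second derivatives are unaffected, while the
first order term `-iky ∂/∂x` changes sign, as if `k` were replaced by `-k`. -/
lemma IsEigen.reflect {k : ℤ} {R : ℝ} {f : ℍ → ℂ} (h : IsEigen k R f) (hf : Smooth f) :
    IsEigen (-k) R (reflect f) := by
  have h1 : dV 1 (MaassEta.reflect f) = MaassEta.reflect (fun z => (-1 : ℂ) * dV 1 f z) := by
    ext z; rw [dV_reflect hf]; simp [dV_neg, reflect_eq]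
  have h2 : dV Complex.I (MaassEta.reflect f) = MaassEta.reflect (dV Complex.I f) := by
    ext z; rw [dV_reflect hf]; simp [reflect_eq]
  intro z
  have h3 := h (negConj z)
  simp only [laplacian, dX_eq, dY_eq] at h3 ⊢
  rw [h1, h2, dV_reflect ((hf.dV 1).const_mul _), dV_reflect (hf.dV _)]
  simp only [map_one, Complex.conj_I, neg_neg, dV_neg, dV_const_mul (hf.dV 1), reflect_eq] at h3 ⊢
  simp only [im_negConj] at h3
  push_cast
  linear_combination h3

lemma IsEigen.sum {ι : Type*} {s : Finset ι} {k : ℤ} {R : ℝ} {f : ι → ℍ → ℂ}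
    (hs : ∀ i ∈ s, Smooth (f i)) (h : ∀ i ∈ s, IsEigen k R (f i)) :
    IsEigen k R (fun z => ∑ i ∈ s, f i z) := by
  intro z
  have hd : ∀ v, dV v (fun z => ∑ i ∈ s, f i z) = fun z => ∑ i ∈ s, dV v (f i) z :=
    fun v => funext (dV_sum hs v)
  simp only [laplacian, dX_eq, dY_eq, hd]
  rw [dV_sum fun i hi => (hs i hi).dV _, dV_sum fun i hi => (hs i hi).dV _]
  rw [← Finset.sum_add_distrib, Finset.mul_sum, Finset.mul_sum, Finset.mul_sum,
    ← Finset.sum_sub_distrib, ← Finset.sum_add_distrib]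
  exact Finset.sum_eq_zero fun i hi => h i hi z

lemma IsEigen.const_mul {k : ℤ} {R : ℝ} {f : ℍ → ℂ} (h : IsEigen k R f) (hf : Smooth f) (c : ℂ) :
    IsEigen k R (fun z => c * f z) := by
  intro z
  have h1 : ∀ v, dV v (fun z => c * f z) = fun z => c * dV v f z :=
    fun v => funext (dV_const_mul hf c v)
  have h3 := h z
  simp only [laplacian, dX_eq, dY_eq, h1] at h3 ⊢
  rw [dV_const_mul (hf.dV _), dV_const_mul (hf.dV _)]
  linear_combination c * h3

/-- The Laplacian is a polynomial in `y`, `∂/∂x`, `∂/∂y` in which each derivative is paired with one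
factor `y`. The factor `r` from the chain rule is therefore absorbed by the scaling of `y`. -/
lemma IsEigen.comp_affine {k : ℤ} {R : ℝ} {f : ℍ → ℂ} (h : IsEigen k R f) (hf : Smooth f) (r : ℝ)
    (w₀ : ℂ) (φ : ℍ → ℍ) (hφ : ∀ z, (φ z : ℂ) = r * z + w₀) (him : ∀ z, (φ z).im = r * z.im) :
    IsEigen k R (fun z => f (φ z)) := by
  have hφ' : ∀ z, (φ z : ℂ) = (r • ContinuousLinearMap.id ℝ ℂ) z + w₀ := by
    intro z; simp [hφ]
  have h1 : ∀ g, Smooth g → ∀ v, dV v (fun z => g (φ z)) = fun z => (r : ℂ) * dV v g (φ z) := by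
    intro g hg v; ext z
    rw [dV_comp_affine hg _ w₀ φ hφ']
    have := congrFun (dV_real_mul r v g) (φ z)
    simpa using this
  intro z
  have h3 := h (φ z)
  have hs : ∀ v, Smooth (fun z => dV v f (φ z)) := fun v => (hf.dV v).comp_affine _ w₀ φ hφ'
  simp only [laplacian, dX_eq, dY_eq, h1 f hf] at h3 ⊢
  rw [dV_const_mul (hs _), dV_const_mul (hs _), h1 _ (hf.dV _), h1 _ (hf.dV _)]
  rw [him] at h3
  push_cast at h3
  linear_combination h3

/-! ### The eta multiplier system -/

/-- The exponent mod `3` of the character of `SL(2, ℤ)` attached to `η²`. -/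
def eThree (a b c d : ZMod 3) : ZMod 3 := (a + d) * c - b * d * (c ^ 2 - 1)

/-- The exponent mod `4` of the character of `SL(2, ℤ)` attached to `η²`. -/
def eFour (a b c d : ZMod 4) : ZMod 4 :=
  if c = 0 ∨ c = 2 then (a + 2 * d) * c + b * d - d + 1 else (a + d + 1) * c

/-- An exponent that increases by a constant under left multiplication by `T` and by `S` defines a
character, since these generate the group. Modulo a fixed number this is a finite check. -/
lemma eThree_T : ∀ a b c d : ZMod 3, a * d - b * c = 1 →
    eThree (a + c) (b + d) c d = eThree a b c d + 1 := by decide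

lemma eThree_S : ∀ a b c d : ZMod 3, a * d - b * c = 1 →
    eThree (-c) (-d) a b = eThree a b c d := by decide

lemma eFour_T : ∀ a b c d : ZMod 4, a * d - b * c = 1 →
    eFour (a + c) (b + d) c d = eFour a b c d + 1 := by decide

lemma eFour_S : ∀ a b c d : ZMod 4, a * d - b * c = 1 →
    eFour (-c) (-d) a b = eFour a b c d + 1 := by decide

/-- The hypothesis says that, after multiplication by `k`, the matrix with negated first row has
determinant one. Negating the first row conjugates a left factor by `diag(-1, 1)`, which takes `T`
and `S` to their inverses; hence the increments have the opposite sign. -/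
lemma eThree_twist_T : ∀ k a b c d : ZMod 3, k * (a * d - b * c + 1) = 0 →
    k * eThree (-(a + c)) (-(b + d)) c d = k * eThree (-a) (-b) c d - k := by decide

lemma eThree_twist_S : ∀ k a b c d : ZMod 3, k * (a * d - b * c + 1) = 0 →
    k * eThree c d a b = k * eThree (-a) (-b) c d := by decide

lemma eFour_twist_T : ∀ k a b c d : ZMod 4, k * (a * d - b * c + 1) = 0 →
    k * eFour (-(a + c)) (-(b + d)) c d = k * eFour (-a) (-b) c d - k := by decide

lemma eFour_twist_S : ∀ k a b c d : ZMod 4, k * (a * d - b * c + 1) = 0 →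
    k * eFour c d a b = k * eFour (-a) (-b) c d - k := by decide

/-- A right factor is not conjugated by the change of sign in the first row, so the increments keep
their sign. -/
lemma eThree_twist_mul_T : ∀ k a b c d : ZMod 3, k * (a * d - b * c + 1) = 0 →
    k * eThree (-a) (-(a + b)) c (c + d) = k * eThree (-a) (-b) c d + k := by decide

lemma eThree_twist_mul_S : ∀ k a b c d : ZMod 3, k * (a * d - b * c + 1) = 0 →
    k * eThree (-b) a d (-c) = k * eThree (-a) (-b) c d := by decide

lemma eFour_twist_mul_T : ∀ k a b c d : ZMod 4, k * (a * d - b * c + 1) = 0 →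
    k * eFour (-a) (-(a + b)) c (c + d) = k * eFour (-a) (-b) c d + k := by decide

lemma eFour_twist_mul_S : ∀ k a b c d : ZMod 4, k * (a * d - b * c + 1) = 0 →
    k * eFour (-b) a d (-c) = k * eFour (-a) (-b) c d + k := by decide

/-! ### Cocycles on `SL(2, ℤ)` and reduction to the generators. -/

/-- The denominator `cz + d`. -/
def den (A : SL(2, ℤ)) (z : ℍ) : ℂ := (A 1 0 : ℂ) * (z : ℂ) + (A 1 1 : ℂ)

lemma den_eq (A : SL(2, ℤ)) (z : ℍ) : den A z = denom (A : GL (Fin 2) ℝ) z := by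
  simp [den, denom]

lemma den_ne_zero (A : SL(2, ℤ)) (z : ℍ) : den A z ≠ 0 := by
  rw [den_eq]; exact denom_ne_zero _ z

lemma den_mul (A B : SL(2, ℤ)) (z : ℍ) : den (A * B) z = den A (B • z) * den B z := by
  simp only [den_eq]
  have := denom_cocycle_σ (A : GL (Fin 2) ℝ) (B : GL (Fin 2) ℝ) z
  rw [σ, if_pos (by simp)] at this
  rw [ModularGroup.sl_moeb]
  simpa using this

lemma den_one (z : ℍ) : den 1 z = 1 := by simp [den]

lemma den_T (z : ℍ) : den ModularGroup.T z = 1 := by simp [den, ModularGroup.T]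

lemma den_S (z : ℍ) : den ModularGroup.S z = z := by simp [den, ModularGroup.S]

lemma coe_T_smul (z : ℍ) : ((ModularGroup.T • z : ℍ) : ℂ) = z + 1 := by
  rw [modular_T_smul, coe_vadd]; push_cast; ring

lemma coe_S_smul (z : ℍ) : ((ModularGroup.S • z : ℍ) : ℂ) = -1 / z := by
  rw [modular_S_smul]; simp [neg_div, inv_neg]

/-- A function on `SL(2, ℤ)` that is multiplicative on the left for the generators `S` and `T` is
multiplicative. -/
lemma map_mul_of_generators {v : SL(2, ℤ) → ℂ} (h1 : v 1 = 1)
    {s t : ℂ} (hs0 : s ≠ 0) (ht0 : t ≠ 0)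
    (hS : ∀ A, v (ModularGroup.S * A) = s * v A) (hT : ∀ A, v (ModularGroup.T * A) = t * v A)
    (A B : SL(2, ℤ)) : v (A * B) = v A * v B := by
  have hA : A ∈ Subgroup.closure {ModularGroup.S, ModularGroup.T} := by
    rw [SpecialLinearGroup.SL2Z_generators]; trivial
  induction hA using Subgroup.closure_induction_left with
  | one => simp [h1]
  | mul_left x hx y hy ih =>
    rcases hx with rfl | rfl
    · rw [mul_assoc, hS, hS, ih, mul_assoc]
    · rw [mul_assoc, hT, hT, ih, mul_assoc]
  | inv_mul_cancel x hx y hy ih =>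
    rcases hx with rfl | rfl
    · refine mul_left_cancel₀ hs0 ?_
      rw [← mul_assoc, ← hS, ← hS]
      simpa [mul_assoc] using ih
    · refine mul_left_cancel₀ ht0 ?_
      rw [← mul_assoc, ← hT, ← hT]
      simpa [mul_assoc] using ih

/-- Automorphy under `SL(2, ℤ)` for a multiplicative cocycle follows from that under the
generators `S` and `T`. -/
lemma automorphic_of_generators {v : SL(2, ℤ) → ℂ} {J : SL(2, ℤ) → ℍ → ℂ} (hv1 : v 1 = 1)
    (hvm : ∀ A B, v (A * B) = v A * v B) (hJ1 : ∀ z, J 1 z = 1)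
    (hJm : ∀ A B z, J (A * B) z = J A (B • z) * J B z) {f : ℍ → ℂ}
    (hS : ∀ z, f (ModularGroup.S • z) = v ModularGroup.S * J ModularGroup.S z * f z)
    (hT : ∀ z, f (ModularGroup.T • z) = v ModularGroup.T * J ModularGroup.T z * f z)
    (A : SL(2, ℤ)) : ∀ z, f (A • z) = v A * J A z * f z := by
  have hA : A ∈ Subgroup.closure {ModularGroup.S, ModularGroup.T} := by
    rw [SpecialLinearGroup.SL2Z_generators]; trivial
  induction hA using Subgroup.closure_induction with
  | mem x hx =>
    rcases hx with rfl | rfl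
    · exact hS
    · exact hT
  | one => intro z; simp [hv1, hJ1]
  | mul x y _ _ hx hy =>
    intro z
    rw [mul_smul, hx, hy, hvm, hJm]; ring
  | inv x _ hx =>
    intro z
    have h1 := hx (x⁻¹ • z)
    rw [smul_inv_smul] at h1
    have h2 : v x⁻¹ * v x = 1 := by rw [← hvm, inv_mul_cancel, hv1]
    have h3 : J x (x⁻¹ • z) * J x⁻¹ z = 1 := by rw [← hJm, mul_inv_cancel, hJ1]
    rw [h1]
    linear_combination (-(f (x⁻¹ • z)) * J x⁻¹ z * J x (x⁻¹ • z)) * h2 - f (x⁻¹ • z) * h3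

/-! ### The explicit character and the transformation law of `η²`. -/

/-- The character of `SL(2, ℤ)` attached to `η^{2k}`, extended to all integral matrices. -/
def chr (k : ℕ) (a b c d : ℤ) : ℂ :=
  ZMod.stdAddChar ((k : ZMod 3) * eThree a b c d) *
    ZMod.stdAddChar (-((k : ZMod 4) * eFour a b c d))

/-- The character `chr` on matrices in `SL(2, ℤ)`. -/
def chrSL (k : ℕ) (A : SL(2, ℤ)) : ℂ := chr k (A 0 0) (A 0 1) (A 1 0) (A 1 1)

/-- The value of `v_η^{2k}` at `T`. -/
def chrT (k : ℕ) : ℂ := ZMod.stdAddChar (k : ZMod 3) * ZMod.stdAddChar (-(k : ZMod 4))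

/-- The value of `v_η^{2k}` at `S`. -/
def chrS (k : ℕ) : ℂ := ZMod.stdAddChar (-(k : ZMod 4))

lemma stdAddChar_ne_zero {N : ℕ} [NeZero N] (x : ZMod N) : ZMod.stdAddChar x ≠ (0 : ℂ) := by
  rw [ZMod.stdAddChar_apply]; exact Circle.coe_ne_zero _

lemma chr_ne_zero (k : ℕ) (a b c d : ℤ) : chr k a b c d ≠ 0 :=
  mul_ne_zero (stdAddChar_ne_zero _) (stdAddChar_ne_zero _)

lemma chrT_ne_zero (k : ℕ) : chrT k ≠ 0 := mul_ne_zero (stdAddChar_ne_zero _) (stdAddChar_ne_zero _)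

lemma chrS_ne_zero (k : ℕ) : chrS k ≠ 0 := stdAddChar_ne_zero _

lemma chrSL_one (k : ℕ) : chrSL k 1 = 1 := by
  simp [chrSL, chr, eThree, eFour]

lemma entries_T_mul (A : SL(2, ℤ)) : (ModularGroup.T * A) 0 0 = A 0 0 + A 1 0 ∧
    (ModularGroup.T * A) 0 1 = A 0 1 + A 1 1 ∧ (ModularGroup.T * A) 1 0 = A 1 0 ∧
    (ModularGroup.T * A) 1 1 = A 1 1 := by
  simp [ModularGroup.coe_T, Matrix.mul_apply, Fin.sum_univ_two]

lemma entries_S_mul (A : SL(2, ℤ)) : (ModularGroup.S * A) 0 0 = -A 1 0 ∧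
    (ModularGroup.S * A) 0 1 = -A 1 1 ∧ (ModularGroup.S * A) 1 0 = A 0 0 ∧
    (ModularGroup.S * A) 1 1 = A 0 1 := by
  simp [ModularGroup.coe_S, Matrix.mul_apply, Fin.sum_univ_two]

lemma det_cast (N : ℕ) (A : SL(2, ℤ)) :
    (A 0 0 : ZMod N) * (A 1 1 : ZMod N) - (A 0 1 : ZMod N) * (A 1 0 : ZMod N) = 1 := by
  have h := A.det_coe
  rw [Matrix.det_fin_two] at h
  exact_mod_cast congrArg (Int.cast : ℤ → ZMod N) h

lemma chrSL_T_mul (k : ℕ) (A : SL(2, ℤ)) : chrSL k (ModularGroup.T * A) = chrT k * chrSL k A := by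
  obtain ⟨h1, h2, h3, h4⟩ := entries_T_mul A
  simp only [chrSL, chr, chrT, h1, h2, h3, h4, Int.cast_add]
  rw [eThree_T _ _ _ _ (det_cast 3 A), eFour_T _ _ _ _ (det_cast 4 A), mul_add, mul_add, neg_add,
    AddChar.map_add_eq_mul, AddChar.map_add_eq_mul, mul_one, mul_one]
  ring

lemma chrSL_S_mul (k : ℕ) (A : SL(2, ℤ)) : chrSL k (ModularGroup.S * A) = chrS k * chrSL k A := by
  obtain ⟨h1, h2, h3, h4⟩ := entries_S_mul A
  simp only [chrSL, chr, chrS, h1, h2, h3, h4, Int.cast_neg]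
  rw [eThree_S _ _ _ _ (det_cast 3 A), eFour_S _ _ _ _ (det_cast 4 A), mul_add, neg_add,
    AddChar.map_add_eq_mul, mul_one]
  ring

lemma chrSL_mul (k : ℕ) (A B : SL(2, ℤ)) : chrSL k (A * B) = chrSL k A * chrSL k B :=
  map_mul_of_generators (chrSL_one k) (chrS_ne_zero k) (chrT_ne_zero k) (chrSL_S_mul k)
    (chrSL_T_mul k) A B

lemma chrSL_T (k : ℕ) : chrSL k ModularGroup.T = chrT k := by
  simpa [chrSL_one] using chrSL_T_mul k 1

lemma chrSL_S (k : ℕ) : chrSL k ModularGroup.S = chrS k := by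
  simpa [chrSL_one] using chrSL_S_mul k 1

/-- This is `1/3 - 1/4 = 1/12`, and explains why the exponent mod `4` enters `chr` with a minus
sign. -/
lemma chrT_eq (k : ℕ) : chrT k = cexp (2 * π * Complex.I * ((k : ℂ) / 12)) := by
  have h1 := ZMod.stdAddChar_coe (N := 3) k
  have h2 := ZMod.stdAddChar_coe (N := 4) (-k)
  push_cast at h1 h2
  rw [chrT, h1, h2, ← Complex.exp_add]
  congr 1; ring

lemma chrS_eq (k : ℕ) : chrS k = (-Complex.I) ^ k := by
  have h2 := ZMod.stdAddChar_coe (N := 4) (-k)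
  push_cast at h2
  rw [chrS, h2, show 2 * π * Complex.I * -(k : ℂ) / 4 = (k : ℕ) * (-(π / 2 * Complex.I)) by ring,
    Complex.exp_nat_mul, Complex.exp_neg, Complex.exp_pi_div_two_mul_I, Complex.inv_I]

lemma chr_pow (k : ℕ) (a b c d : ℤ) : chr k a b c d = chr 1 a b c d ^ k := by
  simp only [chr, mul_pow, ← AddChar.map_nsmul_eq_pow]
  simp

lemma sq_sqrt (z : ℂ) : Complex.sqrt z ^ 2 = z := by
  simp [Complex.sqrt]

/-- Squaring removes the square roots, and with them the choice of a branch, from the inversion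
formula of `η`. -/
lemma eta_sq_S (z : ℍ) : ModularForm.eta ((ModularGroup.S • z : ℍ) : ℂ) ^ 2 =
    chrS 1 * den ModularGroup.S z * ModularForm.eta z ^ 2 := by
  have h := ModularForm.eta_comp_eq_csqrt_I_inv (x := (z : ℂ)) z.im_pos
  simp only [Function.comp_apply, Pi.smul_apply, Pi.mul_apply, smul_eq_mul] at h
  rw [coe_S_smul, h, chrS_eq, den_S, mul_pow, mul_pow, inv_pow, sq_sqrt, sq_sqrt, Complex.inv_I]
  ring

/-- The factors of the product are functions of `e^{2πiz}`, so only the prefactor `e^{2πiz/24}`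
contributes. -/
lemma eta_sq_T (z : ℍ) : ModularForm.eta ((ModularGroup.T • z : ℍ) : ℂ) ^ 2 =
    chrT 1 * den ModularGroup.T z * ModularForm.eta z ^ 2 := by
  rw [coe_T_smul, chrT_eq, den_T]
  have h1 : ∀ n, ModularForm.eta_q n ((z : ℂ) + 1) = ModularForm.eta_q n z := by
    intro n
    rw [ModularForm.eta_q_eq_pow, ModularForm.eta_q_eq_pow, mul_add, mul_one, Complex.exp_add,
      Complex.exp_two_pi_mul_I, mul_one]
  have h2 : Function.Periodic.qParam 24 ((z : ℂ) + 1) =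
      cexp (2 * π * Complex.I / 24) * Function.Periodic.qParam 24 z := by
    simp only [Function.Periodic.qParam]
    rw [← Complex.exp_add]
    congr 1; push_cast; ring
  simp only [ModularForm.eta, h1, h2, mul_pow]
  rw [← Complex.exp_nat_mul]
  have : ((2 : ℕ) : ℂ) * (2 * π * Complex.I / 24) = 2 * π * Complex.I * (((1 : ℕ) : ℂ) / 12) := by
    push_cast; ring
  rw [this]
  ring

lemma eta_sq_smul (A : SL(2, ℤ)) (z : ℍ) : ModularForm.eta ((A • z : ℍ) : ℂ) ^ 2 =
    chrSL 1 A * den A z * ModularForm.eta z ^ 2 :=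
  automorphic_of_generators (f := fun z : ℍ => ModularForm.eta z ^ 2) (chrSL_one 1) (chrSL_mul 1)
    den_one den_mul (by simpa [chrSL_S] using eta_sq_S) (by simpa [chrSL_T] using eta_sq_T) A z

/-- The law for `η²` holds at every point, so evaluation at `i`, where `η` does not vanish, recovers
the character. -/
lemma etaMult_eq (k : ℕ) (A : SL(2, ℤ)) : etaMult k A = chrSL k A := by
  have h := eta_sq_smul A UpperHalfPlane.I
  have h0 : ModularForm.eta Complex.I ≠ 0 := ModularForm.eta_ne_zero (by simp)
  have h1 := den_ne_zero A UpperHalfPlane.I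
  simp only [den, UpperHalfPlane.coe_I] at h h1
  rw [etaMult, pow_mul, h, mul_pow, mul_pow, pow_mul]
  field_simp
  rw [chrSL, chrSL, ← chr_pow]

lemma norm_chr (k : ℕ) (a b c d : ℤ) : ‖chr k a b c d‖ = 1 := by
  rw [chr, norm_mul, ZMod.stdAddChar_apply, ZMod.stdAddChar_apply, Circle.norm_coe,
    Circle.norm_coe, mul_one]

lemma etaMultBar_eq (k : ℕ) (A : SL(2, ℤ)) : etaMultBar k A = (chrSL k A)⁻¹ := by
  rw [etaMultBar, etaMult_eq, Complex.inv_eq_conj (z := chrSL k A) (norm_chr _ _ _ _ _)]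

/-! ### The unitary automorphy factor -/

/-- `(w / |w|)^k`. -/
def unitPow (k : ℤ) (w : ℂ) : ℂ := (w / (‖w‖ : ℂ)) ^ k

lemma exp_arg_eq {w : ℂ} (hw : w ≠ 0) : cexp (Complex.arg w * Complex.I) = w / (‖w‖ : ℂ) := by
  have h : (‖w‖ : ℂ) ≠ 0 := by simpa using hw
  rw [eq_div_iff h, mul_comm, Complex.norm_mul_exp_arg_mul_I]

lemma exp_arg_eq_unitPow (k : ℤ) {w : ℂ} (hw : w ≠ 0) :
    cexp (Complex.I * k * Complex.arg w) = unitPow k w := by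
  rw [unitPow, ← exp_arg_eq hw, ← Complex.exp_int_mul]
  congr 1; ring

/-- `Arg` is additive only modulo `2π`, whereas `w / |w|` is multiplicative. In this form the
automorphy factor is visibly a cocycle. -/
lemma autoFactor_eq (k : ℤ) (A : SL(2, ℤ)) (z : ℍ) : autoFactor k A z = unitPow k (den A z) :=
  exp_arg_eq_unitPow k (den_ne_zero A z)

lemma unitPow_mul (k : ℤ) (w w' : ℂ) : unitPow k (w * w') = unitPow k w * unitPow k w' := by
  simp only [unitPow, norm_mul, Complex.ofReal_mul]
  rw [← mul_zpow]
  congr 1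
  rw [mul_div_mul_comm]

lemma unitPow_one (k : ℤ) : unitPow k 1 = 1 := by simp [unitPow]

lemma unitPow_ne_zero (k : ℤ) {w : ℂ} (hw : w ≠ 0) : unitPow k w ≠ 0 :=
  zpow_ne_zero _ (div_ne_zero hw (by simpa using hw))

lemma unitPow_neg_conj (k : ℤ) {w : ℂ} (hw : w ≠ 0) :
    unitPow (-k) ((starRingEnd ℂ) w) = unitPow k w := by
  have h : (‖w‖ : ℂ) ≠ 0 := by simpa using hw
  have h2 := Complex.mul_conj' w
  have h3 : (starRingEnd ℂ) w ≠ 0 := by simpa using hw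
  rw [unitPow, unitPow, zpow_neg, ← inv_zpow, RCLike.norm_conj, inv_div]
  congr 1
  rw [div_eq_div_iff h3 h, h2]; ring

/-- Transformation law of weight `k` and multiplier `v`. -/
def IsAut (v : SL(2, ℤ) → ℂ) (k : ℤ) (f : ℍ → ℂ) : Prop :=
  ∀ A z, f (A • z) = v A * unitPow k (den A z) * f z

lemma isAut_iff (v : SL(2, ℤ) → ℂ) (k : ℤ) (f : ℍ → ℂ) :
    IsAut v k f ↔ ∀ (A : SL(2, ℤ)) (z : ℍ), (autoFactor k A z)⁻¹ * f (A • z) = v A * f z := by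
  refine forall_congr' fun A => forall_congr' fun z => ?_
  have h := unitPow_ne_zero k (den_ne_zero A z)
  rw [autoFactor_eq, inv_mul_eq_iff_eq_mul₀ h]
  constructor <;> intro h' <;> rw [h'] <;> ring

lemma isAut_of_generators (k' : ℕ) (k : ℤ) {f : ℍ → ℂ}
    (hS : ∀ z, f (ModularGroup.S • z) = chrS k' * unitPow k z * f z)
    (hT : ∀ z, f (ModularGroup.T • z) = chrT k' * f z) : IsAut (chrSL k') k f :=
  automorphic_of_generators (J := fun A z => unitPow k (den A z)) (chrSL_one k') (chrSL_mul k')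
    (fun z => by simp [den_one, unitPow_one]) (fun A B z => by rw [den_mul, unitPow_mul])
    (fun z => by rw [hS, chrSL_S, den_S]) (fun z => by rw [hT, chrSL_T, den_T, unitPow_one, mul_one])

lemma IsAut.S {k' : ℕ} {k : ℤ} {f : ℍ → ℂ} (h : IsAut (chrSL k') k f) (z : ℍ) :
    f (ModularGroup.S • z) = chrS k' * unitPow k z * f z := by
  rw [h, chrSL_S, den_S]

lemma IsAut.T {k' : ℕ} {k : ℤ} {f : ℍ → ℂ} (h : IsAut (chrSL k') k f) (z : ℍ) :
    f (ModularGroup.T • z) = chrT k' * f z := by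
  rw [h, chrSL_T, den_T, unitPow_one, mul_one]

/-! ### Automorphy of the lowered and the reflected form -/

lemma dV_comp {f : ℍ → ℂ} (hf : Smooth f) {φ : ℍ → ℍ} {Φ : ℂ → ℂ} {Φ' : ℂ →L[ℝ] ℂ}
    (hφ : ∀ z : ℍ, (φ z : ℂ) = Φ z) {z : ℍ} (hΦ : HasFDerivAt Φ Φ' z) (v : ℂ) :
    dV v (fun z => f (φ z)) z = dV (Φ' v) f (φ z) := by
  have hf' : HasFDerivAt (up f) (fderiv ℝ (up f) (φ z)) (Φ z) := by
    rw [← hφ]; exact (hf.differentiableAt (φ z)).hasFDerivAt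
  rw [dV_congr_up (F := fun w => up f (Φ w)) (fun z => by rw [← hφ, up_coe])
    (HasFDerivAt.comp (g := up f) (z : ℂ) hf' hΦ)]
  rfl

lemma dV_eq (v : ℂ) (f : ℍ → ℂ) (z : ℍ) :
    dV v f z = v.re * dV 1 f z + v.im * dV Complex.I f z := by
  have h : v = v.re • (1 : ℂ) + v.im • Complex.I := by simp
  conv_lhs => rw [h]
  simp only [dV]
  rw [map_add, map_smul, map_smul]
  simp

lemma unitPow_eq_exp_log (k : ℤ) {w : ℂ} (hw : w ≠ 0) :
    unitPow k w = cexp (Complex.I * k * (Complex.log w).im) := by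
  rw [Complex.log_im, exp_arg_eq_unitPow k hw]

lemma contDiffAt_exp_log (k : ℤ) {w : ℂ} (hw : w ∈ Complex.slitPlane) :
    ContDiffAt ℝ ∞ (fun w : ℂ => cexp (Complex.I * k * (Complex.log w).im)) w := by
  have h1 : ContDiffAt ℝ ∞ Complex.log w := (Complex.contDiffAt_log hw).restrict_scalars ℝ
  have h2 : ContDiffAt ℝ ∞ (fun w : ℂ => ((Complex.log w).im : ℂ)) w :=
    (Complex.ofRealCLM.comp Complex.imCLM).contDiff.contDiffAt.comp w h1
  exact (contDiffAt_const.mul h2).cexp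

lemma smooth_unitPow (k : ℤ) : Smooth (fun z => unitPow k z) := by
  refine smooth_iff.2 fun z => ?_
  exact (contDiffAt_exp_log k (UpperHalfPlane.mem_slitPlane z)).congr_of_eventuallyEq
    (eventually_up (F := fun w : ℂ => cexp (Complex.I * k * (Complex.log w).im))
      (fun z => unitPow_eq_exp_log k z.ne_zero) z)

/-- On the upper half-plane `Arg` is the imaginary part of a holomorphic logarithm, so its
derivative in the direction `v` is `Im(v / z)`. -/
lemma dV_unitPow (k : ℤ) (v : ℂ) (z : ℍ) :
    dV v (fun z => unitPow k z) z = unitPow k z * (Complex.I * k * ((v / (z : ℂ)).im : ℂ)) := by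
  have h1 : HasFDerivAt Complex.log _ (z : ℂ) :=
    (Complex.hasDerivAt_log (UpperHalfPlane.mem_slitPlane z)).hasFDerivAt.restrictScalars ℝ
  have h2 := ((Complex.ofRealCLM.comp Complex.imCLM).hasFDerivAt.comp (z : ℂ) h1).const_mul
    (Complex.I * k)
  have h3 := h2.cexp
  rw [dV_congr_up (f := fun z => unitPow k z) (fun z => unitPow_eq_exp_log k z.ne_zero) h3]
  rw [unitPow_eq_exp_log k z.ne_zero]
  simp [div_eq_mul_inv, smul_eq_mul]

lemma unitPow_sub_two (k : ℤ) {z : ℂ} (hz : z ≠ 0) :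
    unitPow (k - 2) z = unitPow k z * ((starRingEnd ℂ) z / z) := by
  have h : (‖z‖ : ℂ) ≠ 0 := by simpa using hz
  have h2 := Complex.mul_conj' z
  rw [unitPow, unitPow, zpow_sub₀ (div_ne_zero hz h)]
  rw [div_eq_mul_inv, show (2 : ℤ) = ((2 : ℕ) : ℤ) from rfl, zpow_natCast]
  congr 1
  field_simp
  rw [h2]

lemma lower_T {f : ℍ → ℂ} (hf : Smooth f) {t : ℂ}
    (hT : ∀ z, f (ModularGroup.T • z) = t * f z) (k : ℤ) (z : ℍ) :
    lower k f (ModularGroup.T • z) = t * lower k f z := by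
  have him : (ModularGroup.T • z).im = z.im := by
    rw [← UpperHalfPlane.coe_im, coe_T_smul]; simp
  have hd : ∀ v, dV v f (ModularGroup.T • z) = t * dV v f z := by
    intro v
    rw [← dV_const_mul hf]
    have h := dV_comp_affine hf (ContinuousLinearMap.id ℝ ℂ) 1 (fun z => ModularGroup.T • z)
      (fun z => by rw [coe_T_smul]; simp) v z
    simp only [ContinuousLinearMap.id_apply, hT] at h
    exact h.symm
  simp only [lower_eq, hd, him, hT]
  ring

/-- The law of `f` under `S` is differentiated. The factor `(z/|z|)^k` contributes a term in `k f /
z̄`, and the summand `k/2` of the lowering operator is what compensates it, leaving the factor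
`z̄/z` that lowers the weight by two. -/
lemma lower_S {f : ℍ → ℂ} (hf : Smooth f) {s : ℂ} {k : ℤ}
    (hS : ∀ z : ℍ, f (ModularGroup.S • z) = s * unitPow k z * f z) (z : ℍ) :
    lower k f (ModularGroup.S • z) = s * unitPow (k - 2) z * lower k f z := by
  have hz := z.ne_zero
  have hzc : (starRingEnd ℂ) (z : ℂ) ≠ 0 := by simpa using hz
  have hn : (Complex.normSq z : ℂ) = (z : ℂ) * (starRingEnd ℂ) (z : ℂ) := (Complex.mul_conj _).symm
  have him : ((ModularGroup.S • z).im : ℂ) = z.im / ((z : ℂ) * (starRingEnd ℂ) (z : ℂ)) := by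
    rw [← hn, ← UpperHalfPlane.coe_im, coe_S_smul, neg_div, one_div, Complex.neg_im,
      Complex.inv_im]
    push_cast; simp [neg_div]
  have hy : (z : ℂ) - (starRingEnd ℂ) (z : ℂ) = 2 * Complex.I * z.im := by
    rw [Complex.sub_conj]; push_cast; simp; ring
  have hd1 : HasDerivAt (fun w : ℂ => -1 / w) (1 / (z : ℂ) ^ 2) z := by
    have := (hasDerivAt_inv hz).neg
    simp only [neg_neg] at this
    simpa [neg_div] using! this
  have hchain := dV_comp hf (φ := fun z => ModularGroup.S • z) coe_S_smul
    (hd1.hasFDerivAt.restrictScalars ℝ)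
  have hprod : ∀ v, dV v (fun z => f (ModularGroup.S • z)) z =
      s * (unitPow k z * (Complex.I * k * ((v / (z : ℂ)).im : ℂ)) * f z
        + unitPow k z * dV v f z) := by
    intro v
    rw [show (fun z => f (ModularGroup.S • z)) = fun z : ℍ => s * (unitPow k z * f z) by
      ext z; rw [hS]; ring, dV_const_mul ((smooth_unitPow k).mul hf),
      dV_mul (smooth_unitPow k) hf, dV_unitPow]
  set u : ℂ := 1 / (z : ℂ) ^ 2 with hu
  set P := Complex.I * dV 1 f (ModularGroup.S • z) - dV Complex.I f (ModularGroup.S • z) with hP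
  have h1 := hchain 1
  have h2 := hchain Complex.I
  rw [hprod] at h1 h2
  simp only [ContinuousLinearMap.coe_restrictScalars', ContinuousLinearMap.toSpanSingleton_apply,
    smul_eq_mul, one_mul] at h1 h2
  rw [dV_eq u] at h1
  rw [dV_eq (Complex.I * u)] at h2
  have hI : (Complex.I : ℂ) ^ 2 = -1 := Complex.I_sq
  have hcu : (starRingEnd ℂ) u = (u.re : ℂ) - u.im * Complex.I := by
    rw [← Complex.re_add_im ((starRingEnd ℂ) u)]; simp [sub_eq_add_neg]
  -- `i ∂/∂x - ∂/∂y` is `2i ∂/∂z̄`, so composition with the holomorphic map `-1/z`, of derivative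
  -- `u`, brings out the conjugate of `u`.
  have key : (starRingEnd ℂ) u * P = s * unitPow k z *
      (Complex.I * dV 1 f z - dV Complex.I f z - Complex.I * k * f z / (starRingEnd ℂ) (z : ℂ)) := by
    have e1 : ((Complex.I / (z : ℂ)).im : ℂ) = ((1 / (z : ℂ)).re : ℂ) := by
      rw [div_eq_mul_inv, one_div]; simp
    have e2 : 1 / (starRingEnd ℂ) (z : ℂ) =
        ((1 / (z : ℂ)).re : ℂ) - ((1 / (z : ℂ)).im : ℂ) * Complex.I := by
      have : 1 / (starRingEnd ℂ) (z : ℂ) = (starRingEnd ℂ) (1 / (z : ℂ)) := by simp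
      rw [this, ← Complex.re_add_im ((starRingEnd ℂ) (1 / (z : ℂ)))]
      simp [sub_eq_add_neg, neg_div]
    have e3 : ((Complex.I * u).re : ℂ) = -(u.im : ℂ) := by simp
    have e4 : ((Complex.I * u).im : ℂ) = (u.re : ℂ) := by simp
    rw [e1] at h2
    rw [e3, e4] at h2
    rw [hcu, hP, div_eq_mul_one_div (Complex.I * k * f z), e2]
    linear_combination (-Complex.I) * h1 + h2 - u.im * dV 1 f (ModularGroup.S • z) * hI
  have hcu' : (starRingEnd ℂ) u = 1 / (starRingEnd ℂ) (z : ℂ) ^ 2 := by simp [hu]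
  rw [hcu', one_div, inv_mul_eq_iff_eq_mul₀ (pow_ne_zero 2 hzc)] at key
  rw [lower_eq]
  simp only
  rw [← hP, him, key, hS, unitPow_sub_two k hz]
  field_simp
  -- What is left is `z - 2iy = z̄`, multiplied by `k f`.
  linear_combination (s * unitPow k z * k * f z) * hy

lemma IsAut.lower {k' : ℕ} {k : ℤ} {f : ℍ → ℂ} (h : IsAut (chrSL k') k f) (hf : Smooth f) :
    IsAut (chrSL k') (k - 2) (lower k f) :=
  isAut_of_generators _ _ (lower_S hf h.S) (lower_T hf h.T k)

lemma IsAut.lowerIter {k' : ℕ} {k : ℤ} {f : ℍ → ℂ} (h : IsAut (chrSL k') k f) (hf : Smooth f)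
    (j : ℕ) : IsAut (chrSL k') (k - 2 * j) (lowerIter k j f) := by
  induction j with
  | zero => simpa [MaassEta.lowerIter] using h
  | succ j ih =>
    have := ih.lower (smooth_lowerIter hf k j)
    rw [show k - 2 * ((j + 1 : ℕ) : ℤ) = k - 2 * j - 2 by push_cast; ring]
    exact this

/-- The reflection conjugates the translation to its inverse, while it commutes with `S` as a map of
the half-plane. -/
lemma T_smul_negConj (z : ℍ) : ModularGroup.T • negConj (ModularGroup.T • z) = negConj z := by
  ext
  rw [coe_T_smul, coe_negConj, coe_negConj, coe_T_smul]
  simp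

lemma negConj_S (z : ℍ) : negConj (ModularGroup.S • z) = ModularGroup.S • negConj z := by
  ext
  rw [coe_S_smul, coe_negConj, coe_negConj, coe_S_smul]
  simp [neg_div]

lemma unitPow_neg_one (k : ℕ) : unitPow (-(k : ℤ)) (-1) = (-1) ^ k := by
  rcases Nat.even_or_odd k with h | h <;> simp [unitPow, h.neg_one_pow]

lemma chrSL_inv_one (k : ℕ) : (chrSL k 1)⁻¹ = 1 := by rw [chrSL_one, inv_one]

/-- Under `S` the factor of weight `-k` at `-z̄` is `(-1)^k` times that of weight `k` at `z`, and
`(-i)^k (-1)^k` is the inverse of `(-i)^k`. Under `T` the multiplier is inverted because the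
translation is. -/
lemma IsAut.reflect {k : ℕ} {f : ℍ → ℂ} (h : IsAut (chrSL k) (-(k : ℤ)) f) :
    IsAut (fun A => (chrSL k A)⁻¹) k (reflect f) := by
  refine automorphic_of_generators (J := fun A z => unitPow k (den A z)) (chrSL_inv_one k)
    (fun A B => by rw [chrSL_mul, mul_inv]) (fun z => by simp [den_one, unitPow_one])
    (fun A B z => by rw [den_mul, unitPow_mul]) ?_ ?_
  · intro z
    simp only [reflect_eq]
    have e1 : ((negConj z : ℍ) : ℂ) = (-1) * (starRingEnd ℂ) (z : ℂ) := by simp [coe_negConj]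
    rw [negConj_S, h.S, e1, unitPow_mul, unitPow_neg_conj _ z.ne_zero, unitPow_neg_one, den_S,
      chrSL_S, chrS_eq]
    have e2 : (-Complex.I) ^ k * (-1) ^ k = ((-Complex.I) ^ k)⁻¹ := by
      rw [← mul_pow, ← inv_pow, inv_neg, Complex.inv_I]; simp
    rw [← e2]; ring
  · intro z
    simp only [reflect_eq]
    have h1 := h.T (negConj (ModularGroup.T • z))
    rw [T_smul_negConj] at h1
    rw [den_T, unitPow_one, chrSL_T, h1, mul_one, inv_mul_cancel_left₀ (chrT_ne_zero k)]

/-! ### Integrals over horizontal segments -/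

/-- The point `x + iy`. -/
def pt (x y : ℝ) : ℂ := (x : ℂ) + y * Complex.I

@[simp] lemma pt_im (x y : ℝ) : (pt x y).im = y := by simp [pt]

@[simp] lemma pt_re (x y : ℝ) : (pt x y).re = x := by simp [pt]

lemma continuous_pt : Continuous (fun p : ℝ × ℝ => pt p.1 p.2) := by unfold pt; fun_prop

lemma pt_re_im (z : ℍ) : pt z.re z.im = z := by
  apply Complex.ext <;> simp

lemma up_pt {f : ℍ → ℂ} {x y : ℝ} (hy : 0 < y) : up f (pt x y) = f ⟨pt x y, by simpa⟩ := by
  rw [up, ofComplex_apply_of_im_pos (by simpa)]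

lemma Smooth.hasFDerivAt_up {f : ℍ → ℂ} (hf : Smooth f) {w : ℂ} (hw : 0 < w.im) :
    HasFDerivAt (up f) (fderiv ℝ (up f) w) w :=
  (hf.differentiableAt ⟨w, hw⟩).hasFDerivAt

lemma up_dV {f : ℍ → ℂ} {w : ℂ} (hw : 0 < w.im) (v : ℂ) :
    up (dV v f) w = fderiv ℝ (up f) w v := by
  rw [up, ofComplex_apply_of_im_pos hw]; rfl

lemma Smooth.hasDerivAt_x {f : ℍ → ℂ} (hf : Smooth f) {y : ℝ} (hy : 0 < y) (x : ℝ) :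
    HasDerivAt (fun x : ℝ => up f (pt x y)) (up (MaassEta.dV 1 f) (pt x y)) x := by
  have h1 : HasDerivAt (fun x : ℝ => pt x y) 1 x := by
    simpa [pt] using (Complex.ofRealCLM.hasDerivAt (x := x)).add_const ((y : ℂ) * Complex.I)
  rw [up_dV (by simpa)]
  exact (hf.hasFDerivAt_up (w := pt x y) (by simpa)).comp_hasDerivAt x h1

lemma Smooth.hasDerivAt_y {f : ℍ → ℂ} (hf : Smooth f) {y : ℝ} (hy : 0 < y) (x : ℝ) :
    HasDerivAt (fun y : ℝ => up f (pt x y)) (up (MaassEta.dV Complex.I f) (pt x y)) y := by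
  have h1 : HasDerivAt (fun y : ℝ => pt x y) Complex.I y := by
    simpa [pt] using ((Complex.ofRealCLM.hasDerivAt (x := y)).mul_const Complex.I).const_add (x : ℂ)
  rw [up_dV (by simpa)]
  exact (hf.hasFDerivAt_up (w := pt x y) (by simpa)).comp_hasDerivAt y h1

lemma Smooth.continuousOn_up {f : ℍ → ℂ} (hf : Smooth f) : ContinuousOn (up f) {w | 0 < w.im} :=
  ContDiffOn.continuousOn hf

lemma Smooth.continuousOn_pt {f : ℍ → ℂ} (hf : Smooth f) :
    ContinuousOn (fun p : ℝ × ℝ => up f (pt p.1 p.2)) {p | 0 < p.2} :=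
  hf.continuousOn_up.comp continuous_pt.continuousOn fun p hp => by simpa using hp

lemma Smooth.continuous_x {f : ℍ → ℂ} (hf : Smooth f) {y : ℝ} (hy : 0 < y) :
    Continuous (fun x : ℝ => up f (pt x y)) :=
  continuous_iff_continuousAt.2 fun x => (hf.hasDerivAt_x hy x).continuousAt

/-- The integral of `f` over the horizontal segment `[-1/2, 1/2] + iy`. -/
def mean (f : ℍ → ℂ) (y : ℝ) : ℂ := ∫ x in (-(1 / 2) : ℝ)..1 / 2, up f (pt x y)

lemma Smooth.hasDerivAt_mean {f : ℍ → ℂ} (hf : Smooth f) {y : ℝ} (hy : 0 < y) :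
    HasDerivAt (mean f) (mean (MaassEta.dV Complex.I f) y) y := by
  -- On a compact rectangle inside the half-plane the `y`-derivative is bounded, which permits
  -- differentiation under the integral.
  set K : Set (ℝ × ℝ) := Set.Icc (-(1 / 2) : ℝ) (1 / 2) ×ˢ Set.Icc (y / 2) (2 * y) with hK
  have hKc : IsCompact K := isCompact_Icc.prod isCompact_Icc
  have hcont : ContinuousOn (fun p : ℝ × ℝ => up (MaassEta.dV Complex.I f) (pt p.1 p.2)) K :=
    (hf.dV _).continuousOn_pt.mono fun p hp => lt_of_lt_of_le (by linarith) hp.2.1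
  obtain ⟨C, hC⟩ := hKc.exists_bound_of_continuousOn hcont
  have hs : Set.Ioo (y / 2) (2 * y) ∈ nhds y := Ioo_mem_nhds (by linarith) (by linarith)
  refine (intervalIntegral.hasDerivAt_integral_of_dominated_loc_of_deriv_le (bound := fun _ => C)
    (F := fun y x => up f (pt x y)) (F' := fun y x => up (MaassEta.dV Complex.I f) (pt x y)) hs
    ?_ ((hf.continuous_x hy).intervalIntegrable _ _)
    ((hf.dV _).continuous_x hy).aestronglyMeasurable ?_ (by simp) ?_).2
  · filter_upwards [hs] with y' hy'
    exact (hf.continuous_x (lt_trans (by linarith) hy'.1)).aestronglyMeasurable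
  · refine Filter.Eventually.of_forall fun x hx y' hy' => hC (x, y') ⟨?_, hy'.1.le, hy'.2.le⟩
    rw [Set.uIoc_of_le (by norm_num)] at hx
    exact ⟨hx.1.le, hx.2⟩
  · exact Filter.Eventually.of_forall fun x _ y' hy' =>
      hf.hasDerivAt_y (lt_trans (by linarith) hy'.1) x

lemma up_T_smul {f : ℍ → ℂ} {c : ℂ} (h : ∀ z, f (ModularGroup.T • z) = c * f z) {y : ℝ}
    (hy : 0 < y) (x : ℝ) : up f (pt (x + 1) y) = c * up f (pt x y) := by
  rw [up_pt hy, up_pt hy, ← h]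
  congr 1
  ext
  rw [coe_T_smul]
  simp only [pt]
  push_cast; ring

/-- By periodicity the two boundary values cancel. -/
lemma mean_dV_one {f : ℍ → ℂ} (hf : Smooth f) (h : ∀ z, f (ModularGroup.T • z) = f z) {y : ℝ}
    (hy : 0 < y) : mean (dV 1 f) y = 0 := by
  rw [mean, intervalIntegral.integral_eq_sub_of_hasDerivAt (fun x _ => hf.hasDerivAt_x hy x)
    (((hf.dV 1).continuous_x hy).intervalIntegrable _ _)]
  have := up_T_smul (c := 1) (by simpa using h) hy (-(1 / 2))
  rw [show (-(1 / 2) + 1 : ℝ) = 1 / 2 by norm_num, one_mul] at this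
  rw [this, sub_self]

lemma dV_T_invariant {f : ℍ → ℂ} (hf : Smooth f) {t : ℂ}
    (hT : ∀ z, f (ModularGroup.T • z) = t * f z) (v : ℂ) (z : ℍ) :
    dV v f (ModularGroup.T • z) = t * dV v f z := by
  rw [← dV_const_mul hf]
  have h := dV_comp_affine hf (ContinuousLinearMap.id ℝ ℂ) 1 (fun z => ModularGroup.T • z)
    (fun z => by rw [coe_T_smul]; simp) v z
  simp only [ContinuousLinearMap.id_apply, hT] at h
  exact h.symm

lemma mean_add {f g : ℍ → ℂ} (hf : Smooth f) (hg : Smooth g) {y : ℝ} (hy : 0 < y) :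
    mean (fun z => f z + g z) y = mean f y + mean g y :=
  intervalIntegral.integral_add ((hf.continuous_x hy).intervalIntegrable _ _)
    ((hg.continuous_x hy).intervalIntegrable _ _)

/-- The integral of `|f|²` over the horizontal segment `[-1/2, 1/2] + iy`. -/
def meanSq (f : ℍ → ℂ) (y : ℝ) : ℝ := ∫ x in (-(1 / 2) : ℝ)..1 / 2, ‖up f (pt x y)‖ ^ 2

lemma meanSq_nonneg (f : ℍ → ℂ) (y : ℝ) : 0 ≤ meanSq f y :=
  intervalIntegral.integral_nonneg (by norm_num) fun _ _ => by positivity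

lemma mean_mul_conj (f : ℍ → ℂ) (y : ℝ) :
    mean (fun z => f z * (starRingEnd ℂ) (f z)) y = (meanSq f y : ℂ) := by
  rw [mean, meanSq, ← intervalIntegral.integral_ofReal]
  congr 1; ext x
  simp only [up, Complex.mul_conj']
  push_cast; rfl

lemma re_mean {f : ℍ → ℂ} (hf : Smooth f) {y : ℝ} (hy : 0 < y) :
    (mean f y).re = ∫ x in (-(1 / 2) : ℝ)..1 / 2, (up f (pt x y)).re := by
  rw [mean]
  exact ((Complex.reCLM.intervalIntegral_comp_comm
    ((hf.continuous_x hy).intervalIntegrable _ _)).symm)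

lemma Smooth.continuousOn_meanSq {f : ℍ → ℂ} (hf : Smooth f) :
    ContinuousOn (meanSq f) (Set.Ioi 0) := by
  intro y hy
  have h := (hf.mul hf.conj).hasDerivAt_mean hy
  have h2 := (Complex.continuous_re.continuousAt.comp h.continuousAt)
  have h3 : (Complex.re ∘ mean fun z => f z * (starRingEnd ℂ) (f z)) = meanSq f := by
    ext y; simp [mean_mul_conj]
  rw [h3] at h2
  exact h2.continuousWithinAt

/-- A convexity argument: a nonnegative `g` with `∫ g / y² < ∞` and `G ≤ g'' + C g / y²` for some
nonnegative `G` has `∫ G < ∞`. -/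
lemma integrableOn_of_le_deriv_deriv {g g' g'' G : ℝ → ℝ} {C y₀ : ℝ} (hy₀ : 0 < y₀)
    (hg0 : ∀ y, 0 ≤ g y) (hG0 : ∀ y, 0 ≤ G y) (hC : 0 ≤ C)
    (hg : ∀ y, 0 < y → HasDerivAt g (g' y) y) (hg' : ∀ y, 0 < y → HasDerivAt g' (g'' y) y)
    (hG : ContinuousOn G (Set.Ioi 0)) (hg'' : ContinuousOn g'' (Set.Ioi 0))
    (hle : ∀ y, 0 < y → G y ≤ g'' y + C * (g y / y ^ 2))
    (hint : IntegrableOn (fun y => g y / y ^ 2) (Set.Ioi y₀)) : IntegrableOn G (Set.Ioi y₀) := by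
  have hGI : ∀ Y, IntegrableOn G (Set.Ioc y₀ Y) := fun Y =>
    ((hG.mono fun y hy => lt_of_lt_of_le hy₀ hy.1).integrableOn_compact
      (isCompact_Icc (a := y₀) (b := Y))).mono_set Set.Ioc_subset_Icc_self
  set A : ℝ := ∫ y in Set.Ioi y₀, g y / y ^ 2 with hA
  have hbound : ∀ Y, y₀ ≤ Y → ∫ y in y₀..Y, G y ≤ g' Y - g' y₀ + C * A := by
    intro Y hY
    have hsub : Set.uIcc y₀ Y ⊆ Set.Ioi 0 := by
      rw [Set.uIcc_of_le hY]; exact fun y hy => lt_of_lt_of_le hy₀ hy.1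
    have i1 : IntervalIntegrable g'' volume y₀ Y := (hg''.mono hsub).intervalIntegrable
    have i2 : IntervalIntegrable (fun y => g y / y ^ 2) volume y₀ Y := by
      rw [intervalIntegrable_iff_integrableOn_Ioc_of_le hY]
      exact hint.mono_set Set.Ioc_subset_Ioi_self
    have e1 : ∫ y in y₀..Y, G y ≤ ∫ y in y₀..Y, (g'' y + C * (g y / y ^ 2)) := by
      refine intervalIntegral.integral_mono_on hY (hG.mono hsub).intervalIntegrable
        (i1.add (i2.const_mul C)) fun y hy => hle y (lt_of_lt_of_le hy₀ hy.1)
    rw [intervalIntegral.integral_add i1 (i2.const_mul C), intervalIntegral.integral_const_mul,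
      intervalIntegral.integral_eq_sub_of_hasDerivAt (fun y hy => hg' y (hsub hy)) i1] at e1
    have e2 : ∫ y in y₀..Y, g y / y ^ 2 ≤ A := by
      rw [intervalIntegral.integral_of_le hY]
      refine setIntegral_mono_set hint (Filter.Eventually.of_forall fun y => ?_)
        (Filter.Eventually.of_forall Set.Ioc_subset_Ioi_self)
      exact div_nonneg (hg0 y) (sq_nonneg y)
    nlinarith [mul_le_mul_of_nonneg_left e2 hC]
  by_contra hcon
  -- The threshold is chosen so that `hbound` forces `g' ≥ 1` from this point on.
  have hunb : ∃ Y, y₀ ≤ Y ∧ 1 - g' y₀ + C * A < ∫ y in y₀..Y, G y := by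
    by_contra hne
    push Not at hne
    refine hcon (integrableOn_Ioi_of_intervalIntegral_norm_bounded (b := fun Y : ℝ => Y)
      (l := Filter.atTop) (1 - g' y₀ + C * A) y₀ hGI Filter.tendsto_id ?_)
    · filter_upwards [Filter.eventually_ge_atTop y₀] with Y hY
      simp only [Real.norm_of_nonneg (hG0 _)]
      exact hne Y hY
  obtain ⟨Y₁, hY₁, hlt⟩ := hunb
  have hY₁0 : 0 < Y₁ := lt_of_lt_of_le hy₀ hY₁
  have hg'1 : ∀ Y, Y₁ ≤ Y → 1 ≤ g' Y := by
    intro Y hY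
    have h1 := hbound Y (hY₁.trans hY)
    have h2 : ∫ y in y₀..Y₁, G y ≤ ∫ y in y₀..Y, G y := by
      rw [intervalIntegral.integral_of_le hY₁, intervalIntegral.integral_of_le (hY₁.trans hY)]
      exact setIntegral_mono_set (hGI Y) (Filter.Eventually.of_forall hG0)
        (Filter.Eventually.of_forall (Set.Ioc_subset_Ioc_right hY))
    linarith
  have hgl : ∀ Y, Y₁ ≤ Y → Y - Y₁ ≤ g Y := by
    intro Y hY
    have hsub : Set.uIcc Y₁ Y ⊆ Set.Ioi 0 := by
      rw [Set.uIcc_of_le hY]; exact fun y hy => lt_of_lt_of_le hY₁0 hy.1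
    have i1 : IntervalIntegrable g' volume Y₁ Y :=
      ContinuousOn.intervalIntegrable fun y hy => (hg' y (hsub hy)).continuousAt.continuousWithinAt
    have e1 : ∫ y in Y₁..Y, (1 : ℝ) ≤ ∫ y in Y₁..Y, g' y :=
      intervalIntegral.integral_mono_on hY (by simp) i1 fun y hy => hg'1 y hy.1
    rw [intervalIntegral.integral_eq_sub_of_hasDerivAt (fun y hy => hg y (hsub hy)) i1] at e1
    simp only [intervalIntegral.integral_const, smul_eq_mul, mul_one] at e1
    linarith [hg0 Y₁]
  -- For `y > 2Y₁` one has `g y ≥ y - Y₁ ≥ y / 2`, so `2 g / y²` dominates `1 / y`.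
  refine not_integrableOn_Ioi_inv (a := 2 * Y₁) ?_
  have h3 : IntegrableOn (fun y => 2 * (g y / y ^ 2)) (Set.Ioi (2 * Y₁)) :=
    (hint.mono_set (Set.Ioi_subset_Ioi (by linarith))).const_mul 2
  refine Integrable.mono' h3 (by fun_prop) ?_
  refine (ae_restrict_mem measurableSet_Ioi).mono fun y hy => ?_
  have hy0 : 0 < y := lt_trans (by linarith) (Set.mem_Ioi.1 hy)
  have hy1 : 2 * Y₁ < y := hy
  rw [Real.norm_of_nonneg (inv_nonneg.2 hy0.le)]
  have h4 := hgl y (by linarith)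
  rw [inv_eq_one_div, ← mul_div_assoc, div_le_div_iff₀ hy0 (by positivity)]
  nlinarith

/-! ### Square integrability -/

/-- The vertical strip `|x| ≤ 1/2`, `y ≥ y₀`. -/
def strip (y₀ : ℝ) : Set ℍ := {z | |z.re| ≤ 1 / 2 ∧ y₀ ≤ z.im}

/-- The area on the half-plane is Lebesgue measure with density `1 / y²`; the rest is Tonelli.
Closed intervals become half-open or open ones because endpoints are null. -/
lemma lintegral_strip {F : ℂ → ENNReal} (hF : Measurable F) {y₀ : ℝ} (hy₀ : 0 < y₀) :
    ∫⁻ z in strip y₀, F z = ∫⁻ y in Set.Ioi y₀, ∫⁻ x in Set.Ioc (-(1 / 2) : ℝ) (1 / 2),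
      F (pt x y) * (((1 / ‖y‖₊) ^ 2 : NNReal) : ENNReal) := by
  have hemb := UpperHalfPlane.measurableEmbedding_coe
  have hS : MeasurableSet (strip y₀) :=
    ((isClosed_le UpperHalfPlane.continuous_re.abs continuous_const).inter
      (isClosed_le continuous_const UpperHalfPlane.continuous_im)).measurableSet
  set S : Set ℂ := Set.Icc (-(1 / 2)) (1 / 2) ×ℂ Set.Ici y₀ with hSdef
  have hpre : strip y₀ = UpperHalfPlane.coe ⁻¹' S := by
    ext z
    simp [strip, hSdef, Complex.mem_reProdIm, abs_le]
  have hSr : S ⊆ Set.range UpperHalfPlane.coe := fun w hw =>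
    ⟨⟨w, lt_of_lt_of_le hy₀ (Complex.mem_reProdIm.1 hw).2⟩, rfl⟩
  have hSm : MeasurableSet S :=
    (IsClosed.reProdIm (s := Set.Icc (-(1 / 2) : ℝ) (1 / 2)) (t := Set.Ici y₀) isClosed_Icc
      isClosed_Ici).measurableSet
  have hW : Measurable fun w : ℂ => (((1 / ‖w.im‖₊) ^ 2 : NNReal) : ENNReal) := by fun_prop
  have h1 : ∫⁻ z in strip y₀, F z = ∫⁻ w in S, F w * (((1 / ‖w.im‖₊) ^ 2 : NNReal) : ENNReal) := by
    rw [volume_def, restrict_withDensity hS, lintegral_withDensity_eq_lintegral_mul₀]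
    · have e1 : ∀ z : ℍ, ((fun z : ℍ => (((1 / NNReal.mk z.im z.im_pos.le : NNReal) ^ 2 : NNReal) :
          ENNReal)) * fun z : ℍ => F z) z =
          (fun w : ℂ => F w * (((1 / ‖w.im‖₊) ^ 2 : NNReal) : ENNReal)) (z : ℂ) := by
        intro z
        simp only [Pi.mul_apply, UpperHalfPlane.coe_im, Real.nnnorm_of_nonneg z.im_pos.le]
        rw [mul_comm]
      rw [lintegral_congr e1, hpre, ← hemb.lintegral_map
        (fun w : ℂ => F w * (((1 / ‖w.im‖₊) ^ 2 : NNReal) : ENNReal)), ← hemb.restrict_map,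
        hemb.map_comap, Measure.restrict_restrict hSm, Set.inter_eq_self_of_subset_left hSr]
    · refine (Measurable.aemeasurable ?_)
      have : (fun z : ℍ => (((1 / NNReal.mk z.im z.im_pos.le : NNReal) ^ 2 : NNReal) : ENNReal)) =
          fun z : ℍ => (((1 / ‖(z : ℂ).im‖₊) ^ 2 : NNReal) : ENNReal) := by
        ext z; rw [UpperHalfPlane.coe_im, Real.nnnorm_of_nonneg z.im_pos.le]
      rw [this]
      exact hW.comp UpperHalfPlane.measurable_coe
    · exact (hF.comp UpperHalfPlane.measurable_coe).aemeasurable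
  have hmp := Complex.volume_preserving_equiv_real_prod.symm

  have hSpre : Complex.measurableEquivRealProd.symm ⁻¹' S =
      Set.Icc (-(1 / 2) : ℝ) (1 / 2) ×ˢ Set.Ici y₀ := by
    ext p
    simp [hSdef, Complex.mem_reProdIm, Complex.measurableEquivRealProd]
  have hFW : Measurable fun w : ℂ => F w * (((1 / ‖w.im‖₊) ^ 2 : NNReal) : ENNReal) := hF.mul hW
  rw [h1, ← hmp.setLIntegral_comp_preimage hSm hFW, hSpre, Measure.volume_eq_prod,
    ← Measure.prod_restrict, lintegral_prod_symm, restrict_Ioi_eq_restrict_Ici,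
    restrict_Ioc_eq_restrict_Icc]
  · refine lintegral_congr fun y => lintegral_congr fun x => ?_
    have : Complex.measurableEquivRealProd.symm (x, y) = pt x y := by
      apply Complex.ext <;> simp [Complex.measurableEquivRealProd]
    rw [this, pt_im]
  · exact (hFW.comp Complex.measurableEquivRealProd.symm.measurable).aemeasurable

/-- Off the upper half-plane `ofComplex` takes a single default value, so `up f` is piecewise
continuous there. -/
lemma measurable_up {f : ℍ → ℂ} (hf : Smooth f) : Measurable (up f) := by
  classical
  have h : up f = Set.piecewise {w : ℂ | 0 < w.im} (up f) (fun _ => up f 0) := by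
    ext w
    by_cases hw : 0 < w.im
    · simp [Set.piecewise, hw]
    · simp only [Set.piecewise, Set.mem_ofPred_eq, hw, if_false]
      rw [up, up, ofComplex_apply_eq_of_im_nonpos (w' := 0) (not_lt.1 hw) (by rw [Complex.zero_im])]
  rw [h]
  exact hf.continuousOn_up.measurable_piecewise continuousOn_const isOpen_im_pos.measurableSet

/-- Square integrability over all vertical strips of width one. -/
def StripL2 (f : ℍ → ℂ) : Prop := ∀ y₀, 0 < y₀ → IntegrableOn (fun z => ‖f z‖ ^ 2) (strip y₀)

/-- This turns the condition on a strip into the one-variable condition of the convexity argument.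
-/
lemma integrableOn_strip_iff {f : ℍ → ℂ} (hf : Smooth f) {y₀ : ℝ} (hy₀ : 0 < y₀) :
    IntegrableOn (fun z => ‖f z‖ ^ 2) (strip y₀) ↔
      IntegrableOn (fun y => meanSq f y / y ^ 2) (Set.Ioi y₀) := by
  have m1 : AEStronglyMeasurable (fun z => ‖f z‖ ^ 2) (volume.restrict (strip y₀)) :=
    (hf.continuous.norm.pow 2).aestronglyMeasurable
  have hc : ContinuousOn (fun y => meanSq f y / y ^ 2) (Set.Ioi y₀) :=
    (hf.continuousOn_meanSq.mono fun y hy => lt_trans hy₀ hy).div (by fun_prop)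
      fun y hy => pow_ne_zero 2 (lt_trans hy₀ hy).ne'
  have m2 : AEStronglyMeasurable (fun y => meanSq f y / y ^ 2) (volume.restrict (Set.Ioi y₀)) :=
    hc.aestronglyMeasurable measurableSet_Ioi
  have key : ∫⁻ z in strip y₀, ‖‖f z‖ ^ 2‖ₑ = ∫⁻ y in Set.Ioi y₀, ‖meanSq f y / y ^ 2‖ₑ := by
    have hm := measurable_up hf
    have h1 := lintegral_strip (F := fun w => ‖‖up f w‖ ^ 2‖ₑ) (by fun_prop) hy₀
    simp only [up_coe] at h1
    rw [h1]
    refine setLIntegral_congr_fun measurableSet_Ioi fun y hy => ?_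
    have hy0 : 0 < y := lt_trans hy₀ hy
    rw [lintegral_mul_const _ (by unfold pt; fun_prop)]
    have e1 : ‖meanSq f y / y ^ 2‖ₑ = ENNReal.ofReal (meanSq f y) * ENNReal.ofReal (1 / y ^ 2) := by
      rw [Real.enorm_eq_ofReal (div_nonneg (meanSq_nonneg f y) (sq_nonneg y)), div_eq_mul_one_div,
        ENNReal.ofReal_mul (meanSq_nonneg f y)]
    rw [e1, meanSq, intervalIntegral.integral_of_le (by norm_num),
      ofReal_integral_eq_lintegral_ofReal]
    · congr 1
      · refine lintegral_congr fun x => ?_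
        rw [Real.enorm_eq_ofReal (by positivity)]
      · rw [ENNReal.ofReal, ENNReal.coe_inj]
        ext
        rw [Real.coe_toNNReal _ (by positivity)]
        simp
    · exact (((hf.continuous_x hy0).norm.pow 2).integrableOn_Icc).mono_set Set.Ioc_subset_Icc_self
    · exact Filter.Eventually.of_forall fun x => by positivity
  simp only [IntegrableOn, Integrable, HasFiniteIntegral, m1, m2, key, true_and]

/-- On the fundamental domain `4y² ≥ 3`, so it lies in the strip `y ≥ 1/2`. -/
lemma StripL2.integrableOn_fd {f : ℍ → ℂ} (h : StripL2 f) :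
    IntegrableOn (fun z => ‖f z‖ ^ 2) 𝒟 := by
  refine (h (1 / 2) (by norm_num)).mono_set fun z hz => ⟨hz.2, ?_⟩
  have := ModularGroup.three_le_four_mul_im_sq_of_mem_fd hz
  nlinarith [z.im_pos]

/-- A point with `|x| ≤ 1/2` and `y > 1` lies in the fundamental domain, and the rest of a strip is
compact. Strips are preferred because the maps in the Hecke operator respect them, up to horizontal
periods and rescaling. -/
lemma stripL2_of_integrableOn_fd {f : ℍ → ℂ} (hf : Smooth f)
    (h : IntegrableOn (fun z => ‖f z‖ ^ 2) 𝒟) : StripL2 f := by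
  intro y₀ hy₀
  set K : Set ℍ := UpperHalfPlane.coe ⁻¹' (Set.Icc (-(1 / 2)) (1 / 2) ×ℂ Set.Icc y₀ 1) with hK
  have hKc : IsCompact K := by
    rw [UpperHalfPlane.isEmbedding_coe.isCompact_iff, hK, Set.image_preimage_eq_of_subset]
    · exact isCompact_Icc.reProdIm isCompact_Icc
    · exact fun w hw => ⟨⟨w, lt_of_lt_of_le hy₀ (Complex.mem_reProdIm.1 hw).2.1⟩, rfl⟩
  have h2 : IntegrableOn (fun z => ‖f z‖ ^ 2) K :=
    ((hf.continuous.norm.pow 2).continuousOn).integrableOn_compact hKc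
  refine (h.union h2).mono_set fun z hz => ?_
  by_cases hz1 : z.im ≤ 1
  · right
    simp only [hK, Set.mem_preimage, Complex.mem_reProdIm, UpperHalfPlane.coe_re,
      UpperHalfPlane.coe_im]
    exact ⟨abs_le.1 hz.1, hz.2, hz1⟩
  · left
    refine ⟨?_, hz.1⟩
    rw [Complex.normSq_apply, UpperHalfPlane.coe_re, UpperHalfPlane.coe_im]
    nlinarith

lemma meanSq_mono_sum {f g₁ g₂ g₃ : ℍ → ℂ} (hf : Smooth f) (h₁ : Smooth g₁) (h₂ : Smooth g₂)
    (h₃ : Smooth g₃) {a b c : ℝ} {y : ℝ} (hy : 0 < y)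
    (h : ∀ z : ℍ, z.im = y → ‖f z‖ ^ 2 ≤ a * ‖g₁ z‖ ^ 2 + b * ‖g₂ z‖ ^ 2 + c * ‖g₃ z‖ ^ 2) :
    meanSq f y ≤ a * meanSq g₁ y + b * meanSq g₂ y + c * meanSq g₃ y := by
  have hi : ∀ {g}, Smooth g → IntervalIntegrable (fun x => ‖up g (pt x y)‖ ^ 2) volume
      (-(1 / 2)) (1 / 2) := fun hg => ((hg.continuous_x hy).norm.pow 2).intervalIntegrable _ _
  have h1 := (hi h₁).const_mul a
  have h2 := (hi h₂).const_mul b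
  have h3 := (hi h₃).const_mul c
  simp only [meanSq]
  rw [← intervalIntegral.integral_const_mul, ← intervalIntegral.integral_const_mul,
    ← intervalIntegral.integral_const_mul, ← intervalIntegral.integral_add h1 h2,
    ← intervalIntegral.integral_add (h1.add h2) h3]
  refine intervalIntegral.integral_mono_on (by norm_num) (hi hf) ((h1.add h2).add h3)
    fun x _ => ?_
  simp only [up_pt hy]
  exact h _ (by rw [← UpperHalfPlane.coe_im]; simp)

lemma mul_conj_T_invariant {f : ℍ → ℂ} {t : ℂ} (ht : ‖t‖ = 1)
    (hT : ∀ z, f (ModularGroup.T • z) = t * f z) (z : ℍ) :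
    f (ModularGroup.T • z) * (starRingEnd ℂ) (f (ModularGroup.T • z)) =
      f z * (starRingEnd ℂ) (f z) := by
  rw [hT, Complex.mul_conj', Complex.mul_conj', norm_mul, ht, one_mul]

/-- The gradient of a square integrable eigenfunction is square integrable. -/
lemma integrableOn_grad {f : ℍ → ℂ} {k : ℤ} {R : ℝ} (hf : Smooth f) (he : IsEigen k R f) {t : ℂ}
    (ht : ‖t‖ = 1) (hT : ∀ z, f (ModularGroup.T • z) = t * f z) (h2 : StripL2 f) {y₀ : ℝ}
    (hy₀ : 0 < y₀) :
    IntegrableOn (fun y => meanSq (dV 1 f) y + meanSq (dV Complex.I f) y) (Set.Ioi y₀) := by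
  set Q : ℍ → ℂ := fun z => f z * (starRingEnd ℂ) (f z) with hQ
  have sQ : Smooth Q := hf.mul hf.conj
  have hQT := mul_conj_T_invariant ht hT
  have hQd : ∀ v, dV v Q = fun z => dV v f z * (starRingEnd ℂ) (f z) +
      f z * (starRingEnd ℂ) (dV v f z) := by
    intro v; ext z
    rw [hQ, dV_mul hf hf.conj, dV_conj hf]
  have hQdd : ∀ v z, dV v (dV v Q) z = dV v (dV v f) z * (starRingEnd ℂ) (f z) +
      2 * (dV v f z * (starRingEnd ℂ) (dV v f z)) + f z * (starRingEnd ℂ) (dV v (dV v f) z) := by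
    intro v z
    rw [hQd, dV_add ((hf.dV v).mul hf.conj) (hf.mul (hf.dV v).conj), dV_mul (hf.dV v) hf.conj,
      dV_mul hf (hf.dV v).conj, dV_conj hf, dV_conj (hf.dV v)]
    ring
  -- In `Δ|f|² = 2 Re(f̄ Δf) + 2|∇f|²` the eigenvalue equation replaces `y² Δf` by a first order
  -- term and a multiple of `f`. By the inequality of the means the first order term costs
  -- `|∂f/∂x|²`, half of what is available, and `k² |f|² / y²`; the eigenvalue accounts for the rest
  -- of `C`.
  set C : ℝ := (k : ℝ) ^ 2 + 2 * (1 / 4 + R ^ 2) with hC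
  have hCpos : 0 ≤ C := by positivity
  have hmQ : mean Q = fun y => (meanSq f y : ℂ) := funext fun y => mean_mul_conj f y
  have hd1 : ∀ y, 0 < y → HasDerivAt (meanSq f) (mean (dV Complex.I Q) y).re y := by
    intro y hy
    have h := sQ.hasDerivAt_mean hy
    rw [hmQ] at h
    exact Complex.reCLM.hasFDerivAt.comp_hasDerivAt y h
  have hd2 : ∀ y, 0 < y → HasDerivAt (fun y => (mean (dV Complex.I Q) y).re)
      (mean (dV Complex.I (dV Complex.I Q)) y).re y := fun y hy =>
    Complex.reCLM.hasFDerivAt.comp_hasDerivAt y ((sQ.dV Complex.I).hasDerivAt_mean hy)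
  have hpoint : ∀ z : ℍ, ‖dV 1 f z‖ ^ 2 + ‖dV Complex.I f z‖ ^ 2 ≤
      (dV 1 (dV 1 Q) z + dV Complex.I (dV Complex.I Q) z).re + C / z.im ^ 2 * ‖f z‖ ^ 2 := by
    intro z
    set p := dV 1 f z
    set q := dV Complex.I f z
    set L := dV 1 (dV 1 f) z + dV Complex.I (dV Complex.I f) z with hL
    have hy := z.im_pos
    have e1 : (dV 1 (dV 1 Q) z + dV Complex.I (dV Complex.I Q) z).re =
        2 * (L * (starRingEnd ℂ) (f z)).re + 2 * ‖p‖ ^ 2 + 2 * ‖q‖ ^ 2 := by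
      have : dV 1 (dV 1 Q) z + dV Complex.I (dV Complex.I Q) z =
          L * (starRingEnd ℂ) (f z) + (starRingEnd ℂ) (L * (starRingEnd ℂ) (f z)) +
          2 * (p * (starRingEnd ℂ) p) + 2 * (q * (starRingEnd ℂ) q) := by
        rw [hQdd, hQdd, hL]
        simp only [map_add, map_mul, Complex.conj_conj]
        ring
      rw [this, Complex.mul_conj', Complex.mul_conj']
      simp only [Complex.add_re, Complex.conj_re]
      norm_cast
      ring
    have e2 : (z.im : ℂ) ^ 2 * L = Complex.I * k * z.im * p - (1 / 4 + (R : ℂ) ^ 2) * f z := by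
      have := he z
      simp only [laplacian, dX_eq, dY_eq] at this
      linear_combination this
    have e3 : z.im ^ 2 * (L * (starRingEnd ℂ) (f z)).re =
        (Complex.I * k * z.im * p * (starRingEnd ℂ) (f z)).re - (1 / 4 + R ^ 2) * ‖f z‖ ^ 2 := by
      have : ((z.im ^ 2 : ℝ) : ℂ) * (L * (starRingEnd ℂ) (f z)) =
          Complex.I * k * z.im * p * (starRingEnd ℂ) (f z) -
            (((1 / 4 + R ^ 2) * ‖f z‖ ^ 2 : ℝ) : ℂ) := by
        have h4 := Complex.mul_conj' (f z)
        push_cast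
        linear_combination (starRingEnd ℂ) (f z) * e2 - (1 / 4 + (R : ℂ) ^ 2) * h4
      have h5 := congrArg Complex.re this
      rw [Complex.re_ofReal_mul, Complex.sub_re, Complex.ofReal_re] at h5
      exact h5
    have e4 : |(Complex.I * k * z.im * p * (starRingEnd ℂ) (f z)).re| ≤
        |(k : ℝ)| * z.im * ‖p‖ * ‖f z‖ := by
      refine (Complex.abs_re_le_norm _).trans (le_of_eq ?_)
      simp [abs_of_pos hy]
    rw [e1]
    have e5 := (abs_le.1 e4).1
    have e6 : |(k : ℝ)| * z.im * ‖p‖ * ‖f z‖ ≤ z.im ^ 2 * ‖p‖ ^ 2 / 2 + (k : ℝ) ^ 2 * ‖f z‖ ^ 2 / 2 := by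
      have := sq_nonneg (z.im * ‖p‖ - |(k : ℝ)| * ‖f z‖)
      have h6 := sq_abs (k : ℝ)
      nlinarith
    rw [← sub_nonneg]
    have e7 : 0 ≤ z.im ^ 2 * (2 * (L * (starRingEnd ℂ) (f z)).re + 2 * ‖p‖ ^ 2 + 2 * ‖q‖ ^ 2 +
        C / z.im ^ 2 * ‖f z‖ ^ 2 - (‖p‖ ^ 2 + ‖q‖ ^ 2)) := by
      have h7 : z.im ^ 2 * (C / z.im ^ 2 * ‖f z‖ ^ 2) = C * ‖f z‖ ^ 2 := by field_simp
      have h8 : 0 ≤ z.im ^ 2 * ‖q‖ ^ 2 := by positivity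
      rw [hC] at h7
      nlinarith
    exact nonneg_of_mul_nonneg_right e7 (by positivity)
  refine integrableOn_of_le_deriv_deriv (g := meanSq f) (C := C) hy₀ (meanSq_nonneg f)
    (fun y => add_nonneg (meanSq_nonneg _ y) (meanSq_nonneg _ y)) hCpos hd1 hd2
    ((hf.dV 1).continuousOn_meanSq.add (hf.dV Complex.I).continuousOn_meanSq) ?_ ?_
    ((integrableOn_strip_iff hf hy₀).1 (h2 y₀ hy₀))
  · intro y hy
    exact (Complex.continuous_re.continuousAt.comp
      (((sQ.dV _).dV _).hasDerivAt_mean hy).continuousAt).continuousWithinAt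
  · intro y hy
    -- `|f|²` is periodic in `x`, so its second `x`-derivative can be added to the integrand at no
    -- cost, which produces the full Euclidean Laplacian.
    have hzero : mean (dV 1 (dV 1 Q)) y = 0 :=
      mean_dV_one (sQ.dV 1) (fun z => by
        simpa using dV_T_invariant sQ (t := 1) (by simpa using hQT) 1 z) hy
    have s1 := (sQ.dV 1).dV 1
    have s2 := (sQ.dV Complex.I).dV Complex.I
    have e1 : (mean (dV Complex.I (dV Complex.I Q)) y).re =
        (mean (fun z => dV 1 (dV 1 Q) z + dV Complex.I (dV Complex.I Q) z) y).re := by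
      rw [mean_add s1 s2 hy, hzero, zero_add]
    rw [e1, re_mean (s1.add s2) hy]
    simp only [meanSq]
    have hi : ∀ {g}, Smooth g → IntervalIntegrable (fun x => ‖up g (pt x y)‖ ^ 2) volume
        (-(1 / 2)) (1 / 2) := fun hg => ((hg.continuous_x hy).norm.pow 2).intervalIntegrable _ _
    have i1 : IntervalIntegrable (fun x => (up (fun z => dV 1 (dV 1 Q) z +
        dV Complex.I (dV Complex.I Q) z) (pt x y)).re) volume (-(1 / 2)) (1 / 2) :=
      (Complex.continuous_re.comp ((s1.add s2).continuous_x hy)).intervalIntegrable _ _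
    rw [← intervalIntegral.integral_add (hi (hf.dV 1)) (hi (hf.dV Complex.I)), ← mul_div_assoc,
      mul_div_right_comm, ← intervalIntegral.integral_const_mul,
      ← intervalIntegral.integral_add i1 ((hi hf).const_mul _)]
    refine intervalIntegral.integral_mono_on (by norm_num) ((hi (hf.dV 1)).add
      (hi (hf.dV Complex.I))) (i1.add ((hi hf).const_mul _)) fun x _ => ?_
    simp only [up_pt hy]
    have := hpoint ⟨pt x y, by simpa⟩
    have him : (⟨pt x y, by simpa⟩ : ℍ).im = y := by rw [← UpperHalfPlane.coe_im]; simp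
    rw [him] at this
    exact this

/-- The derivatives in the lowering operator carry a factor `y`, whose square cancels the density `1
/ y²`. What must be integrable is then the gradient, without weight. -/
lemma StripL2.lower {f : ℍ → ℂ} {k : ℤ} {R : ℝ} (h2 : StripL2 f) (hf : Smooth f)
    (he : IsEigen k R f) {t : ℂ} (ht : ‖t‖ = 1) (hT : ∀ z, f (ModularGroup.T • z) = t * f z) :
    StripL2 (lower k f) := by
  intro y₀ hy₀
  rw [integrableOn_strip_iff (hf.lower k) hy₀]
  have h1 := integrableOn_grad hf he ht hT h2 hy₀
  have h3 := (integrableOn_strip_iff hf hy₀).1 (h2 y₀ hy₀)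
  refine Integrable.mono' ((h1.const_mul 3).add (h3.const_mul (3 * (k : ℝ) ^ 2 / 4))) ?_ ?_
  · refine ContinuousOn.aestronglyMeasurable ?_ measurableSet_Ioi
    exact ((hf.lower k).continuousOn_meanSq.mono fun y hy => lt_trans hy₀ hy).div (by fun_prop)
      fun y hy => pow_ne_zero 2 (lt_trans hy₀ hy).ne'
  · refine (ae_restrict_mem measurableSet_Ioi).mono fun y hy => ?_
    have hy0 : 0 < y := lt_trans hy₀ hy
    rw [Real.norm_of_nonneg (div_nonneg (meanSq_nonneg _ y) (sq_nonneg y))]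
    have h4 := meanSq_mono_sum (a := 3 * y ^ 2) (b := 3 * y ^ 2) (c := 3 * (k : ℝ) ^ 2 / 4)
      (hf.lower k) (hf.dV 1) (hf.dV Complex.I) hf hy0 (fun z hz => by
        have e1 : ‖MaassEta.lower k f z‖ ≤
            y * ‖MaassEta.dV 1 f z‖ + y * ‖MaassEta.dV Complex.I f z‖ + |(k : ℝ)| / 2 * ‖f z‖ := by
          simp only [lower_eq]
          refine (norm_add_le _ _).trans (add_le_add ?_ ?_)
          · rw [norm_mul, hz, ← mul_add]
            simp only [Complex.norm_real, Real.norm_of_nonneg hy0.le]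
            refine mul_le_mul_of_nonneg_left ((norm_sub_le _ _).trans ?_) hy0.le
            simp
          · simp
        have e2 := pow_le_pow_left₀ (norm_nonneg _) e1 2
        refine e2.trans ?_
        have h6 := sq_abs (k : ℝ)
        set a := y * ‖MaassEta.dV 1 f z‖
        set b := y * ‖MaassEta.dV Complex.I f z‖
        set c := |(k : ℝ)| / 2 * ‖f z‖ with hc
        have e3 : (a + b + c) ^ 2 ≤ 3 * a ^ 2 + 3 * b ^ 2 + 3 * c ^ 2 := by
          nlinarith [sq_nonneg (a - b), sq_nonneg (b - c), sq_nonneg (a - c)]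
        refine e3.trans (le_of_eq ?_)
        rw [hc, mul_pow, mul_pow, mul_pow, div_pow, h6]
        ring)
    simp only [Pi.add_apply]
    rw [div_le_iff₀ (by positivity)]
    refine h4.trans (le_of_eq ?_)
    field_simp

lemma meanSq_reflect (f : ℍ → ℂ) {y : ℝ} (hy : 0 < y) : meanSq (reflect f) y = meanSq f y := by
  have h : ∀ x, up (reflect f) (pt x y) = up f (pt (-x) y) := by
    intro x
    rw [up_pt hy, up_pt hy, reflect_eq]
    simp only
    congr 1
    ext
    rw [coe_negConj]
    apply Complex.ext <;> simp
  simp only [meanSq, h]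
  rw [intervalIntegral.integral_comp_neg fun x => ‖up f (pt x y)‖ ^ 2]
  simp

lemma StripL2.reflect {f : ℍ → ℂ} (h2 : StripL2 f) (hf : Smooth f) : StripL2 (reflect f) := by
  intro y₀ hy₀
  rw [integrableOn_strip_iff hf.reflect hy₀]
  refine ((integrableOn_strip_iff hf hy₀).1 (h2 y₀ hy₀)).congr_fun (fun y hy => ?_)
    measurableSet_Ioi
  simp only [meanSq_reflect f (lt_trans hy₀ hy)]

/-- Square integrability is preserved by `z ↦ rz + β` for functions with `|f|` one-periodic. -/
lemma StripL2.comp_affine {f : ℍ → ℂ} (h2 : StripL2 f) (hf : Smooth f) {t : ℂ} (ht : ‖t‖ = 1)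
    (hT : ∀ z, f (ModularGroup.T • z) = t * f z) {r β : ℝ} (hr : 0 < r) (φ : ℍ → ℍ)
    (hφ : ∀ z, (φ z : ℂ) = r * z + β) : StripL2 (fun z => f (φ z)) := by
  have hs : Smooth (fun z => f (φ z)) :=
    hf.comp_affine (r • ContinuousLinearMap.id ℝ ℂ) β φ (fun z => by simp [hφ])
  intro y₀ hy₀
  rw [integrableOn_strip_iff hs hy₀]
  -- The image of a unit segment has length `r` and is covered by `M` periods of `|f|`.
  obtain ⟨M, hM⟩ := exists_nat_ge r
  have h3 := (integrableOn_strip_iff hf (mul_pos hr hy₀)).1 (h2 _ (mul_pos hr hy₀))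
  have h4 : IntegrableOn (fun y => meanSq f (r * y) / (r * y) ^ 2) (Set.Ioi y₀) :=
    (integrableOn_Ioi_comp_mul_left_iff (fun y => meanSq f y / y ^ 2) y₀ hr).2 h3
  refine Integrable.mono' (h4.const_mul (r⁻¹ * M * r ^ 2)) ?_ ?_
  · refine ContinuousOn.aestronglyMeasurable ?_ measurableSet_Ioi
    exact (hs.continuousOn_meanSq.mono fun y hy => lt_trans hy₀ hy).div (by fun_prop)
      fun y hy => pow_ne_zero 2 (lt_trans hy₀ hy).ne'
  · refine (ae_restrict_mem measurableSet_Ioi).mono fun y hy => ?_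
    have hy0 : 0 < y := lt_trans hy₀ hy
    have hry : 0 < r * y := mul_pos hr hy0
    rw [Real.norm_of_nonneg (div_nonneg (meanSq_nonneg _ y) (sq_nonneg y))]
    have hper : Function.Periodic (fun x => ‖up f (pt x (r * y))‖ ^ 2) 1 := by
      intro x
      simp only [up_T_smul hT hry, norm_mul, ht, one_mul]
    have hcont : Continuous (fun x => ‖up f (pt x (r * y))‖ ^ 2) :=
      (hf.continuous_x hry).norm.pow 2
    have e1 : meanSq (fun z => f (φ z)) y = r⁻¹ * ∫ x in (r * (-(1 / 2)) + β)..(r * (1 / 2) + β),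
        ‖up f (pt x (r * y))‖ ^ 2 := by
      rw [meanSq, ← smul_eq_mul, ← intervalIntegral.integral_comp_mul_add _ hr.ne']
      congr 1; ext x
      rw [up_pt hy0, up_pt hry]
      congr 4
      ext
      rw [hφ]
      simp only [pt]
      push_cast; ring
    have e2 : ∫ x in (r * (-(1 / 2)) + β)..(r * (1 / 2) + β), ‖up f (pt x (r * y))‖ ^ 2 ≤
        M * meanSq f (r * y) := by
      have e3 : ∫ x in (r * (-(1 / 2)) + β)..(r * (-(1 / 2)) + β) + (M : ℤ) • (1 : ℝ),
          ‖up f (pt x (r * y))‖ ^ 2 = M * meanSq f (r * y) := by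
        rw [hper.intervalIntegral_add_zsmul_eq _ _ (fun a b => hcont.intervalIntegrable a b),
          ← hper.intervalIntegral_add_eq (-(1 / 2)), meanSq]
        norm_num
      rw [← e3]
      refine intervalIntegral.integral_mono_interval le_rfl ?_ ?_
        (Filter.Eventually.of_forall fun x => by positivity) (hcont.intervalIntegrable _ _)
      · linarith
      · simp; linarith
    rw [e1, div_le_iff₀ (by positivity)]
    refine (mul_le_mul_of_nonneg_left e2 (inv_nonneg.2 hr.le)).trans (le_of_eq ?_)
    field_simp

lemma StripL2.sum {ι : Type*} {s : Finset ι} {f : ι → ℍ → ℂ} (hs : ∀ i ∈ s, Smooth (f i))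
    (h : ∀ i ∈ s, StripL2 (f i)) : StripL2 (fun z => ∑ i ∈ s, f i z) := by
  intro y₀ hy₀
  refine Integrable.mono' (integrable_finsetSum s fun i hi => ((h i hi) y₀ hy₀).const_mul s.card)
    ((Smooth.sum hs).continuous.norm.pow 2).aestronglyMeasurable
    (Filter.Eventually.of_forall fun z => ?_)
  rw [Real.norm_of_nonneg (by positivity), ← Finset.mul_sum]
  refine (pow_le_pow_left₀ (norm_nonneg _) (norm_sum_le _ _) 2).trans ?_
  exact sq_sum_le_card_mul_sum_sq

lemma StripL2.const_mul {f : ℍ → ℂ} (h : StripL2 f) (c : ℂ) : StripL2 (fun z => c * f z) := by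
  intro y₀ hy₀
  simp only [norm_mul, mul_pow]
  exact (h y₀ hy₀).const_mul (‖c‖ ^ 2)

/-! ### Confluent hypergeometric functions -/

/-- The function `e^{-ts} (1+s)^p`. -/
def kern (p : ℂ) (t s : ℝ) : ℂ := cexp (-(t : ℂ) * s) * (1 + (s : ℂ)) ^ p

/-- The integral `Γ(a)⁻¹ ∫₀^∞ s^{a-1} e^{-ts} (1+s)^p ds`. -/
def confInt (a p : ℂ) (t : ℝ) : ℂ :=
  (Complex.Gamma a)⁻¹ * ∫ s in Set.Ioi (0 : ℝ), (s : ℂ) ^ (a - 1) * kern p t s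

/-- The continuation of `confInt` to `Re a > -N` by `N` integrations by parts. -/
def confl : ℕ → ℂ → ℂ → ℝ → ℂ
  | 0, a, p, t => confInt a p t
  | N + 1, a, p, t => t * confl N (a + 1) p t - p * confl N (a + 1) (p - 1) t

lemma one_add_mem_slitPlane {s : ℝ} (hs : -1 < s) : (1 + (s : ℂ)) ∈ Complex.slitPlane := by
  left; simp; linarith

lemma one_add_ne_zero {s : ℝ} (hs : -1 < s) : (1 + (s : ℂ)) ≠ 0 :=
  Complex.slitPlane_ne_zero (one_add_mem_slitPlane hs)

lemma norm_kern (p : ℂ) (t : ℝ) {s : ℝ} (hs : -1 < s) :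
    ‖kern p t s‖ = Real.exp (-t * s) * (1 + s) ^ p.re := by
  have h : (1 + (s : ℂ)) = ((1 + s : ℝ) : ℂ) := by push_cast; rfl
  rw [kern, norm_mul, Complex.norm_exp, h, Complex.norm_cpow_eq_rpow_re_of_pos (by linarith)]
  simp

lemma norm_kern_le (p : ℂ) (t : ℝ) {s : ℝ} (hs : 0 ≤ s) :
    ‖kern p t s‖ ≤ (1 + s) ^ ⌈p.re⌉₊ * Real.exp (-t * s) := by
  rw [norm_kern p t (by linarith), mul_comm]
  refine mul_le_mul_of_nonneg_right ?_ (Real.exp_pos _).le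
  rw [← Real.rpow_natCast]
  exact Real.rpow_le_rpow_of_exponent_le (by linarith) (Nat.le_ceil _)

lemma integrableOn_majorant {σ t : ℝ} (hσ : 0 < σ) (ht : 0 < t) (N : ℕ) :
    IntegrableOn (fun s : ℝ => s ^ (σ - 1) * ((1 + s) ^ N * Real.exp (-t * s))) (Set.Ioi 0) := by
  have h1 := integrableOn_rpow_mul_exp_neg_mul_rpow (s := σ - 1) (p := 1) (b := t) (by linarith)
    one_pos ht
  have h2 := integrableOn_rpow_mul_exp_neg_mul_rpow (s := σ - 1 + N) (p := 1) (b := t)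
    (by have := Nat.cast_nonneg (α := ℝ) N; linarith) one_pos ht
  simp only [Real.rpow_one] at h1 h2
  refine Integrable.mono' ((h1.add h2).const_mul (2 ^ (N - 1))) ?_ ?_
  · refine ContinuousOn.aestronglyMeasurable (fun s hs => ?_) measurableSet_Ioi
    exact ((Real.continuousAt_rpow_const _ _ (Or.inl (ne_of_gt hs))).mul
      (by fun_prop)).continuousWithinAt
  · refine (ae_restrict_mem measurableSet_Ioi).mono fun s hs => ?_
    have hs0 : 0 < s := hs
    rw [Real.norm_of_nonneg (by positivity)]
    simp only [Pi.add_apply]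
    rw [Real.rpow_add_natCast hs0.ne']
    have h3 := add_pow_le zero_le_one hs0.le N
    rw [one_pow] at h3
    have h4 : 0 ≤ s ^ (σ - 1) * Real.exp (-t * s) := by positivity
    nlinarith [mul_le_mul_of_nonneg_left h3 h4]

lemma norm_cpow_sub_one (a : ℂ) {s : ℝ} (hs : 0 < s) : ‖(s : ℂ) ^ (a - 1)‖ = s ^ (a.re - 1) := by
  rw [Complex.norm_cpow_eq_rpow_re_of_pos hs]; simp

lemma continuousOn_integrand (a p : ℂ) (t : ℝ) :
    ContinuousOn (fun s : ℝ => (s : ℂ) ^ (a - 1) * kern p t s) (Set.Ioi 0) := by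
  intro s hs
  have hs0 : 0 < s := hs
  refine ContinuousAt.continuousWithinAt (ContinuousAt.mul ?_ (ContinuousAt.mul (by fun_prop) ?_))
  · exact (Complex.continuousAt_ofReal_cpow_const _ _ (Or.inr hs0.ne'))
  · exact ContinuousAt.cpow (by fun_prop) continuousAt_const (one_add_mem_slitPlane (by linarith))

lemma integrableOn_integrand {a : ℂ} (ha : 0 < a.re) (p : ℂ) {t : ℝ} (ht : 0 < t) :
    IntegrableOn (fun s : ℝ => (s : ℂ) ^ (a - 1) * kern p t s) (Set.Ioi 0) := by
  refine Integrable.mono' (integrableOn_majorant ha ht ⌈p.re⌉₊)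
    ((continuousOn_integrand a p t).aestronglyMeasurable measurableSet_Ioi) ?_
  refine (ae_restrict_mem measurableSet_Ioi).mono fun s hs => ?_
  have hs0 : 0 < s := hs
  rw [norm_mul, norm_cpow_sub_one a hs0]
  exact mul_le_mul_of_nonneg_left (norm_kern_le p t hs0.le) (by positivity)

lemma hasDerivAt_kern (p : ℂ) (t : ℝ) {s : ℝ} (hs : -1 < s) :
    HasDerivAt (kern p t) (-(t * kern p t s - p * kern (p - 1) t s)) s := by
  have h1 : HasDerivAt (fun s : ℝ => cexp (-(t : ℂ) * s)) (cexp (-(t : ℂ) * s) * (-(t : ℂ) * 1)) s :=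
    ((Complex.ofRealCLM.hasDerivAt (x := s)).const_mul (-(t : ℂ))).cexp
  have h2 : HasDerivAt (fun s : ℝ => (1 + (s : ℂ)) ^ p) (p * (1 + (s : ℂ)) ^ (p - 1) * 1) s :=
    (((hasDerivAt_id (s : ℂ)).const_add 1).cpow_const (one_add_mem_slitPlane hs)).comp_ofReal
  refine (h1.mul h2).congr_deriv ?_
  simp only [kern]
  ring

lemma cpow_sub_one_mul (a : ℂ) {s : ℝ} (hs : 0 < s) : (s : ℂ) ^ (a - 1) * s = (s : ℂ) ^ a := by
  have h : (s : ℂ) ≠ 0 := by exact_mod_cast hs.ne'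
  rw [Complex.cpow_sub _ _ h, Complex.cpow_one, div_mul_cancel₀ _ h]

lemma kern_add_one (p : ℂ) (t : ℝ) {s : ℝ} (hs : -1 < s) :
    kern (p + 1) t s = kern p t s + s * kern p t s := by
  rw [kern, kern, Complex.cpow_add _ _ (one_add_ne_zero hs), Complex.cpow_one]; ring

lemma ne_zero_of_re_pos {a : ℂ} (ha : 0 < a.re) : a ≠ 0 := by
  rintro rfl; simp at ha

lemma inv_Gamma_eq {a : ℂ} (ha : a ≠ 0) :
    (Complex.Gamma a)⁻¹ = a * (Complex.Gamma (a + 1))⁻¹ := by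
  rw [Complex.Gamma_add_one a ha, mul_inv, mul_inv_cancel_left₀ ha]

/-- The function `s^a e^{-ts} (1+s)^p` vanishes at `0` because `Re a > 0`, and at infinity because
it and its derivative are integrable. This identity is what makes the recursion `confl` a
continuation. -/
lemma confInt_by_parts {a : ℂ} (ha : 0 < a.re) (p : ℂ) {t : ℝ} (ht : 0 < t) :
    t * confInt (a + 1) p t - p * confInt (a + 1) (p - 1) t = confInt a p t := by
  have ha0 := ne_zero_of_re_pos ha
  have ha1 : 0 < (a + 1).re := by simp; linarith
  have i0 := integrableOn_integrand ha p ht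
  have i1 := integrableOn_integrand ha1 p ht
  have i2 := integrableOn_integrand ha1 (p - 1) ht
  have hderiv : ∀ s ∈ Set.Ioi (0 : ℝ), HasDerivAt (fun s : ℝ => (s : ℂ) ^ (a + 1 - 1) * kern p t s)
      (a * ((s : ℂ) ^ (a - 1) * kern p t s) - (t * ((s : ℂ) ^ (a + 1 - 1) * kern p t s) -
        p * ((s : ℂ) ^ (a + 1 - 1) * kern (p - 1) t s))) s := by
    intro s hs
    have hs0 : 0 < s := hs
    simp only [add_sub_cancel_right]
    have h1 : HasDerivAt (fun s : ℝ => (s : ℂ) ^ a) (a * (s : ℂ) ^ (a - 1) * 1) s :=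
      ((hasDerivAt_id (s : ℂ)).cpow_const (by left; simpa)).comp_ofReal
    refine (h1.mul (hasDerivAt_kern p t (by linarith))).congr_deriv ?_
    ring
  have hint : IntegrableOn (fun s : ℝ => a * ((s : ℂ) ^ (a - 1) * kern p t s) -
      (t * ((s : ℂ) ^ (a + 1 - 1) * kern p t s) - p * ((s : ℂ) ^ (a + 1 - 1) * kern (p - 1) t s)))
      (Set.Ioi 0) := (i0.const_mul a).sub ((i1.const_mul _).sub (i2.const_mul p))
  have hlim := tendsto_zero_of_hasDerivAt_of_integrableOn_Ioi hderiv hint i1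
  have hcont : ContinuousWithinAt (fun s : ℝ => (s : ℂ) ^ (a + 1 - 1) * kern p t s) (Set.Ici 0) 0 := by
    simp only [add_sub_cancel_right]
    refine ContinuousAt.continuousWithinAt (ContinuousAt.mul ?_ (hasDerivAt_kern p t
      (by norm_num)).continuousAt)
    exact Complex.continuousAt_ofReal_cpow_const _ _ (Or.inl ha)
  have hI := integral_Ioi_of_hasDerivAt_of_tendsto hcont hderiv hint hlim
  have i12 : IntegrableOn (fun s : ℝ => t * ((s : ℂ) ^ (a + 1 - 1) * kern p t s) -
      p * ((s : ℂ) ^ (a + 1 - 1) * kern (p - 1) t s)) (Set.Ioi 0) :=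
    (i1.const_mul _).sub (i2.const_mul p)
  rw [integral_sub (i0.const_mul a) i12,
    integral_sub (i1.const_mul _) (i2.const_mul p), integral_const_mul, integral_const_mul,
    integral_const_mul] at hI
  simp only [add_sub_cancel_right, Complex.ofReal_zero, Complex.zero_cpow ha0, zero_mul,
    sub_zero] at hI
  simp only [confInt, inv_Gamma_eq ha0, add_sub_cancel_right]
  linear_combination (-(Complex.Gamma (a + 1))⁻¹) * hI

/-- Split `(1+s)^{p+1} = (1+s)^p + s (1+s)^p`; the extra `s` raises `a` by one. -/
lemma confInt_add_one {a : ℂ} (ha : 0 < a.re) (p : ℂ) {t : ℝ} (ht : 0 < t) :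
    confInt a (p + 1) t = confInt a p t + a * confInt (a + 1) p t := by
  have ha0 := ne_zero_of_re_pos ha
  have ha1 : 0 < (a + 1).re := by simp; linarith
  have h : ∫ s in Set.Ioi (0 : ℝ), (s : ℂ) ^ (a - 1) * kern (p + 1) t s =
      (∫ s in Set.Ioi (0 : ℝ), (s : ℂ) ^ (a - 1) * kern p t s) +
      ∫ s in Set.Ioi (0 : ℝ), (s : ℂ) ^ (a + 1 - 1) * kern p t s := by
    rw [← integral_add (integrableOn_integrand ha p ht) (integrableOn_integrand ha1 p ht)]
    refine setIntegral_congr_fun measurableSet_Ioi fun s hs => ?_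
    have hs0 : 0 < s := hs
    simp only [add_sub_cancel_right]
    rw [kern_add_one p t (by linarith), ← cpow_sub_one_mul a hs0]
    ring
  simp only [confInt, h, inv_Gamma_eq ha0]
  ring

lemma hasDerivAt_confInt {a : ℂ} (ha : 0 < a.re) (p : ℂ) {t : ℝ} (ht : 0 < t) :
    HasDerivAt (confInt a p) (-a * confInt (a + 1) p t) t := by
  have ha0 := ne_zero_of_re_pos ha
  have ha1 : 0 < (a + 1).re := by simp; linarith
  -- Staying above `t / 2` gives an exponential majorant independent of the parameter.
  have hnhds : Set.Ioi (t / 2) ∈ nhds t := Ioi_mem_nhds (by linarith)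
  have h := (hasDerivAt_integral_of_dominated_loc_of_deriv_le (μ := volume.restrict (Set.Ioi 0))
    (F := fun (t s : ℝ) => (s : ℂ) ^ (a - 1) * kern p t s)
    (F' := fun (t s : ℝ) => -((s : ℂ) ^ (a + 1 - 1) * kern p t s)) (x₀ := t) (s := Set.Ioi (t / 2))
    (bound := fun s : ℝ => s ^ ((a + 1).re - 1) * ((1 + s) ^ ⌈p.re⌉₊ * Real.exp (-(t / 2) * s)))
    hnhds ?_ (integrableOn_integrand ha p ht) ?_ ?_ (integrableOn_majorant ha1 (by linarith) _) ?_).2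
  · have h2 := h.const_mul (Complex.Gamma a)⁻¹
    refine h2.congr_deriv ?_
    rw [integral_neg, confInt, inv_Gamma_eq ha0]
    ring
  · exact Filter.Eventually.of_forall fun t' =>
      (continuousOn_integrand a p t').aestronglyMeasurable measurableSet_Ioi
  · exact ((continuousOn_integrand (a + 1) p t).aestronglyMeasurable measurableSet_Ioi).neg
  · refine (ae_restrict_mem measurableSet_Ioi).mono fun s hs t' ht' => ?_
    have hs0 : 0 < s := hs
    have ht'' : t / 2 < t' := ht'
    rw [norm_neg, norm_mul, norm_cpow_sub_one (a + 1) hs0]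
    refine mul_le_mul_of_nonneg_left ((norm_kern_le p t' hs0.le).trans ?_) (by positivity)
    refine mul_le_mul_of_nonneg_left (Real.exp_le_exp.2 ?_) (by positivity)
    nlinarith
  · refine (ae_restrict_mem measurableSet_Ioi).mono fun s hs t' ht' => ?_
    have hs0 : 0 < s := hs
    have h1 : HasDerivAt (fun t : ℝ => cexp (-(t : ℂ) * s)) (cexp (-(t' : ℂ) * s) * (-1 * s)) t' :=
      ((Complex.ofRealCLM.hasDerivAt (x := t')).neg.mul_const (s : ℂ)).cexp
    refine ((h1.mul_const ((1 + (s : ℂ)) ^ p)).const_mul ((s : ℂ) ^ (a - 1))).congr_deriv ?_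
    rw [add_sub_cancel_right, ← cpow_sub_one_mul a hs0, kern]
    ring

/-- After the substitution `s = u / t` the integrand tends to that of `Γ(a)`. The limit serves to
show that Whittaker functions are not identically zero. -/
lemma tendsto_confInt {a : ℂ} (ha : 0 < a.re) (p : ℂ) :
    Filter.Tendsto (fun t : ℝ => (t : ℂ) ^ a * confInt a p t) Filter.atTop (nhds 1) := by
  have hΓ := Complex.Gamma_ne_zero_of_re_pos ha
  have hsub : ∀ t : ℝ, 0 < t → (t : ℂ) ^ a * confInt a p t = (Complex.Gamma a)⁻¹ *
      ∫ u in Set.Ioi (0 : ℝ), (u : ℂ) ^ (a - 1) * (cexp (-u) * (1 + ((t⁻¹ * u : ℝ) : ℂ)) ^ p) := by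
    intro t ht
    have hi : 0 < t⁻¹ := inv_pos.2 ht
    have h0 : (t : ℂ) ≠ 0 := by exact_mod_cast ht.ne'
    have h1 := integral_comp_mul_left_Ioi
      (fun s : ℝ => (s : ℂ) ^ (a - 1) * kern p t s) 0 hi
    rw [mul_zero, inv_inv] at h1
    have h2 : ∫ u in Set.Ioi (0 : ℝ), (u : ℂ) ^ (a - 1) *
        (cexp (-u) * (1 + ((t⁻¹ * u : ℝ) : ℂ)) ^ p) =
        (t : ℂ) ^ (a - 1) * ∫ u in Set.Ioi (0 : ℝ), ((t⁻¹ * u : ℝ) : ℂ) ^ (a - 1) *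
          kern p t (t⁻¹ * u) := by
      rw [← integral_const_mul]
      refine setIntegral_congr_fun measurableSet_Ioi fun u hu => ?_
      have hu0 : 0 < u := hu
      have h3 : (u : ℂ) ^ (a - 1) = (t : ℂ) ^ (a - 1) * ((t⁻¹ * u : ℝ) : ℂ) ^ (a - 1) := by
        rw [← Complex.mul_cpow_ofReal_nonneg ht.le (by positivity)]
        congr 1
        push_cast
        rw [mul_inv_cancel_left₀ h0]
      simp only [kern]
      rw [h3, show -(t : ℂ) * ((t⁻¹ * u : ℝ) : ℂ) = -u by
        push_cast; rw [neg_mul, mul_inv_cancel_left₀ h0]]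
      ring
    rw [h2, h1, confInt, ← cpow_sub_one_mul a ht]
    simp only [Complex.real_smul]
    ring
  have hlim : Filter.Tendsto (fun t : ℝ => ∫ u in Set.Ioi (0 : ℝ), (u : ℂ) ^ (a - 1) *
      (cexp (-u) * (1 + ((t⁻¹ * u : ℝ) : ℂ)) ^ p)) Filter.atTop
      (nhds (∫ u in Set.Ioi (0 : ℝ), (u : ℂ) ^ (a - 1) * (cexp (-u) * 1))) := by
    refine tendsto_integral_filter_of_dominated_convergence
      (fun s : ℝ => s ^ (a.re - 1) * ((1 + s) ^ ⌈p.re⌉₊ * Real.exp (-1 * s))) ?_ ?_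
      (integrableOn_majorant ha one_pos _) ?_
    · filter_upwards [Filter.eventually_gt_atTop 0] with t ht
      refine ContinuousOn.aestronglyMeasurable (fun s hs => ?_) measurableSet_Ioi
      have hs0 : 0 < s := hs
      refine ContinuousAt.continuousWithinAt (ContinuousAt.mul ?_ (ContinuousAt.mul (by fun_prop) ?_))
      · exact (Complex.continuousAt_ofReal_cpow_const _ _ (Or.inr hs0.ne'))
      · exact ContinuousAt.cpow (by fun_prop) continuousAt_const
          (one_add_mem_slitPlane (by have : 0 < t⁻¹ * s := by positivity
                                     linarith))
    · filter_upwards [Filter.eventually_ge_atTop 1] with t ht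
      refine (ae_restrict_mem measurableSet_Ioi).mono fun s hs => ?_
      have hs0 : 0 < s := hs
      have ht0 : 0 < t⁻¹ := by positivity
      have ht1 : t⁻¹ ≤ 1 := inv_le_one_of_one_le₀ ht
      have hp : 0 < t⁻¹ * s := by positivity
      have h : (1 + ((t⁻¹ * s : ℝ) : ℂ)) = ((1 + t⁻¹ * s : ℝ) : ℂ) := by push_cast; rfl
      rw [norm_mul, norm_mul, norm_cpow_sub_one a hs0, Complex.norm_exp, h,
        Complex.norm_cpow_eq_rpow_re_of_pos (by linarith)]
      refine mul_le_mul_of_nonneg_left ?_ (by positivity)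
      rw [mul_comm]
      simp only [Complex.neg_re, Complex.ofReal_re, neg_one_mul]
      refine mul_le_mul_of_nonneg_right ?_ (Real.exp_pos _).le
      calc (1 + t⁻¹ * s) ^ p.re ≤ (1 + t⁻¹ * s) ^ (⌈p.re⌉₊ : ℝ) :=
            Real.rpow_le_rpow_of_exponent_le (by linarith) (Nat.le_ceil _)
        _ = (1 + t⁻¹ * s) ^ ⌈p.re⌉₊ := Real.rpow_natCast _ _
        _ ≤ (1 + s) ^ ⌈p.re⌉₊ := pow_le_pow_left₀ (by linarith) (by nlinarith) _
    · refine Filter.Eventually.of_forall fun s => ?_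
      refine (Filter.Tendsto.mul tendsto_const_nhds ?_).const_mul _
      have h1 : Filter.Tendsto (fun t : ℝ => (1 + ((t⁻¹ * s : ℝ) : ℂ))) Filter.atTop (nhds 1) := by
        have := (tendsto_inv_atTop_zero (𝕜 := ℝ)).mul_const s
        rw [zero_mul] at this
        simpa using ((Complex.continuous_ofReal.tendsto 0).comp this).const_add 1
      have h2 : ContinuousAt (fun w : ℂ => w ^ p) 1 :=
        continuousAt_id.cpow continuousAt_const (by simp)
      have h3 := h2.tendsto.comp h1
      simpa [Function.comp_def] using h3
  have hG : ∫ u in Set.Ioi (0 : ℝ), (u : ℂ) ^ (a - 1) * (cexp (-u) * 1) = Complex.Gamma a := by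
    rw [Complex.Gamma_eq_integral ha, Complex.GammaIntegral]
    refine setIntegral_congr_fun measurableSet_Ioi fun u _ => ?_
    simp only [mul_one]
    push_cast
    ring
  rw [hG] at hlim
  have := hlim.const_mul (Complex.Gamma a)⁻¹
  rw [inv_mul_cancel₀ hΓ] at this
  refine this.congr' ?_
  filter_upwards [Filter.eventually_gt_atTop 0] with t ht
  rw [hsub t ht]

/-- One more integration by parts changes nothing. Unfolded, this is also the contiguous relation
used below. -/
lemma confl_succ {N : ℕ} {a : ℂ} (ha : 0 < a.re + N) (p : ℂ) {t : ℝ} (ht : 0 < t) :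
    confl (N + 1) a p t = confl N a p t := by
  induction N generalizing a p with
  | zero => exact confInt_by_parts (by simpa using ha) p ht
  | succ N ih =>
    have h1 : 0 < (a + 1).re + N := by push_cast at ha; simp; linarith
    rw [confl, ih h1, ih h1, confl]

lemma confl_add (N M : ℕ) {a : ℂ} (ha : 0 < a.re + N) (p : ℂ) {t : ℝ} (ht : 0 < t) :
    confl (N + M) a p t = confl N a p t := by
  induction M with
  | zero => rfl
  | succ M ih =>
    rw [← add_assoc, confl_succ (by push_cast; have := Nat.cast_nonneg (α := ℝ) M; linarith) p ht, ih]

lemma confl_eq {N M : ℕ} {a : ℂ} (hN : 0 < a.re + N) (hM : 0 < a.re + M) (p : ℂ) {t : ℝ}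
    (ht : 0 < t) : confl N a p t = confl M a p t := by
  rw [← confl_add N M hN p ht, add_comm, confl_add M N hM p ht]

lemma hasDerivAt_confl {N : ℕ} {a : ℂ} (ha : 0 < a.re + N) (p : ℂ) {t : ℝ} (ht : 0 < t) :
    HasDerivAt (confl N a p) (-a * confl N (a + 1) p t) t := by
  induction N generalizing a p with
  | zero => exact hasDerivAt_confInt (by simpa using ha) p ht
  | succ N ih =>
    have h1 : 0 < (a + 1).re + N := by push_cast at ha; simp; linarith
    have h2 := ((Complex.ofRealCLM.hasDerivAt (x := t)).mul (ih h1 p)).sub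
      ((ih h1 (p - 1)).const_mul p)
    refine h2.congr_deriv ?_
    have h3 := confl_succ h1 p ht
    rw [confl] at h3
    simp only [confl, Complex.ofRealCLM_apply, Complex.ofReal_one]
    linear_combination -h3

lemma confl_add_one {N : ℕ} {a : ℂ} (ha : 0 < a.re + N) (p : ℂ) {t : ℝ} (ht : 0 < t) :
    confl N a (p + 1) t = confl N a p t + a * confl N (a + 1) p t := by
  induction N generalizing a p with
  | zero => exact confInt_add_one (by simpa using ha) p ht
  | succ N ih =>
    have h1 : 0 < (a + 1).re + N := by push_cast at ha; simp; linarith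
    have h2 := ih h1 (p - 1)
    rw [sub_add_cancel] at h2
    have h3 := confl_succ h1 p ht
    rw [confl] at h3
    simp only [confl, ih h1 p, add_sub_cancel_right]
    linear_combination -p * h2 + h3

lemma tendsto_confl {N : ℕ} {a : ℂ} (ha : 0 < a.re + N) (p : ℂ) :
    Filter.Tendsto (fun t : ℝ => (t : ℂ) ^ a * confl N a p t) Filter.atTop (nhds 1) := by
  induction N generalizing a p with
  | zero => exact tendsto_confInt (by simpa using ha) p
  | succ N ih =>
    have h1 : 0 < (a + 1).re + N := by push_cast at ha; simp; linarith
    have h2 : Filter.Tendsto (fun t : ℝ => ((t⁻¹ : ℝ) : ℂ)) Filter.atTop (nhds 0) := by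
      simpa [Function.comp_def] using
        (Complex.continuous_ofReal.tendsto 0).comp (tendsto_inv_atTop_zero (𝕜 := ℝ))
    have h3 := (ih h1 p).sub ((h2.const_mul p).mul (ih h1 (p - 1)))
    simp only [mul_zero, zero_mul, sub_zero] at h3
    refine h3.congr' ?_
    filter_upwards [Filter.eventually_gt_atTop 0] with t ht
    have h0 : (t : ℂ) ≠ 0 := by exact_mod_cast ht.ne'
    rw [confl, Complex.cpow_add _ _ h0, Complex.cpow_one]
    push_cast
    field_simp

/-! ### Tricomi's function and Whittaker's function -/

lemma contDiffAt_kern (p : ℂ) (t : ℝ) {s : ℝ} (hs : -1 < s) (n : ℕ) :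
    ContDiffAt ℝ n (kern p t) s := by
  have h0 : ContDiffAt ℝ n (fun s : ℝ => (s : ℂ)) s := Complex.ofRealCLM.contDiff.contDiffAt
  have h1 : ContDiffAt ℝ n (fun s : ℝ => (1 + (s : ℂ))) s := contDiffAt_const.add h0
  have h2 : ContDiffAt ℝ n (fun s : ℝ => (1 + (s : ℂ)) ^ p) s := by
    have h3 : ContDiffAt ℂ n (fun w : ℂ => w ^ p) (1 + (s : ℂ)) :=
      (analyticAt_id.cpow analyticAt_const (one_add_mem_slitPlane hs)).contDiffAt
    exact (h3.restrict_scalars ℝ).comp s h1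
  exact (contDiffAt_const.mul h0).cexp.mul h2

lemma iteratedDeriv_succ_kern (N : ℕ) (p : ℂ) (t : ℝ) {s : ℝ} (hs : -1 < s) :
    iteratedDeriv (N + 1) (kern p t) s =
      -(t * iteratedDeriv N (kern p t) s - p * iteratedDeriv N (kern (p - 1) t) s) := by
  rw [iteratedDeriv_succ']
  have h1 : deriv (kern p t) =ᶠ[nhds s] fun s => -(t * kern p t s - p * kern (p - 1) t s) := by
    filter_upwards [Ioi_mem_nhds hs] with u hu
    exact (hasDerivAt_kern p t hu).deriv
  have c1 := contDiffAt_kern p t hs N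
  have c2 := contDiffAt_kern (p - 1) t hs N
  rw [h1.iteratedDeriv_eq, iteratedDeriv_fun_neg, iteratedDeriv_fun_sub (contDiffAt_const.mul c1)
    (contDiffAt_const.mul c2), iteratedDeriv_const_mul _ c1, iteratedDeriv_const_mul _ c2]

/-- One derivative of the kernel yields the two terms of the recursion for `confl`. Passing from `(N
+ 1, a)` to `(N, a + 1)` keeps `a + N`, hence the power of `s` and the Gamma factor. -/
lemma confl_eq_integral (N : ℕ) {a : ℂ} (ha : 0 < a.re + N) (p : ℂ) {t : ℝ} (ht : 0 < t) :
    IntegrableOn (fun s : ℝ => (s : ℂ) ^ (a + N - 1) * ((-1) ^ N * iteratedDeriv N (kern p t) s))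
      (Set.Ioi 0) ∧
    (Complex.Gamma (a + N))⁻¹ * ∫ s in Set.Ioi (0 : ℝ), (s : ℂ) ^ (a + N - 1) *
      ((-1) ^ N * iteratedDeriv N (kern p t) s) = confl N a p t := by
  induction N generalizing a p with
  | zero =>
    simp only [Nat.cast_zero, add_zero, pow_zero, one_mul, iteratedDeriv_zero]
    exact ⟨integrableOn_integrand (by simpa using ha) p ht, rfl⟩
  | succ N ih =>
    have h1 : 0 < (a + 1).re + N := by push_cast at ha; simp; linarith
    obtain ⟨i1, e1⟩ := ih h1 p
    obtain ⟨i2, e2⟩ := ih h1 (p - 1)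
    have hcast : a + ((N + 1 : ℕ) : ℂ) = a + 1 + N := by push_cast; ring
    have hcongr : ∀ s ∈ Set.Ioi (0 : ℝ), (s : ℂ) ^ (a + ((N + 1 : ℕ) : ℂ) - 1) *
        ((-1) ^ (N + 1) * iteratedDeriv (N + 1) (kern p t) s) =
        t * ((s : ℂ) ^ (a + 1 + N - 1) * ((-1) ^ N * iteratedDeriv N (kern p t) s)) -
        p * ((s : ℂ) ^ (a + 1 + N - 1) * ((-1) ^ N * iteratedDeriv N (kern (p - 1) t) s)) := by
      intro s hs
      have hs0 : 0 < s := hs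
      rw [iteratedDeriv_succ_kern N p t (by linarith), hcast]
      ring
    refine ⟨IntegrableOn.congr_fun ((i1.const_mul (t : ℂ)).sub (i2.const_mul p))
      (fun s hs => (hcongr s hs).symm) measurableSet_Ioi, ?_⟩
    rw [setIntegral_congr_fun measurableSet_Ioi hcongr,
      integral_sub (i1.const_mul _) (i2.const_mul p), integral_const_mul, integral_const_mul, confl,
      ← e1, ← e2, hcast]
    ring

lemma regOrder_spec (a : ℂ) : 0 < a.re + regOrder a := by
  have := Nat.lt_floor_add_one (1 - a.re)
  rw [regOrder]; linarith

lemma tricomiU_eq (a c : ℂ) {t : ℝ} (ht : 0 < t) {N : ℕ} (hN : 0 < a.re + N) :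
    tricomiU a c t = confl N a (c - a - 1) t := by
  rw [← confl_eq (regOrder_spec a) hN _ ht, ← (confl_eq_integral _ (regOrder_spec a) _ ht).2]
  rfl

/-- Any admissible `N` may replace the minimal one of the definition, so that functions with
neighbouring `κ` can be written with related orders. -/
lemma whittakerW_eq (κ μ : ℂ) {t : ℝ} (ht : 0 < t) {N : ℕ} (hN : 0 < (μ - κ + 1 / 2).re + N) :
    whittakerW κ μ t = cexp (-(t : ℂ) / 2) * (t : ℂ) ^ (μ + 1 / 2) *
      confl N (μ - κ + 1 / 2) (μ + κ - 1 / 2) t := by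
  rw [whittakerW, tricomiU_eq _ _ ht hN]
  congr 2; ring

lemma exists_order (a : ℂ) : ∃ N : ℕ, 0 < a.re + N :=
  ⟨regOrder a, regOrder_spec a⟩

/-- With `a = μ - κ + 1/2` and `p = μ + κ - 1/2`, lowering `κ` means `(a, p) ↦ (a + 1, p - 1)`, and
the coefficient is `a p = μ² - (κ - 1/2)²`. -/
lemma hasDerivAt_whittakerW (κ μ : ℂ) {t : ℝ} (ht : 0 < t) :
    HasDerivAt (whittakerW κ μ) (((κ - t / 2) * whittakerW κ μ t -
      (μ ^ 2 - (κ - 1 / 2) ^ 2) * whittakerW (κ - 1) μ t) / t) t := by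
  obtain ⟨N, hN⟩ := exists_order (μ - κ + 1 / 2)
  set a := μ - κ + 1 / 2 with ha
  set p := μ + κ - 1 / 2 with hp
  have h0 : (t : ℂ) ≠ 0 := by exact_mod_cast ht.ne'
  have ha1 : μ - (κ - 1) + 1 / 2 = a + 1 := by rw [ha]; ring
  have hp1 : μ + (κ - 1) - 1 / 2 = p - 1 := by rw [hp]; ring
  have hN1 : 0 < (a + 1).re + N := by simp; linarith
  have hloc : whittakerW κ μ =ᶠ[nhds t] fun t : ℝ => cexp (-(t : ℂ) / 2) * (t : ℂ) ^ (μ + 1 / 2) *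
      confl N a p t := by
    filter_upwards [Ioi_mem_nhds ht] with u hu
    exact whittakerW_eq κ μ hu hN
  have e1 : HasDerivAt (fun t : ℝ => cexp (-(t : ℂ) / 2)) (cexp (-(t : ℂ) / 2) * (-1 / 2)) t :=
    ((Complex.ofRealCLM.hasDerivAt (x := t)).neg.div_const 2).cexp
  have e2 : HasDerivAt (fun t : ℝ => (t : ℂ) ^ (μ + 1 / 2))
      ((μ + 1 / 2) * (t : ℂ) ^ (μ + 1 / 2 - 1) * 1) t :=
    ((hasDerivAt_id (t : ℂ)).cpow_const (by left; simpa)).comp_ofReal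
  have e3 := (e1.mul e2).mul (hasDerivAt_confl hN p ht)
  refine (e3.congr_of_eventuallyEq hloc).congr_deriv ?_
  rw [whittakerW_eq κ μ ht hN, whittakerW_eq (κ - 1) μ ht (N := N) (by rw [ha1]; exact hN1), ha1, hp1,
    eq_div_iff h0]
  have h3 := confl_succ hN p ht
  rw [confl] at h3
  have h4 := cpow_sub_one_mul (μ + 1 / 2) ht
  simp only [Pi.mul_apply]
  have hκ : κ = μ + 1 / 2 - a := by rw [ha]; ring
  have hap : μ ^ 2 - (κ - 1 / 2) ^ 2 = a * p := by rw [ha, hp]; ring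
  rw [hap, ← h4]
  linear_combination (-a * cexp (-(t : ℂ) / 2) * (t : ℂ) ^ (μ + 1 / 2 - 1) * t) * h3 -
    (cexp (-(t : ℂ) / 2) * (t : ℂ) ^ (μ + 1 / 2 - 1) * t * confl N a p t) * hκ

lemma whittakerW_add_one (κ μ : ℂ) {t : ℝ} (ht : 0 < t) :
    whittakerW (κ + 1) μ t = (t - 2 * κ) * whittakerW κ μ t +
      (μ ^ 2 - (κ - 1 / 2) ^ 2) * whittakerW (κ - 1) μ t := by
  obtain ⟨N, hN⟩ := exists_order (μ - κ + 1 / 2)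
  set a := μ - κ + 1 / 2 with ha
  set p := μ + κ - 1 / 2 with hp
  have ha1 : μ - (κ - 1) + 1 / 2 = a + 1 := by rw [ha]; ring
  have hp1 : μ + (κ - 1) - 1 / 2 = p - 1 := by rw [hp]; ring
  have ha2 : μ - (κ + 1) + 1 / 2 = a - 1 := by rw [ha]; ring
  have hp2 : μ + (κ + 1) - 1 / 2 = p + 1 := by rw [hp]; ring
  have hN1 : 0 < (a + 1).re + N := by simp; linarith
  -- Raising `κ` lowers `a` by one, which costs one more integration by parts.
  have hN2 : 0 < (a - 1).re + (N + 1 : ℕ) := by push_cast; simp; linarith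
  rw [whittakerW_eq κ μ ht hN, whittakerW_eq (κ - 1) μ ht (N := N) (by rw [ha1]; exact hN1),
    whittakerW_eq (κ + 1) μ ht (N := N + 1) (by rw [ha2]; exact hN2), ha1, hp1, ha2, hp2]
  have h3 := confl_succ hN p ht
  rw [confl] at h3 ⊢
  have h5 := confl_add_one hN p ht
  rw [sub_add_cancel, add_sub_cancel_right]
  have hap : μ ^ 2 - (κ - 1 / 2) ^ 2 = a * p := by rw [ha, hp]; ring
  have hκ : 2 * κ = p + 1 - a := by rw [ha, hp]; ring
  rw [hap, hκ, h5]
  linear_combination (a * cexp (-(t : ℂ) / 2) * (t : ℂ) ^ (μ + 1 / 2)) * h3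

/-- For large `t` the confluent factor times `t^a` is close to `1`. -/
lemma exists_whittakerW_ne_zero (κ μ : ℂ) : ∃ t : ℝ, 0 < t ∧ whittakerW κ μ t ≠ 0 := by
  obtain ⟨N, hN⟩ := exists_order (μ - κ + 1 / 2)
  have h := tendsto_confl hN (μ + κ - 1 / 2)
  have h1 := h.eventually_ne one_ne_zero
  obtain ⟨t, ht, ht0⟩ := (h1.and (Filter.eventually_gt_atTop 0)).exists
  refine ⟨t, ht0, ?_⟩
  have h0 : (t : ℂ) ≠ 0 := by exact_mod_cast (ne_of_gt ht0)
  rw [whittakerW_eq κ μ ht0 hN]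
  exact mul_ne_zero (mul_ne_zero (Complex.exp_ne_zero _) (by simp [Complex.cpow_eq_zero_iff, h0]))
    (right_ne_zero_of_mul ht)

/-! ### The Hecke operators and automorphy -/

/-- An integral matrix of nonzero determinant as an element of `GL(2, ℝ)`. -/
def toGL {m : ℤ} (hm : m ≠ 0) (M : FixedDetMatrix (Fin 2) ℤ m) : GL (Fin 2) ℝ :=
  Matrix.GeneralLinearGroup.mkOfDetNeZero (M.1.map (Int.castRingHom ℝ)) (by
    rw [← RingHom.mapMatrix_apply, ← RingHom.map_det, M.2]
    simpa using hm)

variable {m : ℤ}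

lemma coe_toGL (hm : m ≠ 0) (M : FixedDetMatrix (Fin 2) ℤ m) :
    (toGL hm M : Matrix (Fin 2) (Fin 2) ℝ) = M.1.map (Int.castRingHom ℝ) := rfl

lemma det_toGL (hm : m ≠ 0) (M : FixedDetMatrix (Fin 2) ℤ m) :
    (toGL hm M).det.val = m := by
  rw [Matrix.GeneralLinearGroup.val_det_apply, coe_toGL, ← RingHom.mapMatrix_apply,
    ← RingHom.map_det, M.2]
  simp

lemma denom_toGL (hm : m ≠ 0) (M : FixedDetMatrix (Fin 2) ℤ m) (z : ℂ) :
    denom (toGL hm M) z = (M.1 1 0 : ℂ) * z + (M.1 1 1 : ℂ) := by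
  simp [denom, coe_toGL]

lemma num_toGL (hm : m ≠ 0) (M : FixedDetMatrix (Fin 2) ℤ m) (z : ℂ) :
    num (toGL hm M) z = (M.1 0 0 : ℂ) * z + (M.1 0 1 : ℂ) := by
  simp [num, coe_toGL]

/-- Right multiplication of a matrix of fixed determinant by an element of `SL(2, ℤ)`. -/
def mulSL (M : FixedDetMatrix (Fin 2) ℤ m) (A : SL(2, ℤ)) : FixedDetMatrix (Fin 2) ℤ m :=
  ⟨M.1 * A.1, by rw [Matrix.det_mul, M.2, A.2, mul_one]⟩

lemma toGL_smul (hm : m ≠ 0) (A : SL(2, ℤ)) (M : FixedDetMatrix (Fin 2) ℤ m) :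
    toGL hm (A • M) = (A : GL (Fin 2) ℝ) * toGL hm M := by
  ext i j
  simp [coe_toGL, FixedDetMatrices.smul_coe, Matrix.mul_apply]

lemma toGL_mulSL (hm : m ≠ 0) (M : FixedDetMatrix (Fin 2) ℤ m) (A : SL(2, ℤ)) :
    toGL hm (mulSL M A) = toGL hm M * (A : GL (Fin 2) ℝ) := by
  ext i j
  simp [coe_toGL, Matrix.mul_apply]
  simp [mulSL, Matrix.mul_apply]

/-- The multiplier of the Hecke operator on integral matrices. -/
def twist (k : ℕ) (M : FixedDetMatrix (Fin 2) ℤ m) : ℂ :=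
  (chr k (-M.1 0 0) (-M.1 0 1) (M.1 1 0) (M.1 1 1))⁻¹

lemma det_condition {k : ℕ} {N : ℕ} (hN : ((k : ZMod N)) * (m + 1) = 0)
    (M : FixedDetMatrix (Fin 2) ℤ m) :
    (k : ZMod N) * ((M.1 0 0 : ZMod N) * (M.1 1 1 : ZMod N) -
      (M.1 0 1 : ZMod N) * (M.1 1 0 : ZMod N) + 1) = 0 := by
  have h := M.2
  rw [Matrix.det_fin_two] at h
  have h' := congrArg (Int.cast : ℤ → ZMod N) h
  push_cast at h'
  rw [h', hN]

lemma entries_T_smul (M : FixedDetMatrix (Fin 2) ℤ m) :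
    (ModularGroup.T • M).1 0 0 = M.1 0 0 + M.1 1 0 ∧
    (ModularGroup.T • M).1 0 1 = M.1 0 1 + M.1 1 1 ∧ (ModularGroup.T • M).1 1 0 = M.1 1 0 ∧
    (ModularGroup.T • M).1 1 1 = M.1 1 1 := by
  simp [FixedDetMatrices.smul_coe, ModularGroup.coe_T, Matrix.mul_apply, Fin.sum_univ_two]

lemma entries_S_smul (M : FixedDetMatrix (Fin 2) ℤ m) :
    (ModularGroup.S • M).1 0 0 = -M.1 1 0 ∧
    (ModularGroup.S • M).1 0 1 = -M.1 1 1 ∧ (ModularGroup.S • M).1 1 0 = M.1 0 0 ∧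
    (ModularGroup.S • M).1 1 1 = M.1 0 1 := by
  simp [FixedDetMatrices.smul_coe, ModularGroup.coe_S, Matrix.mul_apply, Fin.sum_univ_two]

lemma entries_mulSL_T (M : FixedDetMatrix (Fin 2) ℤ m) :
    (mulSL M ModularGroup.T).1 0 0 = M.1 0 0 ∧
    (mulSL M ModularGroup.T).1 0 1 = M.1 0 0 + M.1 0 1 ∧
    (mulSL M ModularGroup.T).1 1 0 = M.1 1 0 ∧
    (mulSL M ModularGroup.T).1 1 1 = M.1 1 0 + M.1 1 1 := by
  simp [mulSL, ModularGroup.coe_T, Matrix.mul_apply, Fin.sum_univ_two]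

lemma entries_mulSL_S (M : FixedDetMatrix (Fin 2) ℤ m) :
    (mulSL M ModularGroup.S).1 0 0 = M.1 0 1 ∧
    (mulSL M ModularGroup.S).1 0 1 = -M.1 0 0 ∧
    (mulSL M ModularGroup.S).1 1 0 = M.1 1 1 ∧
    (mulSL M ModularGroup.S).1 1 1 = -M.1 1 0 := by
  simp [mulSL, ModularGroup.coe_S, Matrix.mul_apply, Fin.sum_univ_two]

section Twist

variable {k : ℕ} (h3 : (k : ZMod 3) * (m + 1) = 0) (h4 : (k : ZMod 4) * (m + 1) = 0)
  (M : FixedDetMatrix (Fin 2) ℤ m)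

include h3 h4

lemma twist_T_smul : twist k (ModularGroup.T • M) = chrT k * twist k M := by
  obtain ⟨e1, e2, e3, e4⟩ := entries_T_smul M
  simp only [twist, chr, chrT, e1, e2, e3, e4, Int.cast_add, Int.cast_neg]
  rw [eThree_twist_T _ _ _ _ _ (det_condition h3 M), eFour_twist_T _ _ _ _ _ (det_condition h4 M),
    neg_sub', sub_eq_add_neg, sub_eq_add_neg, AddChar.map_add_eq_mul, AddChar.map_add_eq_mul,
    AddChar.map_neg_eq_inv, AddChar.map_neg_eq_inv _ (-(k : ZMod 4))]
  simp only [mul_inv, inv_inv]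
  ring

lemma twist_S_smul : twist k (ModularGroup.S • M) = chrS k * twist k M := by
  obtain ⟨e1, e2, e3, e4⟩ := entries_S_smul M
  simp only [twist, chr, chrS, e1, e2, e3, e4, Int.cast_neg, neg_neg]
  rw [eThree_twist_S _ _ _ _ _ (det_condition h3 M), eFour_twist_S _ _ _ _ _ (det_condition h4 M),
    neg_sub', sub_eq_add_neg, AddChar.map_add_eq_mul, AddChar.map_neg_eq_inv _ (-(k : ZMod 4))]
  simp only [mul_inv, inv_inv]
  ring

lemma twist_mulSL_T : twist k M = chrT k * twist k (mulSL M ModularGroup.T) := by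
  obtain ⟨e1, e2, e3, e4⟩ := entries_mulSL_T M
  simp only [twist, chr, e1, e2, e3, e4, Int.cast_add, Int.cast_neg]
  rw [eThree_twist_mul_T _ _ _ _ _ (det_condition h3 M),
    eFour_twist_mul_T _ _ _ _ _ (det_condition h4 M), neg_add, AddChar.map_add_eq_mul,
    AddChar.map_add_eq_mul]
  have := chrT_ne_zero k
  rw [eq_comm, ← mul_right_inj' (inv_ne_zero this), inv_mul_cancel_left₀ this]
  simp only [chrT, mul_inv]
  ring

lemma twist_mulSL_S : twist k M = chrS k * twist k (mulSL M ModularGroup.S) := by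
  obtain ⟨e1, e2, e3, e4⟩ := entries_mulSL_S M
  simp only [twist, chr, e1, e2, e3, e4, Int.cast_neg, neg_neg]
  rw [eThree_twist_mul_S _ _ _ _ _ (det_condition h3 M),
    eFour_twist_mul_S _ _ _ _ _ (det_condition h4 M), neg_add, AddChar.map_add_eq_mul]
  have := chrS_ne_zero k
  rw [eq_comm, ← mul_right_inj' (inv_ne_zero this), inv_mul_cancel_left₀ this]
  simp only [chrS, mul_inv]
  ring

end Twist

/-- The contribution of an integral matrix to the Hecke operator. -/
def heckeTerm (k : ℕ) (hm : m ≠ 0) (g : ℍ → ℂ) (M : FixedDetMatrix (Fin 2) ℤ m) (z : ℍ) : ℂ :=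
  twist k M * (unitPow k (denom (toGL hm M) z))⁻¹ * g (toGL hm M • z)

lemma denom_mul_of_pos (A B : GL (Fin 2) ℝ) (hB : 0 < B.det.val) (z : ℍ) :
    denom (A * B) z = denom A (B • z : ℍ) * denom B z := by
  have := denom_cocycle_σ A B z
  rwa [σ, if_pos hB] at this

lemma heckeTerm_smul_aux {k : ℕ} (hm : 0 < m) {g : ℍ → ℂ}
    (hg : IsAut (fun A => (chrSL k A)⁻¹) k g) (A : SL(2, ℤ)) (M : FixedDetMatrix (Fin 2) ℤ m)
    (hA : twist k (A • M) = chrSL k A * twist k M) (z : ℍ) :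
    heckeTerm k hm.ne' g (A • M) z = heckeTerm k hm.ne' g M z := by
  have hd : 0 < (toGL hm.ne' M).det.val := by rw [det_toGL]; exact_mod_cast hm
  have h1 := unitPow_ne_zero k (den_ne_zero A (toGL hm.ne' M • z))
  have h2 : chrSL k A ≠ 0 := chr_ne_zero _ _ _ _ _
  rw [heckeTerm, heckeTerm, hA, toGL_smul, denom_mul_of_pos _ _ hd, mul_smul, ← den_eq,
    ← ModularGroup.sl_moeb, hg, unitPow_mul, mul_inv]
  field_simp

/-- The multiplier of `twist` cancels the inverse multiplier of `g`, and the two automorphy factors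
cancel. The term thus depends only on the coset of `M`. -/
lemma heckeTerm_smul {k : ℕ} (h3 : (k : ZMod 3) * (m + 1) = 0) (h4 : (k : ZMod 4) * (m + 1) = 0)
    (hm : 0 < m) {g : ℍ → ℂ} (hg : IsAut (fun A => (chrSL k A)⁻¹) k g) (A : SL(2, ℤ)) :
    ∀ (M : FixedDetMatrix (Fin 2) ℤ m) (z : ℍ),
    heckeTerm k hm.ne' g (A • M) z = heckeTerm k hm.ne' g M z := by
  have hA : A ∈ Subgroup.closure {ModularGroup.S, ModularGroup.T} := by
    rw [SpecialLinearGroup.SL2Z_generators]; trivial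
  induction hA using Subgroup.closure_induction with
  | mem x hx =>
    intro M z
    rcases hx with rfl | rfl
    · exact heckeTerm_smul_aux hm hg _ M (by rw [twist_S_smul h3 h4, chrSL_S]) z
    · exact heckeTerm_smul_aux hm hg _ M (by rw [twist_T_smul h3 h4, chrSL_T]) z
  | one => intro M z; rw [one_smul]
  | mul x y _ _ hx hy => intro M z; rw [mul_smul, hx, hy]
  | inv x _ hx => intro M z; rw [← hx, smul_inv_smul]

lemma heckeTerm_apply_smul {k : ℕ} (hm : m ≠ 0) {g : ℍ → ℂ} (A : SL(2, ℤ))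
    (M : FixedDetMatrix (Fin 2) ℤ m) {c : ℂ} (hA : twist k M = c * twist k (mulSL M A)) (z : ℍ) :
    heckeTerm k hm g M (A • z) = c * unitPow k (den A z) * heckeTerm k hm g (mulSL M A) z := by
  have h1 := unitPow_ne_zero k (den_ne_zero A z)
  have hd : 0 < (A : GL (Fin 2) ℝ).det.val := by simp
  rw [heckeTerm, heckeTerm, hA, toGL_mulSL, denom_mul_of_pos _ _ hd, mul_smul, ← den_eq,
    ← ModularGroup.sl_moeb, unitPow_mul, mul_inv]
  field_simp

/-! ### Coset representatives for matrices of determinant `m`. -/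

open FixedDetMatrices

lemma exists_smul_mem_reps (hm : m ≠ 0) (M : FixedDetMatrix (Fin 2) ℤ m) :
    ∃ A : SL(2, ℤ), A • M ∈ reps m := by
  induction M using induction_on hm with
  | h0 A h1 h2 h3 h4 => exact ⟨1, by rw [one_smul]; exact ⟨h1, h2, h3, h4⟩⟩
  | hS B hB =>
    obtain ⟨A, hA⟩ := hB
    exact ⟨A * ModularGroup.S⁻¹, by rwa [mul_smul, inv_smul_smul]⟩
  | hT B hB =>
    obtain ⟨A, hA⟩ := hB
    exact ⟨A * ModularGroup.T⁻¹, by rwa [mul_smul, inv_smul_smul]⟩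

lemma pos_of_mem_reps (hm : 0 < m) {M : FixedDetMatrix (Fin 2) ℤ m} (hM : M ∈ reps m) :
    M.1 0 0 * M.1 1 1 = m ∧ 0 < M.1 1 1 := by
  obtain ⟨h1, h2, h3, h4⟩ := hM
  have h := M.2
  rw [Matrix.det_fin_two, h1, mul_zero, sub_zero] at h
  exact ⟨h, pos_of_mul_pos_right (by rw [h]; exact hm) h2.le⟩

/-- Two upper triangular matrices with positive diagonal can only differ by a translation, and `0 ≤
b < d` makes it trivial. -/
lemma eq_of_smul_mem_reps (hm : 0 < m) {M : FixedDetMatrix (Fin 2) ℤ m} {A : SL(2, ℤ)}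
    (hM : M ∈ reps m) (hA : A • M ∈ reps m) : A • M = M := by
  obtain ⟨p1, p2⟩ := pos_of_mem_reps hm hM
  obtain ⟨q1, q2⟩ := pos_of_mem_reps hm hA
  obtain ⟨h1, h2, h3, h4⟩ := hM
  obtain ⟨h1', h2', h3', h4'⟩ := hA
  have hdet := A.det_coe
  rw [Matrix.det_fin_two] at hdet
  rw [abs_of_pos p2, abs_of_nonneg h3] at h4
  rw [abs_of_pos q2, abs_of_nonneg h3'] at h4'
  simp only [smul_coe, Matrix.mul_apply, Fin.sum_univ_two, h1, mul_zero, add_zero] at *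
  have hr : A.1 1 0 = 0 := by
    rcases mul_eq_zero.1 h1' with h | h
    · exact h
    · omega
  rw [hr] at hdet q2 h4' q1
  have hps : A.1 0 0 = 1 ∧ A.1 1 1 = 1 := by
    have hp : 0 < A.1 0 0 := pos_of_mul_pos_left h2' h2.le
    rcases Int.mul_eq_one_iff_eq_one_or_neg_one.1 (by simpa using hdet) with h | h
    · exact h
    · omega
  rw [hps.1] at h3' h4'
  rw [hps.2] at h4'
  have hq : A.1 0 1 = 0 := by
    by_contra hne
    rcases lt_or_gt_of_ne hne with h | h
    · nlinarith
    · nlinarith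
  have hA1 : A = 1 := by
    ext i j
    fin_cases i <;> fin_cases j <;> simp [hr, hps.1, hps.2, hq]
  rw [hA1, one_smul]

/-- Right multiplication followed by reduction to a representative is an injective map of a finite
set to itself, hence a permutation. -/
lemma sum_heckeTerm_mulSL {k : ℕ} (h3 : (k : ZMod 3) * (m + 1) = 0)
    (h4 : (k : ZMod 4) * (m + 1) = 0) (hm : 0 < m) {g : ℍ → ℂ}
    (hg : IsAut (fun A => (chrSL k A)⁻¹) k g) (A : SL(2, ℤ)) (z : ℍ) :
    ∑ M : reps m, heckeTerm k hm.ne' g (mulSL M.1 A) z =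
      ∑ M : reps m, heckeTerm k hm.ne' g M.1 z := by
  choose r hr using fun M : FixedDetMatrix (Fin 2) ℤ m => exists_smul_mem_reps hm.ne' M
  let φ : reps m → reps m := fun M => ⟨r (mulSL M.1 A) • mulSL M.1 A, hr _⟩
  have hinj : Function.Injective φ := by
    intro M N hMN
    have h1 : r (mulSL M.1 A) • mulSL M.1 A = r (mulSL N.1 A) • mulSL N.1 A :=
      congrArg Subtype.val hMN
    have h2 : mulSL M.1 A = ((r (mulSL M.1 A))⁻¹ * r (mulSL N.1 A)) • mulSL N.1 A := by
      rw [mul_smul, ← h1, inv_smul_smul]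
    set B := (r (mulSL M.1 A))⁻¹ * r (mulSL N.1 A)
    have h3 : M.1 = B • N.1 := by
      refine FixedDetMatrices.ext' (n := Fin 2) (R := ℤ) ?_
      have h4 : M.1.1 * A.1 = B.1 * (N.1.1 * A.1) := congrArg Subtype.val h2
      rw [← mul_assoc] at h4
      have h5 := congrArg (· * (A⁻¹ : SL(2, ℤ)).1) h4
      have h6 : A.1 * (A⁻¹ : SL(2, ℤ)).1 = 1 := by
        rw [← Matrix.SpecialLinearGroup.coe_mul, mul_inv_cancel, Matrix.SpecialLinearGroup.coe_one]
      simp only [mul_assoc, h6, mul_one] at h5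
      rw [smul_coe, h5]
    refine Subtype.ext ?_
    rw [h3]
    exact eq_of_smul_mem_reps hm N.2 (h3 ▸ M.2)
  have hbij := Finite.injective_iff_bijective.1 hinj
  rw [← hbij.sum_comp (fun M : reps m => heckeTerm k hm.ne' g M.1 z)]
  exact Finset.sum_congr rfl fun M _ => (heckeTerm_smul h3 h4 hm hg _ _ z).symm

lemma isAut_sum_heckeTerm {k : ℕ} (h3 : (k : ZMod 3) * (m + 1) = 0)
    (h4 : (k : ZMod 4) * (m + 1) = 0) (hm : 0 < m) {g : ℍ → ℂ}
    (hg : IsAut (fun A => (chrSL k A)⁻¹) k g) :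
    IsAut (chrSL k) k (fun z => ∑ M : reps m, heckeTerm k hm.ne' g M.1 z) := by
  refine isAut_of_generators k k (fun z => ?_) fun z => ?_
  · rw [← sum_heckeTerm_mulSL h3 h4 hm hg ModularGroup.S z, Finset.mul_sum]
    refine Finset.sum_congr rfl fun M _ => ?_
    rw [heckeTerm_apply_smul hm.ne' _ _ (twist_mulSL_S h3 h4 M.1), den_S]
  · rw [← sum_heckeTerm_mulSL h3 h4 hm hg ModularGroup.T z, Finset.mul_sum]
    refine Finset.sum_congr rfl fun M _ => ?_
    rw [heckeTerm_apply_smul hm.ne' _ _ (twist_mulSL_T h3 h4 M.1), den_T, unitPow_one, mul_one]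

/-- On triangular matrices the abstract multiplier is the one in the definition of the operator. The
character produces a power of `-i` and `χ_k` a power of `i`; they agree since `k(d - 1)` is even. -/
lemma twist_of_mem_reps {k : ℕ} (hodd : ∀ d : ℤ, d ∣ m → Even (k * (d - 1)))
    {M : FixedDetMatrix (Fin 2) ℤ m} (hm : 0 < m) (hM : M ∈ reps m) {b d : ℕ}
    (hb : M.1 0 1 = b) (hd : M.1 1 1 = d) :
    twist k M = chi k d * (cexp (-(π * Complex.I * k / 6)) ^ (b * d))⁻¹ := by
  obtain ⟨p1, p2⟩ := pos_of_mem_reps hm hM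
  have heven := hodd d (hd ▸ Dvd.intro_left _ p1)
  have hc : M.1 1 0 = 0 := hM.1
  have d1 : 1 ≤ d := by rw [hd] at p2; exact_mod_cast p2
  obtain ⟨d, rfl⟩ := Nat.exists_eq_add_of_le d1
  rw [twist, hb, hd, hc, chr, eThree, eFour]
  have h1 : (k : ZMod 3) * ((((-M.1 0 0 : ℤ) : ZMod 3) + (((1 + d : ℕ) : ℤ) : ZMod 3)) *
      ((0 : ℤ) : ZMod 3) - ((-(b : ℤ) : ℤ) : ZMod 3) * (((1 + d : ℕ) : ℤ) : ZMod 3) *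
      (((0 : ℤ) : ZMod 3) ^ 2 - 1)) = -((b * (1 + d)) • (k : ZMod 3)) := by
    push_cast; rw [nsmul_eq_mul]; push_cast; ring
  have h2 : -((k : ZMod 4) * ((((-M.1 0 0 : ℤ) : ZMod 4) + 2 * (((1 + d : ℕ) : ℤ) : ZMod 4)) *
      ((0 : ℤ) : ZMod 4) + ((-(b : ℤ) : ℤ) : ZMod 4) * (((1 + d : ℕ) : ℤ) : ZMod 4) -
      (((1 + d : ℕ) : ℤ) : ZMod 4) + 1)) = -((b * (1 + d)) • (-(k : ZMod 4))) -
      d • (-(k : ZMod 4)) := by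
    push_cast; rw [nsmul_eq_mul, nsmul_eq_mul]; push_cast; ring
  rw [if_pos (by simp), h1, h2, AddChar.map_neg_eq_inv, AddChar.map_sub_eq_div,
    AddChar.map_neg_eq_inv, AddChar.map_nsmul_eq_pow, AddChar.map_nsmul_eq_pow,
    AddChar.map_nsmul_eq_pow, ← chrS, chrS_eq]
  have h3 : cexp (-(π * Complex.I * k / 6)) = (chrT k)⁻¹ := by
    rw [chrT_eq, ← Complex.exp_neg]; congr 1; ring
  have h4 : chi k (1 + d) = ((-Complex.I) ^ k) ^ d := by
    have h5 : Even (k * d) := by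
      push_cast at heven
      rw [add_sub_cancel_left] at heven
      exact_mod_cast heven
    rw [← pow_mul, neg_pow, h5.neg_one_pow, one_mul, chi]
    push_cast
    rw [add_sub_cancel_left]
    exact_mod_cast rfl
  rw [h3, h4, chrT, ← chrS, chrS_eq]
  have hX : ZMod.stdAddChar (k : ZMod 3) ≠ (0 : ℂ) := stdAddChar_ne_zero _
  have hY : (-Complex.I) ^ k ≠ 0 := by simp
  generalize ZMod.stdAddChar (k : ZMod 3) = X at hX ⊢
  generalize (-Complex.I) ^ k = Y at hY ⊢
  simp only [mul_inv, inv_inv, div_eq_mul_inv, mul_pow, inv_pow]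
  ring

lemma toGL_smul_of_mem_reps (hm : 0 < m) {M : FixedDetMatrix (Fin 2) ℤ m} (hM : M ∈ reps m)
    {a b d : ℕ} (ha : M.1 0 0 = a) (hb : M.1 0 1 = b) (hd : M.1 1 1 = d) (z : ℍ) :
    toGL hm.ne' M • z = ofComplex (((a : ℂ) * z + b) / d) := by
  obtain ⟨p1, p2⟩ := pos_of_mem_reps hm hM
  have hc : M.1 1 0 = 0 := hM.1
  have hdet : 0 < (toGL hm.ne' M).det.val := by rw [det_toGL]; exact_mod_cast hm
  have h := coe_smul_of_det_pos hdet z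
  rw [num_toGL, denom_toGL, ha, hb, hd, hc] at h
  rw [← ofComplex_apply (toGL hm.ne' M • z), h]
  simp

lemma unitPow_of_pos (k : ℤ) {d : ℕ} (hd : 0 < d) : unitPow k (d : ℂ) = 1 := by
  have : (d : ℂ) ≠ 0 := by exact_mod_cast hd.ne'
  simp [unitPow, this]

lemma sum_reps {m : ℕ} (hm : 0 < m) (F : ℤ → ℤ → ℤ → ℂ) :
    ∑ M : reps (m : ℤ), F (M.1.1 0 0) (M.1.1 0 1) (M.1.1 1 1) =
      ∑ d ∈ m.divisors, ∑ b ∈ Finset.range d, F ((m / d : ℕ) : ℤ) b d := by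
  have hm' : (0 : ℤ) < m := by exact_mod_cast hm
  rw [Finset.sum_sigma']
  refine Finset.sum_bij'
    (i := fun M _ => (⟨(M.1.1 1 1).toNat, (M.1.1 0 1).toNat⟩ : Σ _ : ℕ, ℕ))
    (j := fun p hp => ⟨⟨!![((m / p.1 : ℕ) : ℤ), (p.2 : ℤ); 0, (p.1 : ℤ)], by
      rw [Finset.mem_sigma, Nat.mem_divisors] at hp
      rw [Matrix.det_fin_two_of, mul_zero, sub_zero]
      exact_mod_cast Nat.div_mul_cancel hp.1.1⟩, by
      rw [Finset.mem_sigma, Nat.mem_divisors, Finset.mem_range] at hp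
      have h1 : 0 < m / p.1 := Nat.div_pos (Nat.le_of_dvd hm hp.1.1) (by omega)
      refine ⟨by simp, ?_, by simp, ?_⟩
      · simpa using (by exact_mod_cast h1 : (0 : ℤ) < ((m / p.1 : ℕ) : ℤ))
      · simpa using hp.2⟩) ?_ ?_ ?_ ?_ ?_
  · intro M _
    obtain ⟨p1, p2⟩ := pos_of_mem_reps hm' M.2
    obtain ⟨h1, h2, h3, h4⟩ := M.2
    rw [abs_of_pos p2, abs_of_nonneg h3] at h4
    rw [Finset.mem_sigma, Nat.mem_divisors, Finset.mem_range]
    refine ⟨⟨?_, hm.ne'⟩, by simp only; omega⟩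
    have : M.1.1 1 1 ∣ (m : ℤ) := Dvd.intro_left _ p1
    rw [← Int.natCast_dvd_natCast]
    simpa [p2.le] using this
  · simp
  · intro M _
    obtain ⟨p1, p2⟩ := pos_of_mem_reps hm' M.2
    obtain ⟨h1, h2, h3, h4⟩ := M.2
    refine Subtype.ext (FixedDetMatrices.ext' (n := Fin 2) (R := ℤ) ?_)
    have h5 : (m : ℤ) / M.1.1 1 1 = M.1.1 0 0 :=
      Int.ediv_eq_of_eq_mul_left p2.ne' p1.symm
    ext i j
    fin_cases i <;> fin_cases j <;> simp [h1, h3, p2.le, h5]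
  · intro p _
    simp
  · intro M _
    obtain ⟨p1, p2⟩ := pos_of_mem_reps hm' M.2
    obtain ⟨h1, h2, h3, h4⟩ := M.2
    have h5 : (m : ℤ) / M.1.1 1 1 = M.1.1 0 0 :=
      Int.ediv_eq_of_eq_mul_left p2.ne' p1.symm
    simp [h3, p2.le, h5]

lemma heckeBar_eq {k m : ℕ} (hodd : ∀ d : ℤ, d ∣ m → Even (k * (d - 1))) (hm : 0 < m)
    (g : ℍ → ℂ) (z : ℍ) :
    heckeBar k m g z = ((1 / √(m : ℝ) : ℝ) : ℂ) * ∑ M : reps (m : ℤ),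
      heckeTerm k (by exact_mod_cast hm.ne' : (m : ℤ) ≠ 0) g M.1 z := by
  have hm' : (0 : ℤ) < m := by exact_mod_cast hm
  rw [heckeBar, heckeOp]
  congr 1
  have h := sum_reps hm fun a b d => chi k d.toNat *
    ((cexp (-(π * Complex.I * k / 6)) ^ (b.toNat * d.toNat))⁻¹ *
      g (ofComplex (((a : ℂ) * z + b) / d)))
  simp only [Int.toNat_natCast, Int.cast_natCast] at h
  simp only [Finset.mul_sum]
  rw [← h]
  refine Finset.sum_congr rfl fun M _ => ?_
  obtain ⟨p1, p2⟩ := pos_of_mem_reps hm' M.2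
  obtain ⟨h1, h2, h3, h4⟩ := id M.2
  obtain ⟨a, ha⟩ := Int.eq_ofNat_of_zero_le h2.le
  obtain ⟨b, hb⟩ := Int.eq_ofNat_of_zero_le h3
  obtain ⟨d, hd⟩ := Int.eq_ofNat_of_zero_le p2.le
  have hd0 : 0 < d := by rw [hd] at p2; exact_mod_cast p2
  have hc : M.1.1 1 0 = 0 := h1
  rw [heckeTerm, twist_of_mem_reps hodd hm' M.2 hb hd, toGL_smul_of_mem_reps hm' M.2 ha hb hd,
    denom_toGL, hc, ha, hb, hd]
  simp [unitPow_of_pos _ hd0]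
  ring

lemma isAut_heckeBar {k m : ℕ} (hm : 0 < m) (hkm : (k : ℤ) * m ≡ -k [ZMOD 12]) {g : ℍ → ℂ}
    (hg : IsAut (fun A => (chrSL k A)⁻¹) k g) : IsAut (chrSL k) k (heckeBar k m g) := by
  have hm' : (0 : ℤ) < m := by exact_mod_cast hm
  have h12 : (12 : ℤ) ∣ k * (m + 1) := by
    have := hkm.symm.dvd
    rwa [sub_neg_eq_add, ← mul_add_one] at this
  have h3 : (k : ZMod 3) * ((m : ℤ) + 1) = 0 := by
    have := (ZMod.intCast_zmod_eq_zero_iff_dvd (k * (m + 1) : ℤ) 3).2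
      (dvd_trans (by norm_num) h12)
    exact_mod_cast this
  have h4 : (k : ZMod 4) * ((m : ℤ) + 1) = 0 := by
    have := (ZMod.intCast_zmod_eq_zero_iff_dvd (k * (m + 1) : ℤ) 4).2
      (dvd_trans (by norm_num) h12)
    exact_mod_cast this
  -- `k(m + 1)` is even: either `k` is even, or `m` is odd and so are its divisors.
  have hodd : ∀ d : ℤ, d ∣ m → Even (k * (d - 1)) := by
    intro d hd
    have h2 : Even ((k : ℤ) * (m + 1)) := (even_iff_two_dvd).2 (dvd_trans (by norm_num) h12)
    rcases Int.even_mul.1 h2 with h | h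
    · exact h.mul_right _
    · refine Even.mul_left ?_ _
      have hmo : Odd (m : ℤ) := by simpa [Int.even_add_one] using h
      exact (Int.Odd.of_mul_left (hd.choose_spec ▸ hmo)).sub_odd odd_one
  intro A z
  have h := isAut_sum_heckeTerm h3 h4 hm' hg A z
  beta_reduce at h
  rw [heckeBar_eq hodd hm, heckeBar_eq hodd hm, h]
  ring

/-! ### Preservation of spaces of Maass forms -/

lemma norm_chrT (k : ℕ) : ‖chrT k‖ = 1 := by
  rw [← chrSL_T]; exact norm_chr _ _ _ _ _

lemma IsMaassForm.isAut {k : ℕ} {R : ℝ} {f : ℍ → ℂ} (h : IsMaassForm (etaMult k) k R f) :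
    IsAut (chrSL k) k f := by
  have := (isAut_iff _ _ _).2 h.automorphic
  rwa [show etaMult k = chrSL k from funext (etaMult_eq k)] at this

lemma IsMaassForm.isAut_bar {k : ℕ} {R : ℝ} {f : ℍ → ℂ} (h : IsMaassForm (etaMultBar k) k R f) :
    IsAut (fun A => (chrSL k A)⁻¹) k f := by
  have := (isAut_iff _ _ _).2 h.automorphic
  rwa [show etaMultBar k = fun A => (chrSL k A)⁻¹ from funext (etaMultBar_eq k)] at this

lemma stripL2_lowerIter {k : ℕ} {R : ℝ} {f : ℍ → ℂ} (h : IsMaassForm (etaMult k) k R f) (j : ℕ) :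
    StripL2 (lowerIter k j f) := by
  have hs : Smooth f := h.smooth
  have he : IsEigen k R f := h.eigen
  induction j with
  | zero => exact stripL2_of_integrableOn_fd hs h.sq_integrable
  | succ j ih =>
    exact ih.lower (smooth_lowerIter hs k j) (he.lowerIter hs j) (norm_chrT k)
      (h.isAut.lowerIter hs j).T

lemma isMaassForm_theta {k : ℕ} {R : ℝ} {f : ℍ → ℂ} (h : IsMaassForm (etaMult k) k R f) :
    IsMaassForm (etaMultBar k) k R (theta k f) := by
  have hs : Smooth f := h.smooth
  have he : IsEigen k R f := h.eigen
  have hs' := smooth_lowerIter hs k k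
  have hk : (k : ℤ) - 2 * (k : ℕ) = -k := by ring
  have ha := h.isAut.lowerIter hs k
  have he' := he.lowerIter hs k
  rw [hk] at ha he'
  have he'' := he'.reflect hs'
  rw [neg_neg] at he''
  refine ⟨hs'.reflect, (isAut_iff _ _ _).1 ?_, he'',
    ((stripL2_lowerIter h k).reflect hs').integrableOn_fd⟩
  rw [show etaMultBar k = fun A => (chrSL k A)⁻¹ from funext (etaMultBar_eq k)]
  exact ha.reflect

/-- The affine map `z ↦ (az+b)/d` of the upper half-plane. -/
def affineMap (a b d : ℕ) (z : ℍ) : ℍ := ofComplex (((a : ℂ) * z + b) / d)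

lemma coe_affineMap {a d : ℕ} (ha : 0 < a) (hd : 0 < d) (b : ℕ) (z : ℍ) :
    (affineMap a b d z : ℂ) = ((a / d : ℝ) : ℂ) * z + ((b / d : ℝ) : ℂ) := by
  have h : ((a : ℂ) * z + b) / d = ((a / d : ℝ) : ℂ) * z + ((b / d : ℝ) : ℂ) := by
    push_cast; ring
  have h2 : 0 < (((a / d : ℝ) : ℂ) * (z : ℂ) + ((b / d : ℝ) : ℂ)).im := by
    rw [Complex.add_im, Complex.im_ofReal_mul, Complex.ofReal_im, add_zero]
    have := z.im_pos
    simp only [UpperHalfPlane.coe_im]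
    positivity
  rw [affineMap, h, ofComplex_apply_of_im_pos h2]

lemma im_affineMap {a d : ℕ} (ha : 0 < a) (hd : 0 < d) (b : ℕ) (z : ℍ) :
    (affineMap a b d z).im = (a / d : ℝ) * z.im := by
  rw [← UpperHalfPlane.coe_im, coe_affineMap ha hd, Complex.add_im, Complex.im_ofReal_mul,
    Complex.ofReal_im, add_zero, UpperHalfPlane.coe_im]

lemma re_affineMap {a d : ℕ} (ha : 0 < a) (hd : 0 < d) (b : ℕ) (z : ℍ) :
    (affineMap a b d z).re = (a / d : ℝ) * z.re + b / d := by
  rw [← UpperHalfPlane.coe_re, coe_affineMap ha hd, Complex.add_re, Complex.re_ofReal_mul,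
    Complex.ofReal_re, UpperHalfPlane.coe_re]

lemma isMaassForm_heckeBar {k m : ℕ} {R : ℝ} {g : ℍ → ℂ} (hm : 0 < m)
    (hkm : (k : ℤ) * m ≡ -k [ZMOD 12]) (hg : IsMaassForm (etaMultBar k) k R g) :
    IsMaassForm (etaMult k) k R (heckeBar k m g) := by
  have hs : Smooth g := hg.smooth
  have he : IsEigen k R g := hg.eigen
  have h2 := stripL2_of_integrableOn_fd hs hg.sq_integrable
  have haut := hg.isAut_bar
  have hT : ∀ z, g (ModularGroup.T • z) = (chrT k)⁻¹ * g z := fun z => by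
    rw [haut]
    simp only [chrSL_T, den_T, unitPow_one, mul_one]
  have ht : ‖(chrT k)⁻¹‖ = 1 := by rw [norm_inv, norm_chrT, inv_one]
  have hpos : ∀ d ∈ m.divisors, 0 < m / d ∧ 0 < d := fun d hd => by
    have hd' := Nat.dvd_of_mem_divisors hd
    have := Nat.pos_of_dvd_of_pos hd' hm
    exact ⟨Nat.div_pos (Nat.le_of_dvd hm hd') this, this⟩
  have hterm : ∀ d ∈ m.divisors, ∀ b : ℕ, Smooth (fun z => g (affineMap (m / d) b d z)) ∧
      IsEigen k R (fun z => g (affineMap (m / d) b d z)) ∧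
      StripL2 (fun z => g (affineMap (m / d) b d z)) := by
    intro d hd b
    obtain ⟨ha, hd0⟩ := hpos d hd
    have hr : (0 : ℝ) < (m / d : ℕ) / d := by positivity
    exact ⟨hs.comp_affine (((m / d : ℕ) / d : ℝ) • ContinuousLinearMap.id ℝ ℂ) ((b / d : ℝ) : ℂ) _
      (fun z => by rw [coe_affineMap ha hd0]; simp),
      he.comp_affine hs _ _ _ (coe_affineMap ha hd0 b) (im_affineMap ha hd0 b),
      h2.comp_affine hs ht hT hr _ (coe_affineMap ha hd0 b)⟩
  have hsum : ∀ d ∈ m.divisors,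
      Smooth (fun z => chi k d * ∑ b ∈ Finset.range d,
        (cexp (-(π * Complex.I * k / 6)) ^ (b * d))⁻¹ * g (affineMap (m / d) b d z)) ∧
      IsEigen k R (fun z => chi k d * ∑ b ∈ Finset.range d,
        (cexp (-(π * Complex.I * k / 6)) ^ (b * d))⁻¹ * g (affineMap (m / d) b d z)) ∧
      StripL2 (fun z => chi k d * ∑ b ∈ Finset.range d,
        (cexp (-(π * Complex.I * k / 6)) ^ (b * d))⁻¹ * g (affineMap (m / d) b d z)) := by
    intro d hd
    have hs1 := fun b (_ : b ∈ Finset.range d) => (hterm d hd b).1.const_mul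
      (cexp (-(π * Complex.I * k / 6)) ^ (b * d))⁻¹
    have hs2 := Smooth.sum hs1
    exact ⟨hs2.const_mul _, (IsEigen.sum hs1 fun b _ => (hterm d hd b).2.1.const_mul
      (hterm d hd b).1 _).const_mul hs2 _,
      (StripL2.sum hs1 fun b _ => (hterm d hd b).2.2.const_mul _).const_mul _⟩
  have hs3 := Smooth.sum fun d hd => (hsum d hd).1
  have he3 := IsEigen.sum (fun d hd => (hsum d hd).1) fun d hd => (hsum d hd).2.1
  have h3 := StripL2.sum (fun d hd => (hsum d hd).1) fun d hd => (hsum d hd).2.2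
  refine ⟨hs3.const_mul _, (isAut_iff _ _ _).1 ?_, he3.const_mul hs3 _,
    (h3.const_mul _).integrableOn_fd⟩
  rw [show etaMult k = chrSL k from funext (etaMult_eq k)]
  exact isAut_heckeBar hm hkm haut

lemma isMaassForm_heckeTheta {k m : ℕ} {R : ℝ} {f : ℍ → ℂ} (hm : 0 < m)
    (hkm : (k : ℤ) * m ≡ -k [ZMOD 12]) (h : IsMaassForm (etaMult k) k R f) :
    IsMaassForm (etaMult k) k R (heckeTheta k m f) :=
  isMaassForm_heckeBar hm hkm (isMaassForm_theta h)

/-! ### Fourier coefficients on horizontal lines -/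

/-- The function `e^{2πiνx}` on the upper half-plane. -/
def expX (ν : ℝ) (z : ℍ) : ℂ := cexp (2 * π * Complex.I * ((ν * z.re : ℝ) : ℂ))

lemma contDiff_expX_aux (ν : ℝ) :
    ContDiff ℝ ∞ (fun w : ℂ => cexp (2 * π * Complex.I * ((ν * w.re : ℝ) : ℂ))) := by
  have h : ContDiff ℝ ∞ (fun w : ℂ => ((ν * w.re : ℝ) : ℂ)) :=
    Complex.ofRealCLM.contDiff.comp (contDiff_const.mul Complex.reCLM.contDiff)
  exact (contDiff_const.mul h).cexp

lemma smooth_expX (ν : ℝ) : Smooth (expX ν) :=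
  smooth_of_contDiff (contDiff_expX_aux ν) fun _ => rfl

lemma dV_expX (v : ℂ) (ν : ℝ) (z : ℍ) :
    dV v (expX ν) z = 2 * π * Complex.I * ν * v.re * expX ν z := by
  have h1 : HasFDerivAt (fun w : ℂ => ((ν * w.re : ℝ) : ℂ))
      (Complex.ofRealCLM.comp (ν • Complex.reCLM)) (z : ℂ) :=
    (Complex.ofRealCLM.comp (ν • Complex.reCLM)).hasFDerivAt
  have h2 := (h1.const_mul (2 * π * Complex.I)).cexp
  rw [dV_congr_up (f := expX ν)
    (F := fun w : ℂ => cexp (2 * π * Complex.I * ((ν * w.re : ℝ) : ℂ))) (fun _ => rfl) h2]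
  simp [expX]
  ring

lemma expX_T (ν : ℝ) (z : ℍ) :
    expX ν (ModularGroup.T • z) = cexp (2 * π * Complex.I * ν) * expX ν z := by
  have h : (ModularGroup.T • z).re = z.re + 1 := by
    rw [← UpperHalfPlane.coe_re, coe_T_smul]; simp
  rw [expX, expX, h, ← Complex.exp_add]
  congr 1; push_cast; ring

lemma up_expX (ν x : ℝ) {y : ℝ} (hy : 0 < y) :
    up (expX ν) (pt x y) = cexp (2 * π * Complex.I * ν * x) := by
  rw [up_pt hy, expX, ← UpperHalfPlane.coe_re]
  simp only [pt_re]
  congr 1; push_cast; ring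

/-- The Fourier coefficient `∫ f(x+iy) e^{-2πiνx} dx`. -/
def coef (ν : ℝ) (f : ℍ → ℂ) (y : ℝ) : ℂ := mean (fun z => f z * expX (-ν) z) y

lemma coef_eq (ν : ℝ) (f : ℍ → ℂ) {y : ℝ} (hy : 0 < y) :
    coef ν f y = ∫ x in (-(1 / 2) : ℝ)..1 / 2,
      up f (pt x y) * cexp (-(2 * π * Complex.I * ν * x)) := by
  rw [coef, mean]
  congr 1; ext x
  have h := up_expX (-ν) x hy
  simp only [up] at h ⊢
  rw [h]
  congr 2; push_cast; ring

lemma coef_dV_one {f : ℍ → ℂ} (hf : Smooth f) {ν : ℝ}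
    (hT : ∀ z, f (ModularGroup.T • z) = cexp (2 * π * Complex.I * ν) * f z) {y : ℝ} (hy : 0 < y) :
    coef ν (dV 1 f) y = 2 * π * Complex.I * ν * coef ν f y := by
  have hE := smooth_expX (-ν)
  have h1 := mean_dV_one (hf.mul hE) (fun z => by
    rw [hT, expX_T, mul_mul_mul_comm, ← Complex.exp_add]
    simp) hy
  have h2 : dV 1 (fun z => f z * expX (-ν) z) = fun z => dV 1 f z * expX (-ν) z +
      (-(2 * π * Complex.I * ν)) * (f z * expX (-ν) z) := by
    ext z
    rw [dV_mul hf hE, dV_expX]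
    simp; ring
  rw [h2, mean_add ((hf.dV 1).mul hE) ((hf.mul hE).const_mul _) hy] at h1
  have h3 : mean (fun z => (-(2 * π * Complex.I * ν)) * (f z * expX (-ν) z)) y =
      (-(2 * π * Complex.I * ν)) * coef ν f y := by
    rw [coef, mean, mean, ← intervalIntegral.integral_const_mul]; rfl
  rw [h3] at h1
  rw [coef]
  linear_combination h1

lemma hasDerivAt_coef {f : ℍ → ℂ} (hf : Smooth f) (ν : ℝ) {y : ℝ} (hy : 0 < y) :
    HasDerivAt (coef ν f) (coef ν (dV Complex.I f) y) y := by
  have hE := smooth_expX (-ν)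
  have h := (hf.mul hE).hasDerivAt_mean hy
  have h2 : dV Complex.I (fun z => f z * expX (-ν) z) =
      fun z => dV Complex.I f z * expX (-ν) z := by
    ext z
    rw [dV_mul hf hE, dV_expX]
    simp
  rwa [h2] at h

lemma coef_lower {f : ℍ → ℂ} (hf : Smooth f) {ν : ℝ} (k : ℤ)
    (hT : ∀ z, f (ModularGroup.T • z) = cexp (2 * π * Complex.I * ν) * f z) {y : ℝ} (hy : 0 < y) :
    coef ν (lower k f) y =
      -(2 * π * ν * y) * coef ν f y - y * coef ν (dV Complex.I f) y + k / 2 * coef ν f y := by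
  have h1 := coef_dV_one hf hT hy
  have hi : ∀ g : ℍ → ℂ, Smooth g → IntervalIntegrable
      (fun x : ℝ => up g (pt x y) * cexp (-(2 * π * Complex.I * ν * x))) volume
      (-(1 / 2)) (1 / 2) := fun g hg =>
    ((hg.continuous_x hy).mul (by fun_prop)).intervalIntegrable _ _
  rw [coef_eq ν _ hy] at h1 ⊢
  rw [coef_eq ν _ hy] at h1 ⊢
  rw [coef_eq ν _ hy]
  have h2 : ∀ x : ℝ, up (lower k f) (pt x y) * cexp (-(2 * π * Complex.I * ν * x)) =
      (y * Complex.I) * (up (dV 1 f) (pt x y) * cexp (-(2 * π * Complex.I * ν * x))) -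
      y * (up (dV Complex.I f) (pt x y) * cexp (-(2 * π * Complex.I * ν * x))) +
      k / 2 * (up f (pt x y) * cexp (-(2 * π * Complex.I * ν * x))) := by
    intro x
    rw [up_pt hy, up_pt hy, up_pt hy, up_pt hy, lower_eq]
    have : (UpperHalfPlane.im ⟨pt x y, by simpa⟩ : ℝ) = y := by
      rw [← UpperHalfPlane.coe_im]; simp
    simp only [this]
    ring
  simp only [h2]
  rw [intervalIntegral.integral_add ((((hi _ (hf.dV 1)).const_mul _)).sub
      ((hi _ (hf.dV Complex.I)).const_mul _)) ((hi _ hf).const_mul _),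
    intervalIntegral.integral_sub ((hi _ (hf.dV 1)).const_mul _)
      ((hi _ (hf.dV Complex.I)).const_mul _), intervalIntegral.integral_const_mul,
    intervalIntegral.integral_const_mul, intervalIntegral.integral_const_mul, h1]
  linear_combination (2 * π * ν * y * ∫ x in (-(1 / 2) : ℝ)..1 / 2,
    up f (pt x y) * cexp (-(2 * π * Complex.I * ν * x))) * Complex.I_mul_I

lemma norm_coef_le {f : ℍ → ℂ} {y : ℝ} (hy : 0 < y) (ν : ℝ) :
    ‖coef ν f y‖ ≤ ∫ x in (-(1 / 2) : ℝ)..1 / 2, ‖up f (pt x y)‖ := by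
  rw [coef_eq ν f hy]
  refine (intervalIntegral.norm_integral_le_integral_norm (by norm_num)).trans (le_of_eq ?_)
  congr 1; ext x
  rw [norm_mul, Complex.norm_exp]
  simp

/-- Two integrations by parts in `x` bound the coefficient by a constant times `(n + α)^{-2}`. -/
lemma summable_coef {f : ℍ → ℂ} (hf : Smooth f) {α : ℝ} (hα : ∀ n : ℤ, (n : ℝ) + α ≠ 0)
    (hT : ∀ z, f (ModularGroup.T • z) = cexp (2 * π * Complex.I * α) * f z) {y : ℝ} (hy : 0 < y) :
    Summable (fun n : ℤ => coef (n + α) f y) := by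
  have hexp : ∀ n : ℤ, cexp (2 * π * Complex.I * ((n + α : ℝ) : ℂ)) =
      cexp (2 * π * Complex.I * α) := by
    intro n
    push_cast
    rw [mul_add, Complex.exp_add, show 2 * π * Complex.I * (n : ℂ) = n * (2 * π * Complex.I) by ring,
      Complex.exp_int_mul_two_pi_mul_I, one_mul]
  have hs := (Real.summable_one_div_int_add_rpow α 2).2 (by norm_num)
  refine Summable.of_norm_bounded (hs.mul_left ((∫ x in (-(1 / 2) : ℝ)..1 / 2,
    ‖up (dV 1 (dV 1 f)) (pt x y)‖) / (2 * π) ^ 2)) fun n => ?_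
  have h1 := coef_dV_one hf (ν := n + α) (fun z => by rw [hexp, hT]) hy
  have h2 := coef_dV_one (hf.dV 1) (ν := n + α)
    (fun z => by rw [hexp, dV_T_invariant hf hT]) hy
  have h3 := norm_coef_le (f := dV 1 (dV 1 f)) hy (n + α)
  rw [h2, h1, ← mul_assoc, norm_mul] at h3
  have h4 : ‖2 * π * Complex.I * ((n + α : ℝ) : ℂ) * (2 * π * Complex.I * ((n + α : ℝ) : ℂ))‖ =
      (2 * π) ^ 2 * |(n : ℝ) + α| ^ (2 : ℝ) := by
    simp only [norm_mul, Complex.norm_I, Complex.norm_real, Real.norm_eq_abs, Complex.norm_ofNat,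
      abs_of_pos Real.pi_pos]
    rw [Real.rpow_two]; ring
  rw [h4] at h3
  have h5 : 0 < |(n : ℝ) + α| ^ (2 : ℝ) := by
    have := abs_pos.2 (hα n)
    positivity
  rw [div_mul_div_comm, mul_one, le_div_iff₀ (by positivity), mul_comm]
  exact h3

lemma hasSum_of_eq {ι : Type*} {u v : ι → ℂ} {a : ℂ} (h : HasSum u a) (huv : ∀ i, u i = v i) :
    HasSum v a := by
  rwa [← funext huv]

/-- A smooth quasi-periodic function is the sum of its Fourier series. -/
lemma hasSum_coef {f : ℍ → ℂ} (hf : Smooth f) {α : ℝ} (hα : ∀ n : ℤ, (n : ℝ) + α ≠ 0)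
    (hT : ∀ z, f (ModularGroup.T • z) = cexp (2 * π * Complex.I * α) * f z) (z : ℍ) :
    HasSum (fun n : ℤ => coef (n + α) f z.im * expX (n + α) z) (f z) := by
  have hy := z.im_pos
  set y := z.im with hydef
  -- Removing the phase `e^{2πiαx}` gives a function on the circle, to which Fourier theory applies.
  set g : ℝ → ℂ := fun x => up f (pt x y) * cexp (-(2 * π * Complex.I * α * x)) with hg
  have hgc : Continuous g := (hf.continuous_x hy).mul (by fun_prop)
  have hper : Function.Periodic g 1 := by
    intro x
    simp only [hg, up_T_smul hT hy x]
    rw [mul_comm (cexp _) (up f _), mul_assoc, ← Complex.exp_add]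
    congr 2; push_cast; ring
  have : Fact (0 < (1 : ℝ)) := ⟨one_pos⟩
  let G : C(AddCircle (1 : ℝ), ℂ) := ⟨hper.lift, continuous_coinduced_dom.2 hgc⟩
  have hG : ∀ x : ℝ, G (x : AddCircle (1 : ℝ)) = g x := fun x => rfl
  have hcoef : ∀ n : ℤ, fourierCoeff G n = coef (n + α) f y := by
    intro n
    rw [fourierCoeff_eq_intervalIntegral _ _ (-(1 / 2)), coef_eq _ _ hy,
      show (-(1 / 2) + 1 : ℝ) = 1 / 2 by norm_num, div_one, one_smul]
    congr 1; ext x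
    rw [hG, fourier_coe_apply, smul_eq_mul, hg]
    simp only
    rw [mul_comm, mul_assoc, ← Complex.exp_add]
    congr 2; push_cast; ring
  have hsum : Summable (fourierCoeff G) := by
    rw [show fourierCoeff G = fun n : ℤ => coef (n + α) f y from funext hcoef]
    exact summable_coef hf hα hT hy
  have h := (has_pointwise_sum_fourier_series_of_summable hsum (z.re : AddCircle (1 : ℝ))).mul_right
    (cexp (2 * π * Complex.I * α * z.re))
  rw [hG] at h
  have h1 : g z.re * cexp (2 * π * Complex.I * α * z.re) = f z := by
    simp only [hg]
    rw [mul_assoc, ← Complex.exp_add, neg_add_cancel, Complex.exp_zero, mul_one, hydef, pt_re_im,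
      up_coe]
  rw [h1] at h
  refine hasSum_of_eq h fun n => ?_
  rw [hcoef, fourier_coe_apply, smul_eq_mul, mul_assoc, ← Complex.exp_add, expX]
  congr 2; push_cast; ring

lemma integral_exp_int (N : ℤ) : ∫ x in (-(1 / 2) : ℝ)..1 / 2, cexp (2 * π * Complex.I * N * x) =
    if N = 0 then 1 else 0 := by
  split_ifs with h
  · subst h
    simp; norm_num
  · have h0 : (2 * π * Complex.I * N : ℂ) ≠ 0 := by
      simp [h, Real.pi_ne_zero]
    rw [integral_exp_mul_complex h0, div_eq_zero_iff]
    left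
    rw [sub_eq_zero, ← mul_one (cexp (2 * π * Complex.I * N * ((-(1 / 2) : ℝ) : ℂ))),
      ← Complex.exp_int_mul_two_pi_mul_I N, ← Complex.exp_add]
    congr 1; push_cast; ring

/-- The coefficients of a pointwise convergent series `∑ a(n) e^{2πi(n+α)x}`. -/
lemma integral_eq_of_hasSum {a : ℤ → ℂ} {α : ℝ} {F : ℝ → ℂ}
    (h : ∀ x : ℝ, HasSum (fun n : ℤ => a n * cexp (2 * π * Complex.I * ((n + α : ℝ) : ℂ) * x)) (F x))
    (n : ℤ) : ∫ x in (-(1 / 2) : ℝ)..1 / 2,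
      F x * cexp (-(2 * π * Complex.I * ((n + α : ℝ) : ℂ) * x)) = a n := by
  -- Unconditional convergence at `x = 0` is absolute, and the norms of the terms do not depend on
  -- `x`; this justifies termwise integration.
  have ha : Summable fun n => ‖a n‖ := by
    have := (h 0).summable.norm
    simpa using this
  have hsum := intervalIntegral.hasSum_integral_of_dominated_convergence (μ := volume)
    (a := -(1 / 2)) (b := 1 / 2)
    (F := fun (j : ℤ) (x : ℝ) => a j * cexp (2 * π * Complex.I * ((j - n : ℤ) : ℂ) * x))
    (f := fun x => F x * cexp (-(2 * π * Complex.I * ((n + α : ℝ) : ℂ) * x))) (fun j _ => ‖a j‖)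
    (fun j => Continuous.aestronglyMeasurable (by fun_prop))
    (fun j => Filter.Eventually.of_forall fun x _ => by
      rw [norm_mul, Complex.norm_exp]; simp)
    (Filter.Eventually.of_forall fun _ _ => ha) intervalIntegrable_const
    (Filter.Eventually.of_forall fun x _ => by
      refine hasSum_of_eq ((h x).mul_right _) fun j => ?_
      rw [mul_assoc, ← Complex.exp_add]
      congr 2; push_cast; ring)
  have h1 : ∀ j : ℤ, ∫ x in (-(1 / 2) : ℝ)..1 / 2,
      a j * cexp (2 * π * Complex.I * ((j - n : ℤ) : ℂ) * x) = if j = n then a n else 0 := by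
    intro j
    rw [intervalIntegral.integral_const_mul, integral_exp_int]
    by_cases hj : j = n
    · simp [hj]
    · simp [hj, sub_eq_zero]
  simp only [h1] at hsum
  exact (hasSum_ite_eq n (a n)).unique hsum |>.symm

/-! ### Lowering operators on Fourier expansions -/

lemma mul_coef_dV_I {f : ℍ → ℂ} (hf : Smooth f) {ν a : ℝ} (ha : 0 < a) {A s μ : ℂ}
    (h : ∀ y, 0 < y → coef ν f y = A * whittakerW s μ (4 * π * a * y)) {y : ℝ} (hy : 0 < y) :
    y * coef ν (dV Complex.I f) y = A * ((s - (4 * π * a * y : ℝ) / 2) *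
      whittakerW s μ (4 * π * a * y) -
      (μ ^ 2 - (s - 1 / 2) ^ 2) * whittakerW (s - 1) μ (4 * π * a * y)) := by
  have ht : 0 < 4 * π * a * y := by positivity
  have h1 := hasDerivAt_coef hf ν hy
  have h2 : HasDerivAt (fun y : ℝ => 4 * π * a * y) (4 * π * a) y := by
    simpa using (hasDerivAt_id y).const_mul (4 * π * a)
  have h3 := ((hasDerivAt_whittakerW s μ ht).scomp y h2).const_mul A
  have h4 : coef ν f =ᶠ[nhds y] fun y => A * (whittakerW s μ ∘ fun y => 4 * π * a * y) y := by
    filter_upwards [Ioi_mem_nhds hy] with u hu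
    exact h u hu
  have h5 := h1.unique (h3.congr_of_eventuallyEq h4)
  have h0 : ((4 * π * a * y : ℝ) : ℂ) ≠ 0 := by exact_mod_cast ht.ne'
  rw [h5, Complex.real_smul]
  have h6 : (y : ℂ) * ((4 * π * a : ℝ) : ℂ) = ((4 * π * a * y : ℝ) : ℂ) := by push_cast; ring
  generalize ((s - (4 * π * a * y : ℝ) / 2) * whittakerW s μ (4 * π * a * y) -
    (μ ^ 2 - (s - 1 / 2) ^ 2) * whittakerW (s - 1) μ (4 * π * a * y)) = X
  rw [show (y : ℂ) * (A * (((4 * π * a : ℝ) : ℂ) * (X / ((4 * π * a * y : ℝ) : ℂ)))) =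
    A * (((y : ℂ) * ((4 * π * a : ℝ) : ℂ)) * (X / ((4 * π * a * y : ℝ) : ℂ))) by ring, h6,
    mul_div_cancel₀ _ h0]

/-- With `t = 4πνy` the coefficient of `W_{k/2}` is `-t/2 - (k/2 - t/2) + k/2 = 0`, so only
`W_{k/2-1}` survives. -/
lemma coef_lower_of_pos {f : ℍ → ℂ} (hf : Smooth f) {ν : ℝ} (hν : 0 < ν) (k : ℤ) {A μ : ℂ}
    (hT : ∀ z, f (ModularGroup.T • z) = cexp (2 * π * Complex.I * ν) * f z)
    (h : ∀ y, 0 < y → coef ν f y = A * whittakerW (k / 2) μ (4 * π * ν * y)) {y : ℝ} (hy : 0 < y) :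
    coef ν (lower k f) y =
      A * (μ ^ 2 - ((k : ℂ) / 2 - 1 / 2) ^ 2) * whittakerW (k / 2 - 1) μ (4 * π * ν * y) := by
  rw [coef_lower hf k hT hy, mul_coef_dV_I hf hν h hy, h y hy]
  push_cast
  ring

/-- With `κ = -k/2` and `t = 4π|ν|y` the coefficient of `W_κ` is `t - 2κ`, and the contiguous
relation turns the whole into `W_{κ+1}` with factor one. -/
lemma coef_lower_of_neg {f : ℍ → ℂ} (hf : Smooth f) {ν : ℝ} (hν : ν < 0) (k : ℤ) {A μ : ℂ}
    (hT : ∀ z, f (ModularGroup.T • z) = cexp (2 * π * Complex.I * ν) * f z)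
    (h : ∀ y, 0 < y → coef ν f y = A * whittakerW (-(k / 2)) μ (4 * π * -ν * y)) {y : ℝ}
    (hy : 0 < y) :
    coef ν (lower k f) y = A * whittakerW (-(k / 2) + 1) μ (4 * π * -ν * y) := by
  have ht : 0 < 4 * π * -ν * y := by
    have : 0 < -ν := by linarith
    positivity
  rw [coef_lower hf k hT hy, mul_coef_dV_I hf (by linarith) h hy, h y hy, whittakerW_add_one _ _ ht]
  push_cast
  ring

lemma lowerIter_T {k : ℕ} {f : ℍ → ℂ} (hf : Smooth f) (ha : IsAut (chrSL k) k f) (j : ℕ) (n : ℤ)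
    (z : ℍ) : lowerIter k j f (ModularGroup.T • z) =
      cexp (2 * π * Complex.I * (((n : ℝ) + k / 12 : ℝ) : ℂ)) * lowerIter k j f z := by
  rw [(ha.lowerIter hf j).T, chrT_eq]
  congr 1
  push_cast
  rw [mul_add, Complex.exp_add, show 2 * π * Complex.I * (n : ℂ) = n * (2 * π * Complex.I) by ring,
    Complex.exp_int_mul_two_pi_mul_I, one_mul]

lemma coef_lowerIter_of_pos {k : ℕ} {f : ℍ → ℂ} (hf : Smooth f) (ha : IsAut (chrSL k) k f) {n : ℤ}
    (hν : 0 < (n : ℝ) + k / 12) {A μ : ℂ}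
    (h : ∀ y, 0 < y → coef (n + k / 12) f y =
      A * whittakerW (k / 2) μ (4 * π * (n + k / 12) * y)) (j : ℕ) :
    ∀ y, 0 < y → coef (n + k / 12) (lowerIter k j f) y =
      A * (∏ i ∈ Finset.range j, (μ ^ 2 - ((k : ℂ) / 2 - i - 1 / 2) ^ 2)) *
        whittakerW (k / 2 - j) μ (4 * π * (n + k / 12) * y) := by
  induction j with
  | zero => intro y hy; simpa [lowerIter] using h y hy
  | succ j ih =>
    intro y hy
    have hc : (((k : ℤ) - 2 * j : ℤ) : ℂ) / 2 = k / 2 - j := by push_cast; ring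
    have h1 := coef_lower_of_pos (smooth_lowerIter hf k j) hν (k - 2 * j) (lowerIter_T hf ha j n)
      (by rw [hc]; exact ih) hy
    rw [lowerIter, h1, hc, Finset.prod_range_succ]
    rw [show (k : ℂ) / 2 - (j + 1 : ℕ) = k / 2 - j - 1 by push_cast; ring]
    ring

lemma coef_lowerIter_of_neg {k : ℕ} {f : ℍ → ℂ} (hf : Smooth f) (ha : IsAut (chrSL k) k f) {n : ℤ}
    (hν : (n : ℝ) + k / 12 < 0) {A μ : ℂ}
    (h : ∀ y, 0 < y → coef (n + k / 12) f y =
      A * whittakerW (-(k / 2)) μ (4 * π * -(n + k / 12) * y)) (j : ℕ) :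
    ∀ y, 0 < y → coef (n + k / 12) (lowerIter k j f) y =
      A * whittakerW (-(k / 2) + j) μ (4 * π * -(n + k / 12) * y) := by
  induction j with
  | zero => intro y hy; simpa [lowerIter] using h y hy
  | succ j ih =>
    intro y hy
    have hc : -((((k : ℤ) - 2 * j : ℤ) : ℂ) / 2) = -(k / 2) + j := by push_cast; ring
    have h1 := coef_lower_of_neg (smooth_lowerIter hf k j) hν (k - 2 * j) (lowerIter_T hf ha j n)
      (by rw [hc]; exact ih) hy
    rw [lowerIter, h1, hc]
    rw [show -((k : ℂ) / 2) + (j + 1 : ℕ) = -(k / 2) + j + 1 by push_cast; ring]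

/-- The first and the last factor are equal, and their product is the new square `(l(l+1) + 1/4 +
R²)²`. Peeling both off leaves the product for `l`. -/
lemma prod_half_sq (l : ℕ) (R : ℝ) :
    ∏ i ∈ Finset.range (2 * l), ((Complex.I * R) ^ 2 - ((l : ℂ) - i - 1 / 2) ^ 2) =
      ∏ j ∈ Finset.Icc 1 l, ((j : ℂ) * ((j : ℂ) - 1) + 1 / 4 + (R : ℂ) ^ 2) ^ 2 := by
  induction l with
  | zero => simp
  | succ l ih =>
    rw [show 2 * (l + 1) = 2 * l + 1 + 1 by ring, Finset.prod_range_succ, Finset.prod_range_succ',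
      Finset.prod_Icc_succ_top (by omega), ← ih]
    have : ∀ i : ℕ, ((l + 1 : ℕ) : ℂ) - ((i + 1 : ℕ) : ℂ) - 1 / 2 = l - i - 1 / 2 := by
      intro i; push_cast; ring
    simp only [this, mul_assoc]
    congr 1
    push_cast
    rw [mul_pow, Complex.I_sq]
    ring

/-- The factors pair off around the middle one, `i = l`, which is unpaired and equals `-R²`. -/
lemma prod_sq (l : ℕ) (R : ℝ) :
    ∏ i ∈ Finset.range (2 * l + 1), ((Complex.I * R) ^ 2 - ((l : ℂ) - i) ^ 2) =
      -(R : ℂ) ^ 2 * ∏ j ∈ Finset.Icc 1 l, ((j : ℂ) ^ 2 + (R : ℂ) ^ 2) ^ 2 := by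
  induction l with
  | zero => simp [mul_pow]
  | succ l ih =>
    rw [show 2 * (l + 1) + 1 = 2 * l + 1 + 1 + 1 by ring, Finset.prod_range_succ,
      Finset.prod_range_succ', Finset.prod_Icc_succ_top (by omega), ← mul_assoc, ← ih]
    have : ∀ i : ℕ, ((l + 1 : ℕ) : ℂ) - ((i + 1 : ℕ) : ℂ) = l - i := by
      intro i; push_cast; ring
    simp only [this, mul_assoc]
    congr 1
    push_cast
    rw [mul_pow, Complex.I_sq]
    ring

lemma bigLambda_eq_prod (k : ℕ) (R : ℝ) : (bigLambda k R : ℂ) =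
    ∏ i ∈ Finset.range k, ((Complex.I * R) ^ 2 - ((k : ℂ) / 2 - i - 1 / 2) ^ 2) := by
  rcases Nat.even_or_odd' k with ⟨l, rfl | rfl⟩
  · have h1 : ((2 * l : ℕ) : ℂ) / 2 = l := by push_cast; ring
    rw [bigLambda, if_pos (by simp), h1, prod_half_sq, Nat.mul_div_cancel_left _ two_pos]
    push_cast; rfl
  · have h1 : ∀ i : ℕ, ((2 * l + 1 : ℕ) : ℂ) / 2 - i - 1 / 2 = l - i := by intro i; push_cast; ring
    simp only [h1]
    rw [bigLambda, if_neg (by simp), prod_sq, show (2 * l + 1) / 2 = l by omega]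
    push_cast; rfl

/-- The factor by which `Θ` multiplies the Fourier coefficient of index `n`. -/
def lambdaFactor (k : ℕ) (R : ℝ) (n : ℤ) : ℂ := if 0 ≤ n then (bigLambda k R : ℂ) else 1

/-- The dependence on `y` of `fourierW`. -/
def fourierY (κ : ℂ) (R ν y : ℝ) : ℂ :=
  ((1 / √|ν| : ℝ) : ℂ) * whittakerW κ (Complex.I * R) (4 * π * |ν| * y)

lemma fourierW_eq (k : ℕ) (R : ℝ) (n : ℤ) (z : ℍ) : fourierW k R n z =
    fourierY (((k : ℝ) / 2 * Real.sign ((n : ℝ) + k / 12) : ℝ) : ℂ) R (n + k / 12) z.im *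
      expX (n + k / 12) z := rfl

lemma coef_of_hasFourierExpansion {k : ℕ} {R : ℝ} {f : ℍ → ℂ} {c : ℤ → ℂ}
    (h : HasFourierExpansion k R f c) (n : ℤ) {y : ℝ} (hy : 0 < y) :
    coef (n + k / 12) f y = c n *
      fourierY (((k : ℝ) / 2 * Real.sign ((n : ℝ) + k / 12) : ℝ) : ℂ) R (n + k / 12) y := by
  rw [coef_eq _ _ hy]
  refine integral_eq_of_hasSum (α := k / 12) (F := fun x => up f (pt x y))
    (a := fun n : ℤ => c n *
      fourierY (((k : ℝ) / 2 * Real.sign ((n : ℝ) + k / 12) : ℝ) : ℂ) R (n + k / 12) y) ?_ n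
  intro x
  rw [up_pt hy]
  refine hasSum_of_eq (h _) fun n => ?_
  rw [fourierW_eq, mul_assoc, ← up_expX _ x hy, up_pt hy, ← UpperHalfPlane.coe_im]
  simp only [pt_im]

lemma cast_add_pos {k : ℕ} (hk₁ : 1 ≤ k) {n : ℤ} (hn : 0 ≤ n) : 0 < (n : ℝ) + k / 12 := by
  have h1 : (1 : ℝ) ≤ k := by exact_mod_cast hk₁
  have h2 : (0 : ℝ) ≤ n := by exact_mod_cast hn
  positivity

lemma cast_add_neg {k : ℕ} (hk₂ : k ≤ 11) {n : ℤ} (hn : n < 0) : (n : ℝ) + k / 12 < 0 := by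
  have h1 : (k : ℝ) ≤ 11 := by exact_mod_cast hk₂
  have h2 : (n : ℝ) ≤ -1 := by exact_mod_cast (by omega : n ≤ -1)
  linarith

lemma cast_add_ne_zero {k : ℕ} (hk₁ : 1 ≤ k) (hk₂ : k ≤ 11) (n : ℤ) : (n : ℝ) + k / 12 ≠ 0 := by
  rcases lt_or_ge n 0 with h | h
  · exact (cast_add_neg hk₂ h).ne
  · exact (cast_add_pos hk₁ h).ne'

/-- Since `0 < k/12 < 1`, the sign of the frequency is decided by whether `n ≥ 0`. After `k` steps
`κ` has moved from `±k/2` to `∓k/2`. -/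
lemma coef_lowerIter {k : ℕ} (hk₁ : 1 ≤ k) (hk₂ : k ≤ 11) {R : ℝ} {f : ℍ → ℂ} {c : ℤ → ℂ}
    (hf : Smooth f) (ha : IsAut (chrSL k) k f) (h : HasFourierExpansion k R f c) (n : ℤ) {y : ℝ}
    (hy : 0 < y) : coef (n + k / 12) (lowerIter k k f) y = c n * lambdaFactor k R n *
      fourierY (((k : ℝ) / 2 * -Real.sign ((n : ℝ) + k / 12) : ℝ) : ℂ) R (n + k / 12) y := by
  have h1 := fun y hy => coef_of_hasFourierExpansion h n (y := y) hy
  simp only [fourierY] at h1 ⊢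
  rcases lt_or_ge n 0 with hn | hn
  · have hν := cast_add_neg hk₂ hn
    rw [Real.sign_of_neg hν, abs_of_neg hν] at h1 ⊢
    rw [lambdaFactor, if_neg (by omega), coef_lowerIter_of_neg hf ha hν (μ := Complex.I * R)
      (A := c n * ((1 / √(-((n : ℝ) + k / 12)) : ℝ) : ℂ)) (fun y hy => by
        rw [h1 y hy, ← mul_assoc,
          show (((k : ℝ) / 2 * -1 : ℝ) : ℂ) = -(k / 2) by push_cast; ring]) k y hy]
    rw [show -((k : ℂ) / 2) + k = (((k : ℝ) / 2 * - -1 : ℝ) : ℂ) by push_cast; ring]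
    ring
  · have hν := cast_add_pos hk₁ hn
    rw [Real.sign_of_pos hν, abs_of_pos hν] at h1 ⊢
    rw [lambdaFactor, if_pos hn, coef_lowerIter_of_pos hf ha hν (μ := Complex.I * R)
      (A := c n * ((1 / √((n : ℝ) + k / 12) : ℝ) : ℂ)) (fun y hy => by
        rw [h1 y hy, ← mul_assoc,
          show (((k : ℝ) / 2 * 1 : ℝ) : ℂ) = k / 2 by push_cast; ring]) k y hy,
      bigLambda_eq_prod]
    rw [show (k : ℂ) / 2 - k = (((k : ℝ) / 2 * -1 : ℝ) : ℂ) by push_cast; ring]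
    ring

lemma expX_negConj (ν : ℝ) (z : ℍ) : expX ν (negConj z) = expX (-ν) z := by
  simp [expX]

/-- The Fourier expansion of `Θ f`. -/
lemma hasSum_theta {k : ℕ} (hk₁ : 1 ≤ k) (hk₂ : k ≤ 11) {R : ℝ} {f : ℍ → ℂ} {c : ℤ → ℂ}
    (hf : Smooth f) (ha : IsAut (chrSL k) k f) (h : HasFourierExpansion k R f c) (z : ℍ) :
    HasSum (fun n : ℤ => c n * lambdaFactor k R n *
      fourierY (((k : ℝ) / 2 * -Real.sign ((n : ℝ) + k / 12) : ℝ) : ℂ) R (n + k / 12) z.im *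
      expX (-(n + k / 12)) z) (theta k f z) := by
  have hT := lowerIter_T hf ha k 0
  rw [Int.cast_zero, zero_add] at hT
  have h1 := hasSum_coef (smooth_lowerIter hf k k) (cast_add_ne_zero hk₁ hk₂) hT (negConj z)
  refine hasSum_of_eq h1 fun n => ?_
  rw [coef_lowerIter hk₁ hk₂ hf ha h n (negConj z).im_pos, im_negConj, expX_negConj]

/-! ### Hecke operators on Fourier expansions -/

lemma sum_exp_div {d : ℕ} (hd : 0 < d) (N : ℤ) :
    ∑ b ∈ Finset.range d, cexp (2 * π * Complex.I * N * b / d) = if (d : ℤ) ∣ N then (d : ℂ) else 0 := by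
  have hd0 : (d : ℂ) ≠ 0 := by exact_mod_cast hd.ne'
  set w := cexp (2 * π * Complex.I * N / d) with hw
  have hpow : ∀ b : ℕ, cexp (2 * π * Complex.I * N * b / d) = w ^ b := by
    intro b
    rw [hw, ← Complex.exp_nat_mul]
    congr 1; ring
  simp only [hpow]
  split_ifs with h
  · obtain ⟨M, rfl⟩ := h
    have : w = 1 := by
      rw [hw, ← Complex.exp_int_mul_two_pi_mul_I M]
      congr 1; push_cast; field_simp
    simp [this]
  · have hw1 : w ≠ 1 := by
      intro hw1
      obtain ⟨M, hM⟩ := Complex.exp_eq_one_iff.1 hw1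
      apply h
      refine ⟨M, ?_⟩
      have h2 : (2 * π * Complex.I : ℂ) ≠ 0 := Complex.two_pi_I_ne_zero
      rw [div_eq_iff hd0] at hM
      have : (N : ℂ) = d * M := mul_left_cancel₀ h2 (by rw [hM]; ring)
      exact_mod_cast this
    have hwd : w ^ d = 1 := by
      rw [← hpow, ← Complex.exp_int_mul_two_pi_mul_I N]
      congr 1; field_simp
    rw [geom_sum_eq hw1, hwd, sub_self, zero_div]

/-- The normalisation `|ν|^{-1/2}` is responsible for `√r`. The sign, harmless under absolute
values, anticipates the frequency after reflection. -/
lemma fourierY_scale {κ : ℂ} {R ν y r : ℝ} (hr : 0 < r) :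
    fourierY κ R ν (r * y) = √r * fourierY κ R (-(ν * r)) y := by
  have h : √r ≠ 0 := (Real.sqrt_pos.2 hr).ne'
  rw [fourierY, fourierY, abs_neg, abs_mul, abs_of_pos hr, Real.sqrt_mul (abs_nonneg _),
    show 4 * π * (|ν| * r) * y = 4 * π * |ν| * (r * y) by ring, ← mul_assoc (√r : ℂ),
    ← Complex.ofReal_mul]
  congr 2
  field_simp

lemma sign_neg_mul {ν r : ℝ} (hr : 0 < r) : Real.sign (-(ν * r)) = -Real.sign ν := by
  rcases lt_trichotomy ν 0 with h | rfl | h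
  · rw [Real.sign_of_neg h, Real.sign_of_pos (by nlinarith), neg_neg]
  · simp
  · rw [Real.sign_of_pos h, Real.sign_of_neg (by nlinarith)]

/-- The phase of the term with index `q` is `e^{2πi(q₀ - q)b/d}`, where `q₀ = k(d² - 1)/12` collects
the contributions of `ξ` and `α`. Summation over `b` keeps `q = q₀ - dt`, and this frequency becomes
`at - K + α` after scaling by `-a/d`. -/
lemma hasSum_hecke_inner {k : ℕ} (hk₁ : 1 ≤ k) (hk₂ : k ≤ 11) {R : ℝ} {f : ℍ → ℂ} {c : ℤ → ℂ}
    (hf : Smooth f) (hA : IsAut (chrSL k) k f) (h : HasFourierExpansion k R f c) {a d : ℕ}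
    (ha : 0 < a) (hd : 0 < d) {q₀ K : ℤ} (hq₀ : (k : ℤ) * ((d : ℤ) ^ 2 - 1) = 12 * q₀)
    (hK : (k : ℤ) * (a * d + 1) = 12 * K) (z : ℍ) :
    HasSum (fun t : ℤ => c (q₀ - d * t) * lambdaFactor k R (q₀ - d * t) *
        (d * √((a : ℝ) / d) : ℝ) * fourierW k R (a * t - K) z)
      (∑ b ∈ Finset.range d, (cexp (-(π * Complex.I * k / 6)) ^ (b * d))⁻¹ *
        theta k f (affineMap a b d z)) := by
  have hd0 : (d : ℂ) ≠ 0 := by exact_mod_cast hd.ne'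
  have hdr : (d : ℝ) ≠ 0 := by exact_mod_cast hd.ne'
  have hr : (0 : ℝ) < a / d := by positivity
  have h1 := hasSum_sum (s := Finset.range d) fun b _ =>
    (hasSum_theta hk₁ hk₂ hf hA h (affineMap a b d z)).mul_left
      (cexp (-(π * Complex.I * k / 6)) ^ (b * d))⁻¹
  have hq₀' : (k : ℝ) * ((d : ℝ) ^ 2 - 1) = 12 * q₀ := by exact_mod_cast hq₀
  have hK' : (k : ℝ) * (a * d + 1) = 12 * K := by exact_mod_cast hK
  have hterm : ∀ q : ℤ, ∑ b ∈ Finset.range d, (cexp (-(π * Complex.I * k / 6)) ^ (b * d))⁻¹ *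
      (c q * lambdaFactor k R q *
        fourierY (((k : ℝ) / 2 * -Real.sign ((q : ℝ) + k / 12) : ℝ) : ℂ) R (q + k / 12)
          (affineMap a b d z).im * expX (-(q + k / 12)) (affineMap a b d z)) =
      (c q * lambdaFactor k R q *
        fourierY (((k : ℝ) / 2 * -Real.sign ((q : ℝ) + k / 12) : ℝ) : ℂ) R (q + k / 12)
          ((a / d) * z.im) * expX (-((q + k / 12) * (a / d))) z) *
      if (d : ℤ) ∣ q₀ - q then (d : ℂ) else 0 := by
    intro q
    rw [← sum_exp_div hd (q₀ - q), Finset.mul_sum]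
    refine Finset.sum_congr rfl fun b _ => ?_
    have hexp : (cexp (-(π * Complex.I * k / 6)) ^ (b * d))⁻¹ *
        expX (-(q + k / 12)) (affineMap a b d z) = expX (-((q + k / 12) * (a / d))) z *
        cexp (2 * π * Complex.I * ((q₀ - q : ℤ) : ℂ) * b / d) := by
      rw [← Complex.exp_nat_mul, ← Complex.exp_neg, expX, expX, ← Complex.exp_add, ← Complex.exp_add,
        re_affineMap ha hd]
      have hq₀c : (k : ℂ) * ((d : ℂ) ^ 2 - 1) = 12 * q₀ := by exact_mod_cast hq₀
      congr 1
      push_cast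
      field_simp
      linear_combination (12 * b : ℂ) * hq₀c
    rw [im_affineMap ha hd]
    linear_combination (c q * lambdaFactor k R q *
        fourierY (((k : ℝ) / 2 * -Real.sign ((q : ℝ) + k / 12) : ℝ) : ℂ) R (q + k / 12)
          ((a / d) * z.im)) * hexp
  have h2 := hasSum_of_eq h1 hterm
  have hinj : Function.Injective (fun t : ℤ => q₀ - d * t) := by
    intro s t hst
    have : (d : ℤ) ≠ 0 := by exact_mod_cast hd.ne'
    exact mul_left_cancel₀ this (by simpa using hst)
  rw [← hinj.hasSum_iff] at h2
  · refine hasSum_of_eq h2 fun t => ?_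
    have hν : ((a * t - K : ℤ) : ℝ) + k / 12 = -(((q₀ - d * t : ℤ) : ℝ) + k / 12) * (a / d) := by
      push_cast
      field_simp
      linear_combination (-a : ℝ) * hq₀' + (d : ℝ) * hK'
    simp only [Function.comp_apply]
    rw [if_pos (by simp), fourierW_eq, hν, neg_mul, fourierY_scale hr, sign_neg_mul hr]
    push_cast
    ring
  · intro q hq
    rw [if_neg, mul_zero]
    rintro ⟨t, ht⟩
    exact hq ⟨t, by simp only; omega⟩

/-- For invertible `k` this says that units mod `12` square to `1`. It makes `q₀` an integer. -/
lemma zmod_twelve_aux : ∀ k a d : ZMod 12, k * (a * d + 1) = 0 → k * (d ^ 2 - 1) = 0 := by decide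

lemma zmod_four_aux : ∀ k a d : ZMod 4, k * (a * d + 1) = 0 → k * (d - 1) = 2 * k + k * (a - 1) := by
  decide

lemma I_zpow_congr {m n : ℤ} (h : (4 : ℤ) ∣ m - n) : Complex.I ^ m = Complex.I ^ n := by
  obtain ⟨t, ht⟩ := h
  rw [show m = n + 4 * t by omega, zpow_add₀ Complex.I_ne_zero, zpow_mul]
  rw [show Complex.I ^ (4 : ℤ) = 1 by exact_mod_cast Complex.I_pow_four, one_zpow, mul_one]

/-- This exchanges `d` for the complementary divisor `a`, over which the coefficient formula sums.
-/
lemma chi_eq_neg_one_pow_mul {k a d : ℕ} (h : (12 : ℤ) ∣ k * (a * d + 1)) :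
    chi k d = (-1) ^ k * chi k a := by
  have h2 : (4 : ℤ) ∣ k * (d - 1) - (2 * k + k * (a - 1)) := by
    have h3 := zmod_four_aux k a d (by
      have := (ZMod.intCast_zmod_eq_zero_iff_dvd (k * (a * d + 1) : ℤ) 4).2
        (dvd_trans (by norm_num) h)
      exact_mod_cast this)
    refine (ZMod.intCast_zmod_eq_zero_iff_dvd _ 4).1 ?_
    push_cast
    rw [h3, sub_self]
  rw [chi, chi, I_zpow_congr h2, zpow_add₀ Complex.I_ne_zero, zpow_mul]
  rw [show Complex.I ^ (2 : ℤ) = -1 by exact_mod_cast Complex.I_sq, zpow_natCast]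

lemma coeffAt_intCast (c : ℤ → ℂ) (n : ℤ) : coeffAt c (n : ℚ) = c n := by
  simp [coeffAt]

/-- The contribution of the divisor `a` of `m` to the Fourier coefficient of index `n`. -/
def thetaTerm (k m : ℕ) (R : ℝ) (c : ℤ → ℂ) (a : ℕ) (n : ℤ) : ℂ :=
  if (a : ℤ) ∣ n + (k : ℤ) * ((m : ℤ) + 1) / 12 then
    thetaDelta k m R n a * coeffAt c (-thetaIndex k m n a) else 0

lemma thetaCoeff_eq {k m : ℕ} (hm : 0 < m) (R : ℝ) (c : ℤ → ℂ) (n : ℤ) :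
    thetaCoeff k m R c n = (-1) ^ k * ∑ a ∈ m.divisors, chi k a * thetaTerm k m R c a n := by
  rw [thetaCoeff]
  congr 1
  simp only [thetaTerm, mul_ite, mul_zero]
  rw [← Finset.sum_filter]
  refine Finset.sum_congr ?_ fun a _ => by ring
  ext a
  have hg : Int.gcd m (n + (k : ℤ) * ((m : ℤ) + 1) / 12) ≠ 0 := by
    rw [Ne, Int.gcd_eq_zero_iff]
    rintro ⟨h1, _⟩
    omega
  rw [Nat.mem_divisors, Finset.mem_filter, Nat.mem_divisors, ← Int.natCast_dvd_natCast, Int.dvd_coe_gcd_iff,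
    Int.natCast_dvd_natCast]
  have hm0 : m ≠ 0 := hm.ne'
  tauto

lemma thetaIndex_eq {k a d : ℕ} (ha : 0 < a) {q₀ K t : ℤ}
    (hq₀ : (k : ℤ) * ((d : ℤ) ^ 2 - 1) = 12 * q₀) (hK : (k : ℤ) * (a * d + 1) = 12 * K) :
    thetaIndex k (a * d) (a * t - K) a = ((-(q₀ - d * t) : ℤ) : ℚ) := by
  have ha0 : (a : ℚ) ≠ 0 := by exact_mod_cast ha.ne'
  have h1 : (k : ℚ) * ((d : ℚ) ^ 2 - 1) = 12 * q₀ := by exact_mod_cast hq₀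
  have h2 : (k : ℚ) * (a * d + 1) = 12 * K := by exact_mod_cast hK
  rw [thetaIndex]
  push_cast
  field_simp
  linear_combination (-(a : ℚ)) * h1 + (d : ℚ) * h2

lemma thetaTerm_apply {k a d : ℕ} (ha : 0 < a) (R : ℝ) (c : ℤ → ℂ) {q₀ K : ℤ} (t : ℤ)
    (hq₀ : (k : ℤ) * ((d : ℤ) ^ 2 - 1) = 12 * q₀) (hK : (k : ℤ) * (a * d + 1) = 12 * K) :
    thetaTerm k (a * d) R c a (a * t - K) =
      c (q₀ - d * t) * lambdaFactor k R (q₀ - d * t) := by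
  have hK2 : (k : ℤ) * (((a * d : ℕ) : ℤ) + 1) / 12 = K := by
    push_cast
    rw [hK, Int.mul_ediv_cancel_left _ (by norm_num)]
  rw [thetaTerm, hK2, if_pos (by simp), thetaDelta, thetaIndex_eq ha hq₀ hK]
  rw [← Int.cast_neg, neg_neg, coeffAt_intCast, lambdaFactor, mul_comm]
  congr 1
  -- The index in the definition of `δ_a` is the integer `-(q₀ - dt)`, so the condition `≥ 1` fails
  -- exactly when `Θ` has contributed `Λ`.
  by_cases hq : 0 ≤ q₀ - d * t
  · rw [if_pos hq, if_neg]
    rw [not_le]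
    exact_mod_cast (by omega : -(q₀ - d * t) < 1)
  · rw [if_neg hq, if_pos]
    exact_mod_cast (by omega : 1 ≤ -(q₀ - d * t))

lemma hasSum_hecke_divisor {k : ℕ} (hk₁ : 1 ≤ k) (hk₂ : k ≤ 11) {R : ℝ} {f : ℍ → ℂ} {c : ℤ → ℂ}
    (hf : Smooth f) (hA : IsAut (chrSL k) k f) (h : HasFourierExpansion k R f c) {a d : ℕ}
    (ha : 0 < a) (hd : 0 < d) (hk12 : (12 : ℤ) ∣ k * (a * d + 1)) (z : ℍ) :
    HasSum (fun n : ℤ => thetaTerm k (a * d) R c a n * fourierW k R n z)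
      (((1 / √((a * d : ℕ) : ℝ) : ℝ) : ℂ) *
        ∑ b ∈ Finset.range d, (cexp (-(π * Complex.I * k / 6)) ^ (b * d))⁻¹ *
        theta k f (affineMap a b d z)) := by
  obtain ⟨K, hK⟩ := hk12
  obtain ⟨q₀, hq₀⟩ : (12 : ℤ) ∣ k * ((d : ℤ) ^ 2 - 1) := by
    refine (ZMod.intCast_zmod_eq_zero_iff_dvd _ 12).1 ?_
    have := zmod_twelve_aux k a d (by
      have := (ZMod.intCast_zmod_eq_zero_iff_dvd (k * (a * d + 1) : ℤ) 12).2 ⟨K, hK⟩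
      exact_mod_cast this)
    exact_mod_cast this
  have hinj : Function.Injective (fun t : ℤ => a * t - K) := by
    intro s t hst
    have : (a : ℤ) ≠ 0 := by exact_mod_cast ha.ne'
    exact mul_left_cancel₀ this (by simpa using hst)
  rw [← hinj.hasSum_iff]
  · refine hasSum_of_eq ((hasSum_hecke_inner hk₁ hk₂ hf hA h ha hd hq₀ hK z).mul_left _) fun t => ?_
    simp only [Function.comp_apply]
    rw [thetaTerm_apply ha R c t hq₀ hK]
    -- The normalisation `m^{-1/2}`, the character sum `d` and the scaling `√(a/d)` cancel, so no
    -- power of `a` or `d` enters the formula.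
    have hs : (1 / √((a * d : ℕ) : ℝ)) * (d * √((a : ℝ) / d)) = 1 := by
      have ha' : 0 < √(a : ℝ) := Real.sqrt_pos.2 (by exact_mod_cast ha)
      have hd' : 0 < √(d : ℝ) := Real.sqrt_pos.2 (by exact_mod_cast hd)
      have hdd : √(d : ℝ) * √(d : ℝ) = d := Real.mul_self_sqrt (by positivity)
      push_cast
      rw [Real.sqrt_mul (by positivity), Real.sqrt_div (by positivity)]
      field_simp
      rw [sq, hdd]
    have hs' := congrArg (Complex.ofReal) hs
    push_cast at hs' ⊢
    linear_combination (c (q₀ - d * t) * lambdaFactor k R (q₀ - d * t) *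
      fourierW k R (a * t - K) z) * hs'
  · intro n hn
    rw [thetaTerm, if_neg, zero_mul]
    have hK2 : (k : ℤ) * (((a * d : ℕ) : ℤ) + 1) / 12 = K := by
      push_cast
      rw [hK, Int.mul_ediv_cancel_left _ (by norm_num)]
    rw [hK2]
    rintro ⟨t, ht⟩
    exact hn ⟨t, by simp only; omega⟩

lemma hasFourierExpansion_heckeTheta {k m : ℕ} (hk₁ : 1 ≤ k) (hk₂ : k ≤ 11) (hm : 0 < m)
    (hkm : (12 : ℤ) ∣ k * (m + 1)) {R : ℝ} {f : ℍ → ℂ} {c : ℤ → ℂ}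
    (hf : Smooth f) (hA : IsAut (chrSL k) k f) (h : HasFourierExpansion k R f c) :
    HasFourierExpansion k R (heckeTheta k m f) (thetaCoeff k m R c) := by
  intro z
  have hdiv : ∀ d ∈ m.divisors, 0 < m / d ∧ 0 < d ∧ m / d * d = m := fun d hd => by
    have hd' := Nat.dvd_of_mem_divisors hd
    have := Nat.pos_of_dvd_of_pos hd' hm
    exact ⟨Nat.div_pos (Nat.le_of_dvd hm hd') this, this, Nat.div_mul_cancel hd'⟩
  have h12 : ∀ d ∈ m.divisors, (12 : ℤ) ∣ k * ((m / d : ℕ) * d + 1) := fun d hd => by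
    have h3 := (hdiv d hd).2.2
    have h4 : (((m / d : ℕ) : ℤ) * d) = m := by exact_mod_cast h3
    rwa [h4]
  have h1 := hasSum_sum (s := m.divisors) fun d hd =>
    (hasSum_hecke_divisor hk₁ hk₂ hf hA h (hdiv d hd).1 (hdiv d hd).2.1 (h12 d hd) z).mul_left
      (chi k d)
  have h2 : ∑ d ∈ m.divisors, chi k d * (((1 / √((m / d * d : ℕ) : ℝ) : ℝ) : ℂ) *
      ∑ b ∈ Finset.range d, (cexp (-(π * Complex.I * k / 6)) ^ (b * d))⁻¹ *
        theta k f (affineMap (m / d) b d z)) = heckeTheta k m f z := by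
    rw [heckeTheta, heckeBar, heckeOp, Finset.mul_sum]
    refine Finset.sum_congr rfl fun d hd => ?_
    rw [(hdiv d hd).2.2, mul_left_comm]
    rfl
  rw [h2] at h1
  refine hasSum_of_eq h1 fun n => ?_
  rw [thetaCoeff_eq hm, ← Nat.sum_div_divisors m (fun a => chi k a * thetaTerm k m R c a n),
    Finset.mul_sum, Finset.sum_mul]
  refine Finset.sum_congr rfl fun d hd => ?_
  rw [chi_eq_neg_one_pow_mul (h12 d hd), (hdiv d hd).2.2]
  ring

/-! ### Eigenvalues -/

lemma exists_fourierY_ne_zero (κ : ℂ) (R : ℝ) {ν : ℝ} (hν : ν ≠ 0) :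
    ∃ y : ℝ, 0 < y ∧ fourierY κ R ν y ≠ 0 := by
  obtain ⟨t, ht, h⟩ := exists_whittakerW_ne_zero κ (Complex.I * R)
  have hν' := abs_pos.2 hν
  refine ⟨t / (4 * π * |ν|), by positivity, mul_ne_zero ?_ ?_⟩
  · have := (Real.sqrt_pos.2 hν').ne'
    simpa using this
  · rwa [mul_div_cancel₀ _ (by positivity)]

/-- Coefficients are integrals over a period, compared at a height where the Whittaker factor does
not vanish. -/
lemma eq_of_hasFourierExpansion {k : ℕ} (hk₁ : 1 ≤ k) (hk₂ : k ≤ 11) {R : ℝ} {f g : ℍ → ℂ}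
    {c d : ℤ → ℂ} (hf : HasFourierExpansion k R f c) (hg : HasFourierExpansion k R g d) {μ : ℂ}
    (h : ∀ z, g z = μ * f z) (n : ℤ) : d n = μ * c n := by
  obtain ⟨y, hy, hy0⟩ := exists_fourierY_ne_zero
    (((k : ℝ) / 2 * Real.sign ((n : ℝ) + k / 12) : ℝ) : ℂ) R (cast_add_ne_zero hk₁ hk₂ n)
  have hf' : HasFourierExpansion k R g (fun n => μ * c n) := fun z => by
    rw [h z]
    exact hasSum_of_eq ((hf z).mul_left μ) fun n => by ring
  refine mul_right_cancel₀ hy0 ?_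
  rw [← coef_of_hasFourierExpansion hg n hy, ← coef_of_hasFourierExpansion hf' n hy]

/-- Division by `(12, k)` gives `D(m + 1) = eK` with `e` coprime to `D`. Thus `e` divides `m + 1`
and is coprime to `m`, and both `e` and `m + 1` can be dropped from the gcd with `m`. -/
lemma gcd_eq_gcd_levelD {k m K : ℕ} (hK : k * (m + 1) = 12 * K) :
    Nat.gcd m K = Nat.gcd m (levelD k) := by
  have hg : 0 < Nat.gcd 12 k := Nat.gcd_pos_of_pos_left _ (by norm_num)
  set g := Nat.gcd 12 k with hgdef
  obtain ⟨e, he⟩ : g ∣ 12 := Nat.gcd_dvd_left _ _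
  obtain ⟨D, hD⟩ : g ∣ k := Nat.gcd_dvd_right _ _
  have hD' : levelD k = D := by
    rw [levelD, ← hgdef]
    exact Nat.div_eq_of_eq_mul_right hg hD
  have hcop : Nat.Coprime e D := by
    have := Nat.coprime_div_gcd_div_gcd (m := 12) (n := k) hg
    rwa [← hgdef, Nat.div_eq_of_eq_mul_right hg he, Nat.div_eq_of_eq_mul_right hg hD] at this
  have h1 : D * (m + 1) = e * K := by
    refine Nat.eq_of_mul_eq_mul_left hg ?_
    rw [← mul_assoc, ← mul_assoc, ← hD, ← he, hK]
  have hm1 : Nat.Coprime m (m + 1) := by simp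
  have he1 : Nat.Coprime m e := hm1.coprime_dvd_right (hcop.dvd_of_dvd_mul_left ⟨K, h1⟩)
  rw [hD', ← Nat.Coprime.gcd_mul_left_cancel_right K he1.symm, ← h1,
    Nat.Coprime.gcd_mul_right_cancel_right D hm1.symm]

lemma levelD_eq_one_or_prime {k : ℕ} (hk₁ : 1 ≤ k) (hk₂ : k ≤ 11) :
    levelD k = 1 ∨ (levelD k).Prime := by
  interval_cases k <;> norm_num [levelD]

/-- At `n = 0` the index is positive. If it is below `1` it is not an integer, so the coefficient is
zero and the value of `δ_a` is irrelevant. -/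
lemma thetaDelta_mul_coeffAt {k m a : ℕ} (hk : 0 < k) (hm : 0 < m) (ha : 0 < a) (R : ℝ)
    (c : ℤ → ℂ) : thetaDelta k m R 0 a * coeffAt c (-thetaIndex k m 0 a) =
      coeffAt c (-((k : ℚ) * ((m : ℚ) + (a : ℚ) ^ 2) / (12 * (a : ℚ) ^ 2))) := by
  have hx : thetaIndex k m 0 a = (k : ℚ) * ((m : ℚ) + (a : ℚ) ^ 2) / (12 * (a : ℚ) ^ 2) := by
    simp [thetaIndex]
  rw [thetaDelta, hx]
  set x : ℚ := (k : ℚ) * ((m : ℚ) + (a : ℚ) ^ 2) / (12 * (a : ℚ) ^ 2) with hxdef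
  have hpos : 0 < x := by positivity
  split_ifs with h1
  · rw [one_mul]
  · rw [coeffAt, if_neg, mul_zero]
    intro hden
    have h2 : ((-x).num : ℚ) = -x := (Rat.den_eq_one_iff _).1 hden
    have h3 : ((-x).num : ℚ) < 0 := by rw [h2]; linarith
    have h4 : (-1 : ℚ) < ((-x).num : ℚ) := by rw [h2]; linarith
    have h5 : (-x).num < 0 := by exact_mod_cast h3
    have h6 : -1 < (-x).num := by exact_mod_cast h4
    omega

lemma thetaCoeff_zero {k m : ℕ} (hk : 0 < k) (hm : 0 < m) (hkm : (12 : ℤ) ∣ k * (m + 1)) (R : ℝ)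
    (c : ℤ → ℂ) : thetaCoeff k m R c 0 = (-1) ^ k * ∑ a ∈ (Nat.gcd m (levelD k)).divisors,
      chi k a * coeffAt c (-((k : ℚ) * ((m : ℚ) + (a : ℚ) ^ 2) / (12 * (a : ℚ) ^ 2))) := by
  obtain ⟨K, hK⟩ : 12 ∣ k * (m + 1) := by exact_mod_cast hkm
  have hK' : (k : ℤ) * ((m : ℤ) + 1) / 12 = K := by
    rw [show (k : ℤ) * ((m : ℤ) + 1) = 12 * K by exact_mod_cast hK,
      Int.mul_ediv_cancel_left _ (by norm_num)]
  rw [thetaCoeff, hK', zero_add, Int.gcd_natCast_natCast, gcd_eq_gcd_levelD hK]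
  congr 1
  refine Finset.sum_congr rfl fun a ha => ?_
  rw [mul_assoc, thetaDelta_mul_coeffAt hk hm (Nat.pos_of_mem_divisors ha)]

end MaassEta

end

theorem mainTheorem8 (k : ℕ) (hk₁ : 1 ≤ k) (hk₂ : k ≤ 11) (R : ℝ) (m : ℕ) (hm : 0 < m)
    (hkm : (k : ℤ) * (m : ℤ) ≡ -(k : ℤ) [ZMOD 12]) :
    (∀ f : ℍ → ℂ, MaassEta.IsMaassForm (MaassEta.etaMult k) k R f →
      MaassEta.IsMaassForm (MaassEta.etaMultBar k) k R (MaassEta.theta k f) ∧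
      MaassEta.IsMaassForm (MaassEta.etaMult k) k R (MaassEta.heckeTheta k m f)) ∧
    (∀ (f : ℍ → ℂ) (c : ℤ → ℂ), MaassEta.IsMaassForm (MaassEta.etaMult k) k R f →
      MaassEta.HasFourierExpansion k R f c →
      MaassEta.HasFourierExpansion k R (MaassEta.heckeTheta k m f)
        (MaassEta.thetaCoeff k m R c) ∧
      (∀ μ : ℂ, (∀ z : ℍ, MaassEta.heckeTheta k m f z = μ * f z) → c 0 ≠ 0 →
        (Nat.gcd m (MaassEta.levelD k) = 1 →
          μ = (-1) ^ k * (1 / c 0) *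
            MaassEta.coeffAt c (-((k : ℚ) * (1 + (m : ℚ)) / 12))) ∧
        (1 < Nat.gcd m (MaassEta.levelD k) →
          μ = (-1) ^ k * (1 / c 0) *
            (MaassEta.coeffAt c (-((k : ℚ) * (1 + (m : ℚ)) / 12)) +
              MaassEta.chi k (MaassEta.levelD k) *
                MaassEta.coeffAt c (-((k : ℚ) *
                  ((m : ℚ) + (MaassEta.levelD k : ℚ) ^ 2) /
                    (12 * (MaassEta.levelD k : ℚ) ^ 2))))))) := by
  have h12 : (12 : ℤ) ∣ k * (m + 1) := by
    have := hkm.symm.dvd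
    rwa [sub_neg_eq_add, ← mul_add_one] at this
  refine ⟨fun f hf => ⟨MaassEta.isMaassForm_theta hf, MaassEta.isMaassForm_heckeTheta hm hkm hf⟩,
    fun f c hf hc => ?_⟩
  have hexp := MaassEta.hasFourierExpansion_heckeTheta hk₁ hk₂ hm h12 hf.smooth hf.isAut hc
  refine ⟨hexp, fun μ hμ hc0 => ?_⟩
  have h0 := MaassEta.eq_of_hasFourierExpansion hk₁ hk₂ hc hexp hμ 0
  rw [MaassEta.thetaCoeff_zero hk₁ hm h12] at h0
  have hone : MaassEta.chi k 1 * MaassEta.coeffAt c (-((k : ℚ) * ((m : ℚ) + ((1 : ℕ) : ℚ) ^ 2) /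
      (12 * ((1 : ℕ) : ℚ) ^ 2))) = MaassEta.coeffAt c (-((k : ℚ) * (1 + (m : ℚ)) / 12)) := by
    simp [MaassEta.chi, add_comm]
  refine ⟨fun hg => ?_, fun hg => ?_⟩
  · rw [hg, Nat.divisors_one, Finset.sum_singleton, hone] at h0
    field_simp
    exact h0.symm
  -- A common factor greater than `1` with the prime `D` is `D` itself, so the divisors are `1` and
  -- `D`.
  · rcases MaassEta.levelD_eq_one_or_prime hk₁ hk₂ with hD | hD
    · simp [hD] at hg
    · have hgD : Nat.gcd m (MaassEta.levelD k) = MaassEta.levelD k :=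
        (hD.eq_one_or_self_of_dvd _ (Nat.gcd_dvd_right _ _)).resolve_left hg.ne'
      rw [hgD, hD.divisors, Finset.sum_pair hD.one_lt.ne, hone] at h0
      field_simp
      exact h0.symm
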